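/- Let $1<\alpha<2$ and let $\widehat Z$ be either $\mathbb R$ or $\mathbb T=\mathbb R/2\pi\mathbb Z$, with frequency set $Z=\mathbb R$ (Lebesgue measure), respectively $Z=\mathbb Z$ (counting measure). For a tempered distribution $u$ on $\mathbb R\times\widehat Z$ let $\widehat u(\tau,\xi)$ be its space-time Fourier transform, formally $\widehat u(\tau,\xi)=\int_{\mathbb R}\int_{\widehat Z}e^{-i(t\tau+x\xi)}u(t,x)\,dx\,dt$, and for $s,b\in\mathbb R$ put $$\|u\|_{X^{s,b}_{\widehat Z}}=\big\|\langle\xi\rangle^s\langle\tau-|\xi|^\alpha\rangle^b\,\widehat u(\tau,\xi)\big\|_{L^2_{\tau,\xi}(\mathbb R\times Z)},\qquad \langle y\rangle=1+|y|,$$ with the value $\infty$ if $\widehat u$ is not a function. Let $X^{s,b}_{\widehat Z}$ be the set of tempered distributions $u$ on $\mathbb R\times\widehat Z$ with $\|u\|_{X^{s,b}_{\widehat Z}}<\infty$. 1. There is $\varepsilon_0>0$ such that for all $s\ge\frac{2-\alpha}4$ and all $0<\varepsilon<\varepsilon_0$ there is a constant $C<\infty$ such that, for all $u_1,u_2,u_3\in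 X^{s,\frac12+\varepsilon}_{\widehat Z}$, the distributions $u_j$ are functions whose pointwise product $u_1\overline{u_2}u_3$ is a tempered distribution in $X^{s,-\frac12+\varepsilon}_{\widehat Z}$, and $$\|u_1\overline{u_2}u_3\|_{X^{s,-\frac12+\varepsilon}_{\widehat Z}}\le C\prod_{j=1}^3\|u_j\|_{X^{s,\frac12+\varepsilon}_{\widehat Z}}.$$ 2. The estimate fails for $s<\frac{2-\alpha}4$: for all real $s<\frac{2-\alpha}4$, all $\varepsilon>0$ and all $C<\infty$ there are functions $u_1,u_2,u_3\in X^{s,\frac12+\varepsilon}_{\widehat Z}$ such that $u_1\overline{u_2}u_3\in X^{s,-\frac12+\varepsilon}_{\widehat Z}$ and $$\|u_1\overline{u_2}u_3\|_{X^{s,-\frac12+\varepsilon}_{\widehat Z}}> C\prod_{j=1}^3\|u_j\|_{X^{s,\frac12+\varepsilon}_{\widehat Z}}.$$ -/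

import Mathlib

open MeasureTheory
open scoped SchwartzMap FourierTransform NNReal ENNReal

noncomputable section

namespace FractionalNLS

/-- The spatial domain: the real line `ℝ` or the circle `𝕋 = ℝ / 2πℤ`. -/
inductive SpaceDomain where
  | line
  | circle

/-- The space-time plane; coordinate `0` is the time `t`, coordinate `1` is the space variable `x`. -/
abbrev Plane : Type := EuclideanSpace ℝ (Fin 2)

/-- The measure on spatial frequencies `ξ`: Lebesgue measure on `ℝ` for the line, counting measure
on `ℤ ⊆ ℝ` for the circle. -/
def SpaceDomain.freqMeasure : SpaceDomain → Measure ℝ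
  | .line => volume
  | .circle => Measure.map (fun k : ℤ => (k : ℝ)) Measure.count

/-- The measure `dτ dξ` on space-time frequencies `(τ, ξ)`, i.e. the measure of `ℝ × ℝ` or
of `ℝ × ℤ`. -/
def SpaceDomain.spaceTimeFreqMeasure (Z : SpaceDomain) : Measure (ℝ × ℝ) :=
  (volume : Measure ℝ).prod Z.freqMeasure

/-- Tempered distributions on `ℝ × Ẑ`. For the line there is no condition. Tempered
distributions on `ℝ × 𝕋` are, as usual, the tempered distributions on the plane that are
`2π`-periodic in `x`, i.e. invariant when the test function is translated by `2π` in `x`. -/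
def SpaceDomain.IsDistribution : SpaceDomain → 𝓢'(Plane, ℂ) → Prop
  | .line, _ => True
  | .circle, u => ∀ φ ψ : 𝓢(Plane, ℂ),
      (∀ p : Plane, ψ p = φ (p + !₂[0, 2 * Real.pi])) → u ψ = u φ

/-- The function `g` of `(τ, ξ)` is the space-time Fourier transform
`g(τ, ξ) = ∫_ℝ ∫_Ẑ e^{-i (t τ + x ξ)} u(t, x) dx dt` of the tempered distribution `u`.

Mathlib's `𝓕` has the kernel `e^{-2π i (t τ + x ξ)}`, which accounts for the rescaling by `2π`.
For the line this says that the distribution `(𝓕 u)(τ / 2π, ξ / 2π)` is the function `g`.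
For the circle, `(𝓕 u)(τ / 2π, ξ / 2π)` is the sum over `k ∈ ℤ` of the measures
`g(τ, k) dτ ⊗ δ_k(ξ)`; e.g. `u = h(t) e^{i k x}` has `g(τ, k) = 2π ∫ e^{-i t τ} h(t) dt`
and `g(τ, ξ) = 0` for the other integers `ξ`. -/
def HasFourier (Z : SpaceDomain) (u : 𝓢'(Plane, ℂ)) (g : ℝ × ℝ → ℂ) : Prop :=
  ∀ χ : 𝓢(Plane, ℂ),
    Integrable (fun q : ℝ × ℝ => g q * χ !₂[q.1 / (2 * Real.pi), q.2 / (2 * Real.pi)])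
      Z.spaceTimeFreqMeasure ∧
    (2 * Real.pi : ℂ) ^ 2 * (𝓕 u) χ =
      ∫ q, g q * χ !₂[q.1 / (2 * Real.pi), q.2 / (2 * Real.pi)] ∂Z.spaceTimeFreqMeasure

/-- The bracket `⟨x⟩ = 1 + |x|`. -/
def bracket (x : ℝ) : ℝ := 1 + |x|

/-- The weight `⟨ξ⟩^s ⟨τ - |ξ|^α⟩^b` at `q = (τ, ξ)`. -/
def bourgainWeight (α s b : ℝ) (q : ℝ × ℝ) : ℝ :=
  bracket q.2 ^ s * bracket (q.1 - |q.2| ^ α) ^ b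

/-- The norm `‖⟨ξ⟩^s ⟨τ - |ξ|^α⟩^b û(τ, ξ)‖` in `L²(ℝ × ℝ)` or `L²(ℝ × ℤ)`, with the value `∞` if
`û` is not a function. The infimum runs over the functions `g` that are the Fourier transform
of `u`; they all agree almost everywhere. -/
def bourgainNorm (Z : SpaceDomain) (α s b : ℝ) (u : 𝓢'(Plane, ℂ)) : ℝ≥0∞ :=
  ⨅ (g : ℝ × ℝ → ℂ) (_ : HasFourier Z u g),
    eLpNorm (fun q => (bourgainWeight α s b q : ℂ) * g q) 2 Z.spaceTimeFreqMeasure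

/-- The space `X^{s,b}` adapted to the symbol `|ξ|^α`. -/
def bourgainSpace (Z : SpaceDomain) (α s b : ℝ) : Set 𝓢'(Plane, ℂ) :=
  {u | Z.IsDistribution u ∧ bourgainNorm Z α s b u < ∞}

/-- The tempered distribution `u` is (given by) the function `f`. -/
def IsGivenBy (u : 𝓢'(Plane, ℂ)) (f : Plane → ℂ) : Prop :=
  ∀ φ : 𝓢(Plane, ℂ), Integrable (fun p => f p * φ p) ∧ u φ = ∫ p, f p * φ p

/-- `w = u₁ ū₂ u₃`: the distributions `u₁, u₂, u₃` are functions, and `w` is the pointwise product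
of `u₁`, the complex conjugate of `u₂`, and `u₃`. -/
def IsTripleProduct (u₁ u₂ u₃ w : 𝓢'(Plane, ℂ)) : Prop :=
  ∃ f₁ f₂ f₃ : Plane → ℂ, IsGivenBy u₁ f₁ ∧ IsGivenBy u₂ f₂ ∧ IsGivenBy u₃ f₃ ∧
    IsGivenBy w (fun p => f₁ p * starRingEnd ℂ (f₂ p) * f₃ p)

end FractionalNLS

end

/-! The positive part rests on one bilinear `L²` estimate. Let A = ⟨ξ⟩^(-(2-α)/4) ⟨τ-|ξ|^α⟩^(-1/2-ε)
and B = ⟨τ-|ξ|^α⟩^(-1/2+ε). If the convolution of A² and B² is bounded, Cauchy–Schwarz gives ‖(A h₁)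
* (B h₂)‖ ≤ C ‖h₁‖ ‖h₂‖ in `L²`.

Boundedness of the kernel (`exists_bilinear_kernel_bound`): integrating in τ leaves ∫ ⟨x⟩^(-(2-α)/2)
⟨τ - |x|^α - |ξ-x|^α⟩^(-θ) dx with θ = 1 - 2ε. The phase |x|^α + |ξ-x|^α is convex and symmetric
about ξ/2, and a Bregman inequality for |x|^α (`abs_rpow_bregman`) shows that, on each side of ξ/2,
its distance to τ is at least a multiple of (x^(α/2) - y)² for some y, where the power is extended
oddly. Substituting t = x^(α/2), whose Jacobian is comparable to the factor |x|^(-(2-α)/2), bounds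
the integral by a multiple of ∫ (1+t²)^(-θ) dt, finite for θ > 1/2. This is the origin of the
exponent (2-α)/4. The integrand varies slowly on unit scale, so the sum over ℤ is controlled by the
integral over ℝ.

From two factors to three (`lintegral_ltriple_sq_le`): dualise, and move the output weight ⟨ξ⟩^s to
one of the inputs. That input and the dual function then carry B, the other two carry A. The
quadrilinear form is an inner product of two correlations, each of an A-function with a B-function.
A correlation has the same `L²` norm as the convolution, because |u v̄| = |u v|, so the complex
conjugate does no harm.

To make sense of the pointwise product, the same bilinear estimate is read in physical space with
the finite measure of density (1+t²)⁻¹(1+x²)⁻¹. Its Fourier transform π² e^(-|τ|-|ξ|) decays, so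
Schur's test gives an `L²` bound valid for line and circle alike. Hence truncations in frequency
converge in `L⁴` of this measure, their triple products converge in `L¹`, and the limit is
identified with the triple convolution on the Fourier side.

For the failure, take indicators of unit neighbourhoods of the curve τ = ξ^α over [N, N+L] with L =
N^((2-α)/2), the longest scale on which the curve is straight up to O(1). Up to constants the left
side is N^s L^(5/2) and the right side N^(3s) L^(3/2), and L exceeds any multiple of N^(2s) for
large N when s < (2-α)/4. -/

namespace FractionalNLS

/-! ### The frequency measures of the line and the circle -/

/-- A measure on a group is invariant under translation by almost every element. -/
structure IsAETranslationInvariant {G : Type*} [MeasurableSpace G] [AddCommGroup G]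
    (ν : Measure G) : Prop where
  map_add : ∀ᵐ a ∂ν, ν.map (fun x => x + a) = ν
  map_neg : ν.map (fun x => -x) = ν

theorem SpaceDomain.lintegral_circle {F : ℝ → ℝ≥0∞} (hF : Measurable F) :
    ∫⁻ x, F x ∂SpaceDomain.circle.freqMeasure = ∑' k : ℤ, F k := by
  rw [SpaceDomain.freqMeasure, lintegral_map hF (measurable_of_countable _), lintegral_count]

/-- On the circle, F(k) is compared with its average over [k, k+1). Every kernel bound below is
thereby reduced to an integral over ℝ of a function that varies slowly on unit scale. -/
theorem SpaceDomain.lintegral_freqMeasure_le (Z : SpaceDomain) {F : ℝ → ℝ≥0∞} (hF : Measurable F)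
    {C : ℝ≥0∞} (hC : 1 ≤ C) (h : ∀ x y, |x - y| ≤ 1 → F x ≤ C * F y) :
    ∫⁻ x, F x ∂Z.freqMeasure ≤ C * ∫⁻ x, F x := by
  cases Z with
  | line => exact le_mul_of_one_le_left (zero_le) hC
  | circle =>
    rw [SpaceDomain.lintegral_circle hF, ← lintegral_const_mul C hF, ← setLIntegral_univ,
      ← iUnion_Ico_intCast, lintegral_iUnion (fun i => measurableSet_Ico)
        (Set.pairwise_disjoint_Ico_intCast ℝ)]
    refine ENNReal.tsum_le_tsum fun k => ?_
    calc F k = ∫⁻ x in Set.Ico (k : ℝ) (k + 1), F k := by simp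
      _ ≤ _ := setLIntegral_mono' measurableSet_Ico fun x hx => h _ _ ?_
    rw [abs_le]
    constructor <;> linarith [hx.1, hx.2]

instance SpaceDomain.isFiniteMeasureOnCompacts_freqMeasure (Z : SpaceDomain) :
    IsFiniteMeasureOnCompacts Z.freqMeasure := by
  cases Z with
  | line => exact inferInstanceAs (IsFiniteMeasureOnCompacts (volume : Measure ℝ))
  | circle =>
    refine ⟨fun K hK => ?_⟩
    rw [SpaceDomain.freqMeasure, Measure.map_apply (measurable_of_countable _) hK.measurableSet,
      Measure.count_apply_lt_top]
    have := (Int.isClosedEmbedding_coe_real).isCompact_preimage hK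
    exact this.finite_of_discrete

instance SpaceDomain.sigmaFinite_freqMeasure (Z : SpaceDomain) : SigmaFinite Z.freqMeasure :=
  inferInstance

instance SpaceDomain.sigmaFinite_spaceTimeFreqMeasure (Z : SpaceDomain) :
    SigmaFinite Z.spaceTimeFreqMeasure :=
  inferInstanceAs (SigmaFinite ((volume : Measure ℝ).prod Z.freqMeasure))

instance SpaceDomain.isFiniteMeasureOnCompacts_spaceTimeFreqMeasure (Z : SpaceDomain) :
    IsFiniteMeasureOnCompacts Z.spaceTimeFreqMeasure :=
  inferInstanceAs (IsFiniteMeasureOnCompacts ((volume : Measure ℝ).prod Z.freqMeasure))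

/-- Counting measure on ℤ, viewed on ℝ, is preserved only by integer shifts, but these are almost
all shifts for the measure itself. The almost everywhere notion lets line and circle be treated
together. -/
theorem SpaceDomain.isAETranslationInvariant_freqMeasure (Z : SpaceDomain) :
    IsAETranslationInvariant Z.freqMeasure := by
  cases Z with
  | line =>
    exact ⟨.of_forall fun a => map_add_right_eq_self volume a, Measure.map_neg_eq_self volume⟩
  | circle =>
    have hm : Measurable (fun k : ℤ => (k : ℝ)) := measurable_of_countable _
    constructor
    · filter_upwards [ae_map_mem_range (fun k : ℤ => (k : ℝ)) (Set.countable_range _).measurableSet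
        Measure.count]
      rintro _ ⟨m, rfl⟩
      rw [SpaceDomain.freqMeasure, Measure.map_map (by fun_prop) hm]
      have : ((fun x : ℝ => x + m) ∘ fun k : ℤ => (k : ℝ)) =
          (fun k : ℤ => (k : ℝ)) ∘ (fun k => k + m) := by
        ext; simp
      rw [this, ← Measure.map_map hm (measurable_of_countable _), map_add_right_eq_self]
    · rw [SpaceDomain.freqMeasure, Measure.map_map measurable_neg hm]
      have : ((fun x : ℝ => -x) ∘ fun k : ℤ => (k : ℝ)) = (fun k : ℤ => (k : ℝ)) ∘ (fun k => -k) := by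
        ext; simp
      rw [this, ← Measure.map_map hm (measurable_of_countable _)]
      congr 1
      exact Measure.map_neg_eq_self _

theorem SpaceDomain.isAETranslationInvariant (Z : SpaceDomain) :
    IsAETranslationInvariant Z.spaceTimeFreqMeasure := by
  have h := Z.isAETranslationInvariant_freqMeasure
  constructor
  · have h1 : ∀ᵐ a ∂Z.spaceTimeFreqMeasure, Z.freqMeasure.map (fun x => x + a.2) = Z.freqMeasure :=
      Measure.quasiMeasurePreserving_snd.ae h.map_add
    filter_upwards [h1] with a ha
    rw [SpaceDomain.spaceTimeFreqMeasure]
    conv_rhs => rw [← map_add_right_eq_self (volume : Measure ℝ) a.1, ← ha]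
    rw [Measure.map_prod_map _ _ (by fun_prop) (by fun_prop)]
    rfl
  · rw [SpaceDomain.spaceTimeFreqMeasure]
    conv_rhs => rw [← Measure.map_neg_eq_self (volume : Measure ℝ), ← h.map_neg]
    rw [Measure.map_prod_map _ _ (by fun_prop) (by fun_prop)]
    rfl

set_option linter.unusedSectionVars false

/-! ### Convolutions, correlations and the weighted trilinear bound -/

section Convolution

theorem lintegral_mul_sq_le {α : Type*} [MeasurableSpace α] (μ : Measure α) {u v : α → ℝ≥0∞}
    (hu : Measurable u) (hv : Measurable v) :
    (∫⁻ x, u x * v x ∂μ) ^ 2 ≤ (∫⁻ x, u x ^ 2 ∂μ) * ∫⁻ x, v x ^ 2 ∂μ := by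
  have h := ENNReal.lintegral_mul_le_Lp_mul_Lq μ Real.HolderConjugate.two_two hu.aemeasurable
    hv.aemeasurable
  calc (∫⁻ x, u x * v x ∂μ) ^ 2 ≤ _ := pow_le_pow_left' h 2
    _ = _ := by
      rw [mul_pow, ← ENNReal.rpow_natCast, ← ENNReal.rpow_natCast, ← ENNReal.rpow_mul,
        ← ENNReal.rpow_mul]
      norm_num

/-- Converse of Cauchy–Schwarz. Testing with H cut off in height and to a set of finite measure
makes I = ∫ v² finite, so that I² ≤ K I can be divided by I. Fatou's lemma removes the cutoff. -/
theorem lintegral_sq_le_of_forall_lintegral_mul_sq_le {α : Type*} [MeasurableSpace α]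
    (μ : Measure α) [SigmaFinite μ] {H : α → ℝ≥0∞} (hH : Measurable H) {K : ℝ≥0∞}
    (h : ∀ v : α → ℝ≥0∞, Measurable v → (∫⁻ x, H x * v x ∂μ) ^ 2 ≤ K * ∫⁻ x, v x ^ 2 ∂μ) :
    ∫⁻ x, H x ^ 2 ∂μ ≤ K := by
  let v : ℕ → α → ℝ≥0∞ := fun n => (spanningSets μ n).indicator fun x => min (H x) n
  have hv : ∀ n, Measurable (v n) := fun n =>
    (hH.min measurable_const).indicator (measurableSet_spanningSets μ n)
  have hvH : ∀ n x, v n x ≤ H x := fun n x =>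
    Set.indicator_apply_le' (fun _ => min_le_left _ _) fun _ => zero_le
  have hlim : ∀ x, Filter.Tendsto (fun n => v n x ^ 2) Filter.atTop (nhds (H x ^ 2)) := by
    intro x
    refine ENNReal.Tendsto.pow ?_
    have h1 : Filter.Tendsto (fun n : ℕ => min (H x) (n : ℝ≥0∞)) Filter.atTop
        (nhds (min (H x) ∞)) := tendsto_const_nhds.min ENNReal.tendsto_nat_nhds_top
    rw [min_eq_left le_top] at h1
    refine h1.congr' ?_
    filter_upwards [Filter.eventually_ge_atTop (spanningSetsIndex μ x)] with n hn
    exact (Set.indicator_of_mem (mem_spanningSets_of_index_le μ x hn)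
      (fun x => min (H x) (n : ℝ≥0∞))).symm
  have hle : ∀ n, ∫⁻ x, v n x ^ 2 ∂μ ≤ K := by
    intro n
    set I := ∫⁻ x, v n x ^ 2 ∂μ with hI
    have hfin : I ≠ ∞ := by
      refine ne_top_of_le_ne_top (b := (n : ℝ≥0∞) ^ 2 * μ (spanningSets μ n))
        (ENNReal.mul_ne_top (by simp) (measure_spanningSets_lt_top μ n).ne) ?_
      rw [← setLIntegral_const, ← lintegral_indicator (measurableSet_spanningSets μ n)]
      refine lintegral_mono fun x => ?_
      by_cases hx : x ∈ spanningSets μ n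
      · simp only [v, Set.indicator_of_mem hx]
        gcongr
        exact min_le_right _ _
      · simp [v, Set.indicator_of_notMem hx]
    have h1 : I ≤ ∫⁻ x, H x * v n x ∂μ := lintegral_mono fun x => by
      rw [sq]
      gcongr
      exact hvH n x
    have h2 : I * I ≤ K * I := by
      rw [← sq]
      exact (pow_le_pow_left' h1 2).trans (h _ (hv n))
    by_cases h0 : I = 0
    · simp [h0]
    · exact (ENNReal.mul_le_mul_iff_left h0 hfin).1 h2
  calc ∫⁻ x, H x ^ 2 ∂μ = ∫⁻ x, Filter.liminf (fun n => v n x ^ 2) Filter.atTop ∂μ :=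
        lintegral_congr fun x => (hlim x).liminf_eq.symm
    _ ≤ Filter.liminf (fun n => ∫⁻ x, v n x ^ 2 ∂μ) Filter.atTop :=
        lintegral_liminf_le fun n => (hv n).pow_const 2
    _ ≤ K := Filter.liminf_le_of_le (by isBoundedDefault) fun b hb => by
        obtain ⟨n, hn⟩ := hb.exists
        exact hn.trans (hle n)

variable {G : Type*} [MeasurableSpace G] [AddCommGroup G] [MeasurableAdd₂ G] [MeasurableNeg G]
  {ν : Measure G}

theorem IsAETranslationInvariant.lintegral_add (h : IsAETranslationInvariant ν) :
    ∀ᵐ a ∂ν, ∀ F : G → ℝ≥0∞, Measurable F → ∫⁻ x, F (x + a) ∂ν = ∫⁻ x, F x ∂ν := by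
  filter_upwards [h.map_add] with a ha F hF
  conv_rhs => rw [← ha]
  rw [lintegral_map hF (by fun_prop)]

theorem IsAETranslationInvariant.lintegral_neg (h : IsAETranslationInvariant ν)
    {F : G → ℝ≥0∞} (hF : Measurable F) : ∫⁻ x, F (-x) ∂ν = ∫⁻ x, F x ∂ν := by
  conv_rhs => rw [← h.map_neg]
  rw [lintegral_map hF (by fun_prop)]

theorem IsAETranslationInvariant.ae_neg (h : IsAETranslationInvariant ν) {p : G → Prop}
    (hp : ∀ᵐ a ∂ν, p a) : ∀ᵐ a ∂ν, p (-a) := by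
  rw [← h.map_neg] at hp
  exact ae_of_ae_map (by fun_prop) hp

theorem IsAETranslationInvariant.lintegral_sub (h : IsAETranslationInvariant ν) :
    ∀ᵐ a ∂ν, ∀ F : G → ℝ≥0∞, Measurable F → ∫⁻ x, F (x - a) ∂ν = ∫⁻ x, F x ∂ν := by
  filter_upwards [h.ae_neg h.lintegral_add] with a ha F hF
  simpa [sub_eq_add_neg] using ha F hF

theorem IsAETranslationInvariant.lintegral_sub_left (h : IsAETranslationInvariant ν) :
    ∀ᵐ a ∂ν, ∀ F : G → ℝ≥0∞, Measurable F → ∫⁻ x, F (a - x) ∂ν = ∫⁻ x, F x ∂ν := by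
  filter_upwards [h.lintegral_add] with a ha F hF
  rw [← ha F hF, ← h.lintegral_neg (by fun_prop)]
  simp [sub_eq_neg_add]

variable [SFinite ν]

variable (ν) in
/-- The convolution of two nonnegative functions. -/
noncomputable def lconv (F H : G → ℝ≥0∞) (f : G) : ℝ≥0∞ := ∫⁻ a, F a * H (f - a) ∂ν

theorem IsAETranslationInvariant.lconv_comm (h : IsAETranslationInvariant ν)
    {F H : G → ℝ≥0∞} (hF : Measurable F) (hH : Measurable H) :
    ∀ᵐ f ∂ν, lconv ν F H f = lconv ν H F f := by
  filter_upwards [h.lintegral_sub_left] with f hf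
  rw [lconv, lconv, ← hf (fun a => H a * F (f - a)) (by fun_prop)]
  simp [mul_comm]

theorem IsAETranslationInvariant.lintegral_lconv_sq_comm (h : IsAETranslationInvariant ν)
    {F H : G → ℝ≥0∞} (hF : Measurable F) (hH : Measurable H) :
    ∫⁻ f, lconv ν F H f ^ 2 ∂ν = ∫⁻ f, lconv ν H F f ^ 2 ∂ν := by
  refine lintegral_congr_ae ?_
  filter_upwards [h.lconv_comm hF hH] with f hf
  rw [hf]

/-- Young's inequality `L² * L² → L²` with weights that have a bounded convolution. -/
theorem IsAETranslationInvariant.lintegral_lconv_sq_le (h : IsAETranslationInvariant ν)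
    {A B h₁ h₂ : G → ℝ≥0∞} (hA : Measurable A) (hB : Measurable B) (hh₁ : Measurable h₁)
    (hh₂ : Measurable h₂) {K : ℝ≥0∞} (hK : ∀ f, ∫⁻ a, A a ^ 2 * B (f - a) ^ 2 ∂ν ≤ K) :
    ∫⁻ f, lconv ν (fun a => A a * h₁ a) (fun a => B a * h₂ a) f ^ 2 ∂ν ≤
      K * ((∫⁻ a, h₁ a ^ 2 ∂ν) * ∫⁻ a, h₂ a ^ 2 ∂ν) := by
  calc ∫⁻ f, lconv ν (fun a => A a * h₁ a) (fun a => B a * h₂ a) f ^ 2 ∂ν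
      ≤ ∫⁻ f, K * ∫⁻ a, h₁ a ^ 2 * h₂ (f - a) ^ 2 ∂ν ∂ν := by
        refine lintegral_mono fun f => ?_
        have := lintegral_mul_sq_le ν (u := fun a => A a * B (f - a))
          (v := fun a => h₁ a * h₂ (f - a)) (by fun_prop) (by fun_prop)
        simp only [mul_pow] at this
        refine le_trans (le_of_eq ?_) (this.trans (mul_le_mul_left (hK f) _))
        simp only [lconv]
        congr 1
        exact lintegral_congr fun a => by ring
    _ = K * ∫⁻ a, ∫⁻ f, h₁ a ^ 2 * h₂ (f - a) ^ 2 ∂ν ∂ν := by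
        rw [lintegral_const_mul _ (by fun_prop), lintegral_lintegral_swap (by fun_prop)]
    _ = _ := by
        congr 1
        rw [← lintegral_mul_const _ (by fun_prop)]
        refine lintegral_congr_ae ?_
        filter_upwards [h.lintegral_sub] with a ha
        rw [lintegral_const_mul _ (by fun_prop), ha (fun x => h₂ x ^ 2) (by fun_prop)]

/-- Frequency form of ‖u v̄‖ = ‖u v‖. Both sides integrate F(a) F(a') H(b) H(b'), over a - b = a' -
b' on the left and a + b = a' + b' on the right. Exchanging the names b and b' turns one constraint
into the other. -/
theorem IsAETranslationInvariant.lintegral_correlation_sq (h : IsAETranslationInvariant ν)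
    {F H : G → ℝ≥0∞} (hF : Measurable F) (hH : Measurable H) :
    ∫⁻ e, (∫⁻ b, F (e + b) * H b ∂ν) ^ 2 ∂ν = ∫⁻ f, lconv ν F H f ^ 2 ∂ν := by
  calc ∫⁻ e, (∫⁻ b, F (e + b) * H b ∂ν) ^ 2 ∂ν
      = ∫⁻ e, ∫⁻ b, ∫⁻ b', F (e + b) * H b * (F (e + b') * H b') ∂ν ∂ν ∂ν := by
        refine lintegral_congr fun e => ?_
        rw [sq, ← lintegral_mul_const _ (by fun_prop)]
        exact lintegral_congr fun b => (lintegral_const_mul _ (by fun_prop)).symm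
    _ = ∫⁻ b, ∫⁻ b', ∫⁻ e, F (e + b) * H b * (F (e + b') * H b') ∂ν ∂ν ∂ν := by
        rw [lintegral_lintegral_swap (by fun_prop)]
        exact lintegral_congr fun b => lintegral_lintegral_swap (by fun_prop)
    _ = ∫⁻ b, ∫⁻ b', ∫⁻ a, F a * H b * (F (a - b + b') * H b') ∂ν ∂ν ∂ν := by
        refine lintegral_congr_ae ?_
        filter_upwards [h.lintegral_add] with b hb
        refine lintegral_congr fun b' => ?_
        rw [← hb (fun a => F a * H b * (F (a - b + b') * H b')) (by fun_prop)]
        simp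
    _ = ∫⁻ a, ∫⁻ b', ∫⁻ b, F a * H b * (F (a - b + b') * H b') ∂ν ∂ν ∂ν := by
        rw [lintegral_lintegral_swap (by fun_prop)]
        rw [lintegral_congr fun b' => lintegral_lintegral_swap (by fun_prop)]
        rw [lintegral_lintegral_swap (by fun_prop)]
    -- For fixed a and b', the substitution a' = a - b + b', a reflection followed by two
    -- translations. Next, f = a + b' replaces b'.
    _ = ∫⁻ a, ∫⁻ b', ∫⁻ a', F a * H b' * (F a' * H (a + b' - a')) ∂ν ∂ν ∂ν := by
        refine lintegral_congr_ae ?_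
        filter_upwards [h.lintegral_add] with a ha
        refine lintegral_congr_ae ?_
        filter_upwards [h.lintegral_add] with b' hb'
        have e1 := hb' (fun x => F a * H (b' + a - x) * (F x * H b')) (by fun_prop)
        have e2 := ha (fun x => F a * H (b' + a - (x + b')) * (F (x + b') * H b')) (by fun_prop)
        have e3 := h.lintegral_neg
          (F := fun x => F a * H (b' + a - (x + a + b')) * (F (x + a + b') * H b')) (by fun_prop)
        calc _ = ∫⁻ x, F a * H (b' + a - (-x + a + b')) * (F (-x + a + b') * H b') ∂ν := by
              refine lintegral_congr fun x => ?_
              congr 3 <;> abel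
          _ = ∫⁻ x, F a * H (b' + a - x) * (F x * H b') ∂ν := by rw [e3, e2, e1]
          _ = _ := by
              refine lintegral_congr fun x => ?_
              rw [add_comm a b']
              ring
    _ = ∫⁻ a, ∫⁻ f, ∫⁻ a', F a * H (f - a) * (F a' * H (f - a')) ∂ν ∂ν ∂ν := by
        refine lintegral_congr_ae ?_
        filter_upwards [h.lintegral_add] with a ha
        rw [← ha (fun f => ∫⁻ a', F a * H (f - a) * (F a' * H (f - a')) ∂ν) (by fun_prop)]
        simp [add_comm]
    _ = ∫⁻ f, lconv ν F H f ^ 2 ∂ν := by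
        rw [lintegral_lintegral_swap (by fun_prop)]
        refine lintegral_congr fun f => ?_
        simp only [lconv]
        rw [sq, ← lintegral_mul_const _ (by fun_prop)]
        exact lintegral_congr fun b => (lintegral_const_mul _ (by fun_prop))

variable (ν) in
/-- The quadrilinear form `∫∫∫ F₁(a) F₂(b) F₃(c) V(a - b + c)`. -/
noncomputable def lquad (F₁ F₂ F₃ V : G → ℝ≥0∞) : ℝ≥0∞ :=
  ∫⁻ a, ∫⁻ b, ∫⁻ c, F₁ a * F₂ b * F₃ c * V (a - b + c) ∂ν ∂ν ∂ν

theorem lquad_swap {F₁ F₂ F₃ V : G → ℝ≥0∞} (h₁ : Measurable F₁) (h₂ : Measurable F₂)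
    (h₃ : Measurable F₃) (hV : Measurable V) : lquad ν F₁ F₂ F₃ V = lquad ν F₃ F₂ F₁ V := by
  unfold lquad
  rw [lintegral_congr fun a => lintegral_lintegral_swap (by fun_prop)]
  rw [lintegral_lintegral_swap (by fun_prop)]
  rw [lintegral_congr fun a => lintegral_lintegral_swap (by fun_prop)]
  refine lintegral_congr fun c => lintegral_congr fun b => lintegral_congr fun a => ?_
  rw [show a - b + c = c - b + a by abel]
  ring

/-- With e = a - b the form becomes the inner product over e of the correlation of F₁ with F₂ and
that of V with F₃. After Cauchy–Schwarz, correlations are replaced by convolutions of the same `L²`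
norm. -/
theorem IsAETranslationInvariant.lquad_sq_le (h : IsAETranslationInvariant ν)
    {F₁ F₂ F₃ V : G → ℝ≥0∞} (h₁ : Measurable F₁) (h₂ : Measurable F₂)
    (h₃ : Measurable F₃) (hV : Measurable V) :
    lquad ν F₁ F₂ F₃ V ^ 2 ≤
      (∫⁻ f, lconv ν F₁ F₂ f ^ 2 ∂ν) * ∫⁻ f, lconv ν F₃ V f ^ 2 ∂ν := by
  have key : lquad ν F₁ F₂ F₃ V =
      ∫⁻ e, (∫⁻ b, F₁ (e + b) * F₂ b ∂ν) * ∫⁻ c, V (e + c) * F₃ c ∂ν ∂ν := by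
    unfold lquad
    rw [lintegral_lintegral_swap (by fun_prop)]
    calc _ = ∫⁻ b, ∫⁻ e, ∫⁻ c, F₁ (e + b) * F₂ b * (V (e + c) * F₃ c) ∂ν ∂ν ∂ν := by
          refine lintegral_congr_ae ?_
          filter_upwards [h.lintegral_add] with b hb
          rw [← hb (fun a => ∫⁻ c, F₁ a * F₂ b * F₃ c * V (a - b + c) ∂ν) (by fun_prop)]
          refine lintegral_congr fun e => lintegral_congr fun c => ?_
          rw [add_sub_cancel_right]
          ring
      _ = ∫⁻ e, ∫⁻ b, ∫⁻ c, F₁ (e + b) * F₂ b * (V (e + c) * F₃ c) ∂ν ∂ν ∂ν :=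
          lintegral_lintegral_swap (by fun_prop)
      _ = _ := by
          refine lintegral_congr fun e => ?_
          rw [← lintegral_mul_const _ (by fun_prop)]
          exact lintegral_congr fun b => (lintegral_const_mul _ (by fun_prop))
  rw [key, ← h.lintegral_correlation_sq h₁ h₂, h.lintegral_lconv_sq_comm h₃ hV,
    ← h.lintegral_correlation_sq hV h₃]
  exact lintegral_mul_sq_le ν (by fun_prop) (by fun_prop)

variable (ν) in
/-- The trilinear convolution `∫∫ F₁(a) F₂(b) F₃(q - a + b)`. -/
noncomputable def ltriple (F₁ F₂ F₃ : G → ℝ≥0∞) (q : G) : ℝ≥0∞ :=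
  ∫⁻ a, ∫⁻ b, F₁ a * F₂ b * F₃ (q - a + b) ∂ν ∂ν

theorem measurable_ltriple {F₁ F₂ F₃ : G → ℝ≥0∞} (h₁ : Measurable F₁) (h₂ : Measurable F₂)
    (h₃ : Measurable F₃) : Measurable (ltriple ν F₁ F₂ F₃) := by
  unfold ltriple
  fun_prop

theorem IsAETranslationInvariant.lintegral_ltriple_mul (h : IsAETranslationInvariant ν)
    {F₁ F₂ F₃ V : G → ℝ≥0∞} (h₁ : Measurable F₁) (h₂ : Measurable F₂)
    (h₃ : Measurable F₃) (hV : Measurable V) :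
    ∫⁻ q, ltriple ν F₁ F₂ F₃ q * V q ∂ν = lquad ν F₁ F₂ F₃ V := by
  unfold ltriple lquad
  calc _ = ∫⁻ q, ∫⁻ a, ∫⁻ b, F₁ a * F₂ b * F₃ (q - a + b) * V q ∂ν ∂ν ∂ν := by
        refine lintegral_congr fun q => ?_
        rw [← lintegral_mul_const _ (by fun_prop)]
        exact lintegral_congr fun a => (lintegral_mul_const _ (by fun_prop)).symm
    _ = ∫⁻ a, ∫⁻ b, ∫⁻ q, F₁ a * F₂ b * F₃ (q - a + b) * V q ∂ν ∂ν ∂ν := by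
        rw [lintegral_lintegral_swap (by fun_prop)]
        exact lintegral_congr fun a => lintegral_lintegral_swap (by fun_prop)
    _ = _ := by
        refine lintegral_congr_ae ?_
        filter_upwards [h.lintegral_add] with a ha
        refine lintegral_congr_ae ?_
        filter_upwards [h.lintegral_sub] with b hb
        rw [← ha (fun q => F₁ a * F₂ b * F₃ (q - a + b) * V q) (by fun_prop),
          ← hb (fun q => F₁ a * F₂ b * F₃ (q + a - a + b) * V (q + a)) (by fun_prop)]
        refine lintegral_congr fun q => ?_
        rw [show q - b + a - a + b = q by abel, show q - b + a = a - b + q by abel]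

/-- The weighted `L²` bound for trilinear convolutions. -/
theorem IsAETranslationInvariant.lintegral_ltriple_sq_le [SigmaFinite ν]
    (h : IsAETranslationInvariant ν)
    {A B S : G → ℝ≥0∞} (hA : Measurable A) (hB : Measurable B) (hS : Measurable S) {K M : ℝ≥0∞}
    (hK : ∀ f, ∫⁻ a, A a ^ 2 * B (f - a) ^ 2 ∂ν ≤ K)
    (hM : ∀ a b c, S (a - b + c) ≤ M * (S a + S b + S c))
    {F₁ F₂ F₃ h₁ h₂ h₃ : G → ℝ≥0∞} (mF₁ : Measurable F₁) (mF₂ : Measurable F₂) (mF₃ : Measurable F₃)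
    (mh₁ : Measurable h₁) (mh₂ : Measurable h₂) (mh₃ : Measurable h₃)
    (hA₁ : ∀ a, F₁ a ≤ A a * h₁ a) (hA₂ : ∀ a, F₂ a ≤ A a * h₂ a) (hA₃ : ∀ a, F₃ a ≤ A a * h₃ a)
    (hB₁ : ∀ a, S a * F₁ a ≤ B a * h₁ a) (hB₂ : ∀ a, S a * F₂ a ≤ B a * h₂ a)
    (hB₃ : ∀ a, S a * F₃ a ≤ B a * h₃ a) :
    ∫⁻ q, (S q * B q * ltriple ν F₁ F₂ F₃ q) ^ 2 ∂ν ≤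
      9 * M ^ 2 * K ^ 2 * ((∫⁻ a, h₁ a ^ 2 ∂ν) * (∫⁻ a, h₂ a ^ 2 ∂ν) * ∫⁻ a, h₃ a ^ 2 ∂ν) := by
  refine lintegral_sq_le_of_forall_lintegral_mul_sq_le ν
    ((hS.mul hB).mul (measurable_ltriple mF₁ mF₂ mF₃)) fun v mv => ?_
  set N := (∫⁻ a, h₁ a ^ 2 ∂ν) * (∫⁻ a, h₂ a ^ 2 ∂ν) * (∫⁻ a, h₃ a ^ 2 ∂ν) * ∫⁻ a, v a ^ 2 ∂ν
    with hN
  -- The three terms correspond to the input that receives the weight S. In each, two functions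
  -- carry A and two carry B, and they must be paired so that every convolution contains one of
  -- each.
  have b₁ : lquad ν (fun a => B a * h₁ a) (fun a => A a * h₂ a) (fun a => A a * h₃ a)
      (fun a => B a * v a) ^ 2 ≤ K ^ 2 * N := by
    refine (h.lquad_sq_le (by fun_prop) (by fun_prop) (by fun_prop) (by fun_prop)).trans ?_
    rw [h.lintegral_lconv_sq_comm (by fun_prop) (by fun_prop)]
    refine (mul_le_mul' (h.lintegral_lconv_sq_le hA hB mh₂ mh₁ hK)
      (h.lintegral_lconv_sq_le hA hB mh₃ mv hK)).trans (le_of_eq ?_)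
    rw [hN]
    ring
  have b₂ : lquad ν (fun a => A a * h₁ a) (fun a => B a * h₂ a) (fun a => A a * h₃ a)
      (fun a => B a * v a) ^ 2 ≤ K ^ 2 * N := by
    refine (h.lquad_sq_le (by fun_prop) (by fun_prop) (by fun_prop) (by fun_prop)).trans ?_
    refine (mul_le_mul' (h.lintegral_lconv_sq_le hA hB mh₁ mh₂ hK)
      (h.lintegral_lconv_sq_le hA hB mh₃ mv hK)).trans (le_of_eq ?_)
    rw [hN]
    ring
  have b₃ : lquad ν (fun a => A a * h₁ a) (fun a => A a * h₂ a) (fun a => B a * h₃ a)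
      (fun a => B a * v a) ^ 2 ≤ K ^ 2 * N := by
    -- Pairing the first input with the second would put A with A and B with B, so the first and
    -- third inputs are exchanged.
    rw [lquad_swap (by fun_prop) (by fun_prop) (by fun_prop) (by fun_prop)]
    refine (h.lquad_sq_le (by fun_prop) (by fun_prop) (by fun_prop) (by fun_prop)).trans ?_
    rw [h.lintegral_lconv_sq_comm (by fun_prop) (by fun_prop)]
    refine (mul_le_mul' (h.lintegral_lconv_sq_le hA hB mh₂ mh₃ hK)
      (h.lintegral_lconv_sq_le hA hB mh₁ mv hK)).trans (le_of_eq ?_)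
    rw [hN]
    ring
  set x := lquad ν (fun a => B a * h₁ a) (fun a => A a * h₂ a) (fun a => A a * h₃ a)
      (fun a => B a * v a) with hx
  set y := lquad ν (fun a => A a * h₁ a) (fun a => B a * h₂ a) (fun a => A a * h₃ a)
      (fun a => B a * v a) with hy
  set z := lquad ν (fun a => A a * h₁ a) (fun a => A a * h₂ a) (fun a => B a * h₃ a)
      (fun a => B a * v a) with hz
  -- The output weight S is spread over the inputs by `hM`. The input that receives it is bounded
  -- through B, the other two through A.
  have main : ∫⁻ q, S q * B q * ltriple ν F₁ F₂ F₃ q * v q ∂ν ≤ M * (x + y + z) := by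
    calc _ = ∫⁻ q, ltriple ν F₁ F₂ F₃ q * (S q * B q * v q) ∂ν :=
          lintegral_congr fun q => by ring
      _ = lquad ν F₁ F₂ F₃ (fun q => S q * B q * v q) :=
          h.lintegral_ltriple_mul mF₁ mF₂ mF₃ (by fun_prop)
      _ ≤ ∫⁻ a, ∫⁻ b, ∫⁻ c, M * (
            B a * h₁ a * (A b * h₂ b) * (A c * h₃ c) * (B (a - b + c) * v (a - b + c)) +
            A a * h₁ a * (B b * h₂ b) * (A c * h₃ c) * (B (a - b + c) * v (a - b + c)) +
            A a * h₁ a * (A b * h₂ b) * (B c * h₃ c) * (B (a - b + c) * v (a - b + c))) ∂ν ∂ν ∂ν := by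
          refine lintegral_mono fun a => lintegral_mono fun b => lintegral_mono fun c => ?_
          calc _ = F₁ a * F₂ b * F₃ c * (S (a - b + c) * B (a - b + c) * v (a - b + c)) := rfl
            _ ≤ F₁ a * F₂ b * F₃ c * (M * (S a + S b + S c) * B (a - b + c) * v (a - b + c)) := by
                gcongr
                exact hM a b c
            _ = M * (
              S a * F₁ a * F₂ b * F₃ c * (B (a - b + c) * v (a - b + c)) +
              F₁ a * (S b * F₂ b) * F₃ c * (B (a - b + c) * v (a - b + c)) +
              F₁ a * F₂ b * (S c * F₃ c) * (B (a - b + c) * v (a - b + c))) := by ring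
            _ ≤ _ := by
              have k₁ := hA₁ a
              have k₂ := hA₂ b
              have k₃ := hA₃ c
              refine mul_le_mul' le_rfl (add_le_add (add_le_add ?_ ?_) ?_)
              · exact mul_le_mul' (mul_le_mul' (mul_le_mul' (hB₁ a) k₂) k₃) le_rfl
              · exact mul_le_mul' (mul_le_mul' (mul_le_mul' k₁ (hB₂ b)) k₃) le_rfl
              · exact mul_le_mul' (mul_le_mul' (mul_le_mul' k₁ k₂) (hB₃ c)) le_rfl
      _ = _ := by
          rw [hx, hy, hz]
          unfold lquad
          rw [← lintegral_add_left (by fun_prop), ← lintegral_add_left (by fun_prop),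
            ← lintegral_const_mul _ (by fun_prop)]
          refine lintegral_congr fun a => ?_
          rw [← lintegral_add_left (by fun_prop), ← lintegral_add_left (by fun_prop),
            ← lintegral_const_mul _ (by fun_prop)]
          refine lintegral_congr fun b => ?_
          rw [← lintegral_add_left (by fun_prop), ← lintegral_add_left (by fun_prop),
            ← lintegral_const_mul _ (by fun_prop)]
  have hsq : (x + y + z) ^ 2 ≤ 9 * (K ^ 2 * N) := by
    have hm : max x (max y z) ^ 2 ≤ K ^ 2 * N := by
      rcases max_choice x (max y z) with e | e <;> rw [e]
      · exact b₁
      · rcases max_choice y z with e | e <;> rw [e] <;> assumption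
    calc (x + y + z) ^ 2 ≤ (3 * max x (max y z)) ^ 2 := by
          gcongr
          calc x + y + z ≤ max x (max y z) + max x (max y z) + max x (max y z) := by
                gcongr <;> simp
            _ = 3 * max x (max y z) := by ring
      _ = 9 * max x (max y z) ^ 2 := by ring
      _ ≤ _ := by gcongr
  calc _ ≤ (M * (x + y + z)) ^ 2 := pow_le_pow_left' main 2
    _ ≤ M ^ 2 * (9 * (K ^ 2 * N)) := by
      rw [mul_pow]
      gcongr
    _ = _ := by
      rw [hN]
      ring

end Convolution

/-! ### Quantitative convexity of |x|^α and of the phase -/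

section Convexity

/-- The odd extension of the power function. -/
noncomputable def signedRpow (p x : ℝ) : ℝ := if 0 ≤ x then x ^ p else -(-x) ^ p

theorem signedRpow_of_nonneg {p x : ℝ} (hx : 0 ≤ x) : signedRpow p x = x ^ p := if_pos hx

theorem signedRpow_neg {p : ℝ} (hp : 0 < p) (x : ℝ) : signedRpow p (-x) = -signedRpow p x := by
  rcases lt_trichotomy x 0 with h | h | h
  · simp [signedRpow, h.le, not_le.2 h]
  · simp [signedRpow, h, Real.zero_rpow hp.ne']
  · simp [signedRpow, h.le, not_le.2 h]

theorem signedRpow_of_nonpos {p x : ℝ} (hp : 0 < p) (hx : x ≤ 0) :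
    signedRpow p x = -(-x) ^ p := by
  rw [← neg_neg x, signedRpow_neg hp, signedRpow_of_nonneg (by linarith)]
  simp

theorem monotone_signedRpow {p : ℝ} (hp : 0 < p) : Monotone (signedRpow p) := by
  intro x y hxy
  rcases le_total 0 x with hx | hx
  · rw [signedRpow_of_nonneg hx, signedRpow_of_nonneg (hx.trans hxy)]
    exact Real.rpow_le_rpow hx hxy hp.le
  · rcases le_total 0 y with hy | hy
    · rw [signedRpow_of_nonneg hy, signedRpow_of_nonpos hp hx]
      have := Real.rpow_nonneg hy p
      have := Real.rpow_nonneg (neg_nonneg.2 hx) p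
      linarith
    · rw [signedRpow_of_nonpos hp hx, signedRpow_of_nonpos hp hy, neg_le_neg_iff]
      exact Real.rpow_le_rpow (by linarith) (by linarith) hp.le

theorem measurable_signedRpow (p : ℝ) : Measurable (signedRpow p) :=
  Measurable.ite measurableSet_Ici (by fun_prop) (by fun_prop)

/-- Subadditivity of t^p gives the bound 1 on each half-line. If the two points have opposite signs,
each side contributes at most 1. -/
theorem abs_signedRpow_sub_le {p : ℝ} (hp : 0 < p) (hp1 : p ≤ 1) {x y : ℝ} (h : |x - y| ≤ 1) :
    |signedRpow p x - signedRpow p y| ≤ 2 := by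
  wlog hxy : y ≤ x generalizing x y
  · rw [abs_sub_comm]
    exact this (by rwa [abs_sub_comm]) (le_of_not_ge hxy)
  have hsub : ∀ a b : ℝ, 0 ≤ b → b ≤ a → a - b ≤ 1 → a ^ p - b ^ p ≤ 1 := by
    intro a b hb hba hab
    have h1 : a ^ p ≤ (b + 1) ^ p := Real.rpow_le_rpow (hb.trans hba) (by linarith) hp.le
    have h2 := Real.rpow_add_le_add_rpow hb zero_le_one hp.le hp1
    rw [Real.one_rpow] at h2
    linarith
  rw [abs_of_nonneg (by linarith)] at h
  rw [abs_of_nonneg (sub_nonneg.2 (monotone_signedRpow hp hxy))]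
  rcases le_total 0 y with hy | hy
  · rw [signedRpow_of_nonneg hy, signedRpow_of_nonneg (hy.trans hxy)]
    linarith [hsub x y hy hxy h]
  · rcases le_total 0 x with hx | hx
    · rw [signedRpow_of_nonneg hx, signedRpow_of_nonpos hp hy]
      have h1 := Real.rpow_le_one hx (by linarith) hp.le
      have h2 := Real.rpow_le_one (neg_nonneg.2 hy) (by linarith) hp.le
      linarith
    · rw [signedRpow_of_nonpos hp hx, signedRpow_of_nonpos hp hy]
      linarith [hsub (-y) (-x) (by linarith) (by linarith) (by linarith)]

variable {α : ℝ}

/-- Write X = x^(α/2) and Y = y^(α/2). The right side is Y² + (α-1) X² - α x^(α-1) y, and weighted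
AM–GM bounds α x^(α-1) y by (2-α) Y² + 2(α-1) X Y. What remains is the perfect square (α-1)(Y-X)².
-/
theorem rpow_bregman_of_nonneg (hα₁ : 1 < α) (hα₂ : α < 2) {x y : ℝ} (hx : 0 ≤ x) (hy : 0 ≤ y) :
    (α - 1) * (y ^ (α / 2) - x ^ (α / 2)) ^ 2 ≤ y ^ α - x ^ α - α * x ^ (α - 1) * (y - x) := by
  have hα0 : α ≠ 0 := by linarith
  have e1 : y ^ α = (y ^ (α / 2)) ^ 2 := by
    rw [← Real.rpow_natCast, ← Real.rpow_mul hy]; congr 1; push_cast; ring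
  have e2 : x ^ α = (x ^ (α / 2)) ^ 2 := by
    rw [← Real.rpow_natCast, ← Real.rpow_mul hx]; congr 1; push_cast; ring
  have e3 : x ^ (α - 1) * x = (x ^ (α / 2)) ^ 2 := by
    rw [← e2]
    nth_rewrite 2 [← Real.rpow_one x]
    rw [← Real.rpow_add_of_nonneg hx (by linarith) (by linarith)]
    congr 1; ring
  -- Here x^(α-1) y = Y · Y^(2/α-1) X^(2-2/α). The last two exponents are nonnegative and sum to 1,
  -- and AM–GM is applied to them alone.
  have e4 : x ^ (α - 1) * y ≤
      y ^ (α / 2) * ((2 / α - 1) * y ^ (α / 2) + (2 - 2 / α) * x ^ (α / 2)) := by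
    have h := Real.geom_mean_le_arith_mean2_weighted (w₁ := 2 / α - 1) (w₂ := 2 - 2 / α)
      (p₁ := y ^ (α / 2)) (p₂ := x ^ (α / 2))
      (by rw [sub_nonneg, le_div_iff₀ (by linarith)]; linarith)
      (by rw [sub_nonneg, div_le_iff₀ (by linarith)]; linarith)
      (by positivity) (by positivity) (by ring)
    rw [← Real.rpow_mul hy, ← Real.rpow_mul hx] at h
    have h' := mul_le_mul_of_nonneg_left h (Real.rpow_nonneg hy (α / 2))
    refine le_trans (le_of_eq ?_) h'
    rw [← mul_assoc, ← Real.rpow_add_of_nonneg hy (by linarith), mul_comm]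
    · congr 2
      · rw [show α / 2 + α / 2 * (2 / α - 1) = 1 by field_simp; ring, Real.rpow_one]
      · field_simp
    · have : α / 2 * (2 / α - 1) = 1 - α / 2 := by field_simp
      rw [this]; linarith
  have e5 := mul_le_mul_of_nonneg_left e4 (show (0 : ℝ) ≤ α by linarith)
  have e6 : α * (y ^ (α / 2) * ((2 / α - 1) * y ^ (α / 2) + (2 - 2 / α) * x ^ (α / 2))) =
      (2 - α) * (y ^ (α / 2)) ^ 2 + 2 * (α - 1) * (y ^ (α / 2) * x ^ (α / 2)) := by
    field_simp
  rw [e6] at e5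
  rw [e1, e2]
  have e7 : α * x ^ (α - 1) * (y - x) = α * (x ^ (α - 1) * y) - α * (x ^ (α - 1) * x) := by ring
  rw [e7, e3]
  nlinarith

/-- Quantitative convexity of `|x| ^ α`. -/
theorem abs_rpow_bregman (hα₁ : 1 < α) (hα₂ : α < 2) (x y : ℝ) :
    (α - 1) / 2 * (signedRpow (α / 2) y - signedRpow (α / 2) x) ^ 2 ≤
      |y| ^ α - |x| ^ α - α * signedRpow (α - 1) x * (y - x) := by
  wlog hx : 0 ≤ x generalizing x y
  · have := this (-x) (-y) (by linarith)
    rw [signedRpow_neg (by linarith), signedRpow_neg (by linarith), signedRpow_neg (by linarith),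
      abs_neg, abs_neg] at this
    linarith
  rw [signedRpow_of_nonneg hx, signedRpow_of_nonneg hx, abs_of_nonneg hx]
  rcases le_total 0 y with hy | hy
  · rw [signedRpow_of_nonneg hy, abs_of_nonneg hy]
    have := rpow_bregman_of_nonneg hα₁ hα₂ hx hy
    nlinarith [sq_nonneg (y ^ (α / 2) - x ^ (α / 2))]
  -- For opposite signs the mixed term α x^(α-1) |y| has the favourable sign and is dropped, leaving
  -- at least (α-1)(a² + b²). The inequality (a+b)² ≤ 2(a² + b²) accounts for the factor 1/2.
  · rw [signedRpow_of_nonpos (by linarith) hy, abs_of_nonpos hy]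
    have hz : 0 ≤ -y := by linarith
    have e1 : (-y) ^ α = ((-y) ^ (α / 2)) ^ 2 := by
      rw [← Real.rpow_natCast, ← Real.rpow_mul hz]; congr 1; push_cast; ring
    have e2 : x ^ α = (x ^ (α / 2)) ^ 2 := by
      rw [← Real.rpow_natCast, ← Real.rpow_mul hx]; congr 1; push_cast; ring
    have e3 : x ^ (α - 1) * x = (x ^ (α / 2)) ^ 2 := by
      rw [← e2]
      nth_rewrite 2 [← Real.rpow_one x]
      rw [← Real.rpow_add_of_nonneg hx (by linarith) (by linarith)]
      congr 1; ring
    have e4 : 0 ≤ α * (x ^ (α - 1) * -y) := by positivity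
    have e7 : α * x ^ (α - 1) * (y - x) = -(α * (x ^ (α - 1) * -y)) - α * (x ^ (α - 1) * x) := by
      ring
    rw [e7, e3, e1, e2]
    set a := (-y) ^ (α / 2)
    set b := x ^ (α / 2)
    have h1 : (α - 1) / 2 * (-a - b) ^ 2 ≤ (α - 1) * (a ^ 2 + b ^ 2) := by
      nlinarith [sq_nonneg (a - b)]
    nlinarith [sq_nonneg a, sq_nonneg b]

/-- Add the Bregman inequalities at x₀ and at ξ - x₀. The linear terms combine to a multiple of the
derivative of the phase at x₀ times x₁ - x₀, which is nonnegative to the right of the vertex ξ/2. -/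
theorem phase_sub_ge (hα₁ : 1 < α) (hα₂ : α < 2) {ξ x₀ x₁ : ℝ} (h₀ : ξ / 2 ≤ x₀) (h₁ : x₀ ≤ x₁) :
    (α - 1) / 2 * (signedRpow (α / 2) x₁ - signedRpow (α / 2) x₀) ^ 2 ≤
      (|x₁| ^ α + |ξ - x₁| ^ α) - (|x₀| ^ α + |ξ - x₀| ^ α) := by
  have b1 := abs_rpow_bregman hα₁ hα₂ x₀ x₁
  have b2 := abs_rpow_bregman hα₁ hα₂ (ξ - x₀) (ξ - x₁)
  have b3 : 0 ≤ (α - 1) / 2 *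
      (signedRpow (α / 2) (ξ - x₁) - signedRpow (α / 2) (ξ - x₀)) ^ 2 := by
    have : 0 < α - 1 := by linarith
    positivity
  have b4 : signedRpow (α - 1) (ξ - x₀) ≤ signedRpow (α - 1) x₀ :=
    monotone_signedRpow (by linarith) (by linarith)
  have b5 : 0 ≤ α * (signedRpow (α - 1) x₀ - signedRpow (α - 1) (ξ - x₀)) * (x₁ - x₀) :=
    mul_nonneg (mul_nonneg (by linarith) (by linarith)) (by linarith)
  nlinarith

/-- Let z be the point of [ξ/2, ∞) where the phase equals τ, or the vertex ξ/2 if τ does not exceed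
the minimum. Then y is the signed power of z, and `phase_sub_ge` compares any x with z. -/
theorem exists_forall_le_abs_phase_sub (hα₁ : 1 < α) (hα₂ : α < 2) (ξ τ : ℝ) :
    ∃ y, ∀ x, ξ / 2 ≤ x → (α - 1) / 2 * (signedRpow (α / 2) x - y) ^ 2 ≤
      |τ - (|x| ^ α + |ξ - x| ^ α)| := by
  set f : ℝ → ℝ := fun x => |x| ^ α + |ξ - x| ^ α with hf
  have hfc : Continuous f :=
    (continuous_abs.rpow_const fun _ => Or.inr (by linarith)).add
      ((continuous_const.sub continuous_id).abs.rpow_const fun _ => Or.inr (by linarith))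
  rcases le_total τ (f (ξ / 2)) with hτ | hτ
  · refine ⟨signedRpow (α / 2) (ξ / 2), fun x hx => ?_⟩
    have := phase_sub_ge hα₁ hα₂ le_rfl hx
    rw [abs_sub_comm]
    exact this.trans (le_trans (by simp only [hf] at hτ; linarith) (le_abs_self _))
  · set X := max (ξ / 2) (max 1 τ) with hX
    have h1 : (1 : ℝ) ≤ X := (le_max_left 1 τ).trans (le_max_right _ _)
    have h2 : τ ≤ f X := by
      have h3 : X ≤ X ^ α := by
        nth_rewrite 1 [← Real.rpow_one X]
        exact Real.rpow_le_rpow_of_exponent_le h1 hα₁.le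
      have h4 : (0 : ℝ) ≤ |ξ - X| ^ α := by positivity
      simp only [hf]
      rw [abs_of_nonneg (by linarith : 0 ≤ X)]
      have : τ ≤ X := (le_max_right 1 τ).trans (le_max_right _ _)
      linarith
    obtain ⟨z, hz, hfz⟩ := intermediate_value_Icc (le_max_left _ _ : ξ / 2 ≤ X) hfc.continuousOn
      ⟨hτ, h2⟩
    refine ⟨signedRpow (α / 2) z, fun x hx => ?_⟩
    rw [← hfz]
    rcases le_total z x with h | h
    · rw [abs_sub_comm]
      exact (phase_sub_ge hα₁ hα₂ hz.1 h).trans (le_abs_self _)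
    · rw [← neg_sq, neg_sub]
      exact (phase_sub_ge hα₁ hα₂ hx h).trans (le_abs_self _)

end Convexity

/-! ### The kernel of the bilinear estimate -/

section Kernel

theorem one_le_bracket (x : ℝ) : 1 ≤ bracket x := by
  rw [bracket]; linarith [abs_nonneg x]

theorem bracket_pos (x : ℝ) : 0 < bracket x := zero_lt_one.trans_le (one_le_bracket x)

theorem bracket_add_le (x y : ℝ) : bracket (x + y) ≤ bracket x + bracket y := by
  simp only [bracket]; linarith [abs_add_le x y]

@[fun_prop]
theorem measurable_bracket : Measurable bracket := by
  unfold bracket; fun_prop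

theorem bracket_le_two_mul {x y : ℝ} (h : |x - y| ≤ 1) : bracket x ≤ 2 * bracket y := by
  simp only [bracket]
  linarith [abs_sub_abs_le_abs_sub x y, abs_nonneg y]

theorem lintegral_bracket_lt_top {p : ℝ} (hp : 1 < p) :
    ∫⁻ t : ℝ, ENNReal.ofReal (bracket t ^ (-p)) < ∞ := by
  have := finite_integral_one_add_norm (E := ℝ) (μ := volume) (r := p) (by simpa using hp)
  simpa [bracket] using this

/-- Since ⟨x+z⟩^θ ≤ ⟨x⟩^θ + ⟨z⟩^θ, multiplying by it cancels ⟨z⟩^(-θ) or leaves two nonpositive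
exponents of total -p, which can be given to the smaller bracket. Either way an integrable decay of
order p survives. -/
theorem bracket_mul_bracket_le {p θ : ℝ} (hθ : 0 ≤ θ) (hθ1 : θ ≤ 1) (hp : 1 ≤ p) (x z : ℝ) :
    bracket x ^ (-p) * bracket z ^ (-θ) ≤
      bracket (x + z) ^ (-θ) * (2 * bracket x ^ (-p) + bracket z ^ (-p)) := by
  have hX := one_le_bracket x
  have hZ := one_le_bracket z
  have hY := bracket_pos (x + z)
  have hXZ := bracket_add_le x z
  set X := bracket x
  set Z := bracket z
  set Y := bracket (x + z)
  have hX0 : 0 < X := by linarith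
  have hZ0 : 0 < Z := by linarith
  have h1 : Y ^ θ ≤ X ^ θ + Z ^ θ := (Real.rpow_le_rpow hY.le hXZ hθ).trans
    (Real.rpow_add_le_add_rpow hX0.le hZ0.le hθ hθ1)
  have h2 : X ^ (θ - p) * Z ^ (-θ) ≤ X ^ (-p) + Z ^ (-p) := by
    rcases le_total X Z with h | h
    · have : Z ^ (-θ) ≤ X ^ (-θ) := Real.rpow_le_rpow_of_nonpos hX0 h (by linarith)
      calc _ ≤ X ^ (θ - p) * X ^ (-θ) := by gcongr
        _ = X ^ (-p) := by rw [← Real.rpow_add hX0]; congr 1; ring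
        _ ≤ _ := by linarith [Real.rpow_nonneg hZ0.le (-p)]
    · have : X ^ (θ - p) ≤ Z ^ (θ - p) := Real.rpow_le_rpow_of_nonpos hZ0 h (by linarith)
      calc _ ≤ Z ^ (θ - p) * Z ^ (-θ) := by gcongr
        _ = Z ^ (-p) := by rw [← Real.rpow_add hZ0]; congr 1; ring
        _ ≤ _ := by linarith [Real.rpow_nonneg hX0.le (-p)]
  have h3 : X ^ (-p) * Z ^ (-θ) * Y ^ θ ≤ 2 * X ^ (-p) + Z ^ (-p) := by
    calc _ ≤ X ^ (-p) * Z ^ (-θ) * (X ^ θ + Z ^ θ) := by gcongr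
      _ = X ^ (θ - p) * Z ^ (-θ) + X ^ (-p) := by
        rw [mul_add, mul_right_comm, ← Real.rpow_add hX0, mul_assoc,
          ← Real.rpow_add hZ0]
        simp [sub_eq_neg_add]
      _ ≤ _ := by linarith
  calc _ = Y ^ (-θ) * (X ^ (-p) * Z ^ (-θ) * Y ^ θ) := by
        rw [mul_comm _ (Y ^ θ), ← mul_assoc, ← Real.rpow_add hY]
        simp
    _ ≤ _ := by gcongr

theorem lintegral_bracket_mul_bracket_le {p θ : ℝ} (hθ : 0 ≤ θ) (hθ1 : θ ≤ 1) (hp : 1 ≤ p)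
    (u w : ℝ) :
    ∫⁻ t, ENNReal.ofReal (bracket (t - u) ^ (-p) * bracket (w - t) ^ (-θ)) ≤
      (3 * ∫⁻ t, ENNReal.ofReal (bracket t ^ (-p))) * ENNReal.ofReal (bracket (w - u) ^ (-θ)) := by
  calc _ ≤ ∫⁻ t, ENNReal.ofReal (bracket (w - u) ^ (-θ)) *
        (2 * ENNReal.ofReal (bracket (t - u) ^ (-p)) +
          ENNReal.ofReal (bracket (w - t) ^ (-p))) := by
        refine lintegral_mono fun t => ?_
        have := bracket_mul_bracket_le hθ hθ1 hp (t - u) (w - t)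
        rw [show t - u + (w - t) = w - u by ring] at this
        have e0 : ∀ x r : ℝ, 0 ≤ bracket x ^ r := fun x r => Real.rpow_nonneg (bracket_pos x).le r
        rw [show (2 : ℝ≥0∞) = ENNReal.ofReal 2 by simp, ← ENNReal.ofReal_mul zero_le_two,
          ← ENNReal.ofReal_add (mul_nonneg zero_le_two (e0 _ _)) (e0 _ _),
          ← ENNReal.ofReal_mul (e0 _ _)]
        exact ENNReal.ofReal_le_ofReal this
    _ = _ := by
        rw [lintegral_const_mul _ (by fun_prop), lintegral_add_left (by fun_prop),
          lintegral_const_mul _ (by fun_prop),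
          lintegral_sub_right_eq_self (fun t => ENNReal.ofReal (bracket t ^ (-p))) u,
          lintegral_sub_left_eq_self (fun t => ENNReal.ofReal (bracket t ^ (-p))) w]
        ring

variable {α : ℝ}

/-- The weight that bounds the bilinear kernel in terms of the variable `|ξ| ^ (α / 2)`. -/
noncomputable def branchWeight (α θ y x : ℝ) : ℝ :=
  bracket x ^ (-((2 - α) / 2)) * (1 + (signedRpow (α / 2) x - y) ^ 2) ^ (-θ)

theorem measurable_branchWeight (α θ y : ℝ) : Measurable (branchWeight α θ y) := by
  have := measurable_signedRpow (α / 2)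
  unfold branchWeight
  fun_prop

theorem branchWeight_nonneg (α θ y x : ℝ) : 0 ≤ branchWeight α θ y x :=
  mul_nonneg (Real.rpow_nonneg (bracket_pos x).le _) (Real.rpow_nonneg (by positivity) _)

/-- Slow variation on unit scale, needed for the sum over ℤ. The first factor changes by at most 2.
In the second the signed power moves by at most 2, hence 1 + (·)² changes by at most a factor 9, and
18 = 2 · 9. -/
theorem branchWeight_le (hα₁ : 1 < α) (hα₂ : α < 2) {θ : ℝ} (hθ : 0 ≤ θ) (hθ1 : θ ≤ 1) (y : ℝ)
    {x x' : ℝ} (h : |x - x'| ≤ 1) : branchWeight α θ y x ≤ 18 * branchWeight α θ y x' := by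
  have h1 : bracket x ^ (-((2 - α) / 2)) ≤ 2 * bracket x' ^ (-((2 - α) / 2)) := by
    have hb : bracket x' / 2 ≤ bracket x := by
      have := bracket_le_two_mul (x := x') (y := x) (by rwa [abs_sub_comm])
      linarith
    have h' := bracket_pos x'
    calc bracket x ^ (-((2 - α) / 2)) ≤ (bracket x' / 2) ^ (-((2 - α) / 2)) :=
          Real.rpow_le_rpow_of_nonpos (by linarith) hb (by linarith)
      _ = 2 ^ ((2 - α) / 2) * bracket x' ^ (-((2 - α) / 2)) := by
          rw [Real.div_rpow h'.le zero_le_two, Real.rpow_neg zero_le_two, div_inv_eq_mul, mul_comm]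
      _ ≤ (2 : ℝ) ^ (1 : ℝ) * bracket x' ^ (-((2 - α) / 2)) := by
          gcongr
          · exact one_le_two
          · linarith
      _ = _ := by rw [Real.rpow_one]
  have h2 : (1 + (signedRpow (α / 2) x - y) ^ 2) ^ (-θ) ≤
      9 * (1 + (signedRpow (α / 2) x' - y) ^ 2) ^ (-θ) := by
    have hd := abs_signedRpow_sub_le (p := α / 2) (by linarith) (by linarith) h
    set a := signedRpow (α / 2) x
    set b := signedRpow (α / 2) x'
    have hd2 : (a - b) ^ 2 ≤ 4 := by
      rw [← sq_abs]; nlinarith [abs_nonneg (a - b)]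
    have hb : (1 + (b - y) ^ 2) / 9 ≤ 1 + (a - y) ^ 2 := by
      nlinarith [sq_nonneg (a - y + (a - b))]
    calc (1 + (a - y) ^ 2) ^ (-θ) ≤ ((1 + (b - y) ^ 2) / 9) ^ (-θ) :=
          Real.rpow_le_rpow_of_nonpos (by positivity) hb (by linarith)
      _ = 9 ^ θ * (1 + (b - y) ^ 2) ^ (-θ) := by
          rw [Real.div_rpow (by positivity) (by norm_num),
            Real.rpow_neg (show (0 : ℝ) ≤ 9 by norm_num), div_inv_eq_mul, mul_comm]
      _ ≤ (9 : ℝ) ^ (1 : ℝ) * (1 + (b - y) ^ 2) ^ (-θ) := by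
          gcongr
          norm_num
      _ = _ := by rw [Real.rpow_one]
  unfold branchWeight
  calc _ ≤ (2 * bracket x' ^ (-((2 - α) / 2))) *
        (9 * (1 + (signedRpow (α / 2) x' - y) ^ 2) ^ (-θ)) := by
        gcongr
        exact mul_nonneg zero_le_two (Real.rpow_nonneg (bracket_pos x').le _)
    _ = _ := by ring

/-- Substitute t = x^(α/2). The Jacobian (α/2) x^(-(2-α)/2) dominates the first factor of the weight
up to 2, because α/2 ≥ 1/2. This is where the exponent (2-α)/4, squared in the kernel, is exactly
what is needed. -/
theorem setLIntegral_branchWeight_le (hα₁ : 1 < α) (hα₂ : α < 2) (θ y : ℝ) :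
    ∫⁻ x in Set.Ioi 0, ENNReal.ofReal (branchWeight α θ y x) ≤
      2 * ∫⁻ t : ℝ, ENNReal.ofReal ((1 + t ^ 2) ^ (-θ)) := by
  set φ : ℝ → ℝ≥0∞ := fun t => ENNReal.ofReal ((1 + (t - y) ^ 2) ^ (-θ)) with hφ
  have hd : ∀ x ∈ Set.Ioi (0 : ℝ), HasDerivWithinAt (fun x => x ^ (α / 2))
      (α / 2 * x ^ (α / 2 - 1)) (Set.Ioi 0) x := fun x hx =>
    (Real.hasDerivAt_rpow_const (Or.inl (ne_of_gt hx))).hasDerivWithinAt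
  have hinj : Set.InjOn (fun x : ℝ => x ^ (α / 2)) (Set.Ioi 0) := fun a ha b hb hab =>
    (Real.rpow_left_inj (le_of_lt ha) (le_of_lt hb) (by linarith)).1 hab
  have hcv := lintegral_image_eq_lintegral_abs_deriv_mul measurableSet_Ioi hd hinj φ
  calc _ ≤ ∫⁻ x in Set.Ioi 0, 2 * (ENNReal.ofReal |α / 2 * x ^ (α / 2 - 1)| * φ (x ^ (α / 2))) := by
        refine setLIntegral_mono' measurableSet_Ioi fun x hx => ?_
        have hx0 : (0 : ℝ) < x := hx
        rw [hφ, ← ENNReal.ofReal_mul (abs_nonneg _), show (2 : ℝ≥0∞) = ENNReal.ofReal 2 by simp,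
          ← ENNReal.ofReal_mul zero_le_two]
        refine ENNReal.ofReal_le_ofReal ?_
        rw [branchWeight, signedRpow_of_nonneg hx0.le, ← mul_assoc]
        refine mul_le_mul_of_nonneg_right ?_ (by positivity)
        rw [abs_of_nonneg (by positivity)]
        have h1 : bracket x ^ (-((2 - α) / 2)) ≤ x ^ (-((2 - α) / 2)) :=
          Real.rpow_le_rpow_of_nonpos hx0 (by rw [bracket, abs_of_pos hx0]; linarith) (by linarith)
        rw [show α / 2 - 1 = -((2 - α) / 2) by ring]
        have := Real.rpow_nonneg hx0.le (-((2 - α) / 2))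
        nlinarith
    _ = 2 * ∫⁻ t in (fun x : ℝ => x ^ (α / 2)) '' Set.Ioi 0, φ t := by
        rw [hcv, lintegral_const_mul]
        fun_prop
    _ ≤ 2 * ∫⁻ t, φ t := by gcongr; exact Measure.restrict_le_self
    _ = _ := by
        rw [hφ, lintegral_sub_right_eq_self (fun t => ENNReal.ofReal ((1 + t ^ 2) ^ (-θ))) y]

theorem lintegral_branchWeight_le (hα₁ : 1 < α) (hα₂ : α < 2) (θ y : ℝ) :
    ∫⁻ x, ENNReal.ofReal (branchWeight α θ y x) ≤
      4 * ∫⁻ t : ℝ, ENNReal.ofReal ((1 + t ^ 2) ^ (-θ)) := by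
  have hneg : ∀ x, branchWeight α θ y (-x) = branchWeight α θ (-y) x := by
    intro x
    rw [branchWeight, branchWeight, signedRpow_neg (by linarith), bracket, bracket, abs_neg]
    congr 3
    ring
  rw [← lintegral_add_compl _ (measurableSet_Ioi : MeasurableSet (Set.Ioi (0 : ℝ))), Set.compl_Ioi,
    setLIntegral_congr Iio_ae_eq_Iic.symm]
  have h2 : ∫⁻ x in Set.Iio 0, ENNReal.ofReal (branchWeight α θ y x) =
      ∫⁻ x in Set.Ioi 0, ENNReal.ofReal (branchWeight α θ (-y) x) := by
    have := (Measure.measurePreserving_neg (volume : Measure ℝ)).setLIntegral_comp_preimage_emb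
      (MeasurableEquiv.neg ℝ).measurableEmbedding
      (fun x => ENNReal.ofReal (branchWeight α θ y x)) (Set.Iio 0)
    rw [← this]
    simp [hneg]
  rw [h2]
  calc _ ≤ _ := add_le_add (setLIntegral_branchWeight_le hα₁ hα₂ θ y)
        (setLIntegral_branchWeight_le hα₁ hα₂ θ (-y))
    _ = _ := by ring

theorem lintegral_one_add_sq_lt_top {θ : ℝ} (hθ : 1 / 2 < θ) :
    ∫⁻ t : ℝ, ENNReal.ofReal ((1 + t ^ 2) ^ (-θ)) < ∞ := by
  have := (integrable_rpow_neg_one_add_norm_sq (E := ℝ) (μ := volume) (r := 2 * θ)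
    (by simp; linarith)).lintegral_lt_top
  refine lt_of_eq_of_lt (lintegral_congr fun t => ?_) this
  congr 2
  · simp
  · ring

/-- The phase has one branch on each side of ξ/2. The left branch is the right branch for -ξ after x
↦ -x, so two centres y and y' suffice. -/
theorem phase_weight_le (hα₁ : 1 < α) (hα₂ : α < 2) {θ : ℝ} (hθ : 0 ≤ θ) (ξ τ : ℝ) :
    ∃ y y', ∀ x, bracket x ^ (-((2 - α) / 2)) *
        bracket (τ - (|x| ^ α + |ξ - x| ^ α)) ^ (-θ) ≤
      ((α - 1) / 2) ^ (-θ) * (branchWeight α θ y x + branchWeight α θ y' x) := by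
  obtain ⟨y, hy⟩ := exists_forall_le_abs_phase_sub hα₁ hα₂ ξ τ
  obtain ⟨y', hy'⟩ := exists_forall_le_abs_phase_sub hα₁ hα₂ (-ξ) τ
  have key : ∀ z x T : ℝ, (α - 1) / 2 * (signedRpow (α / 2) x - z) ^ 2 ≤ |T| →
      bracket x ^ (-((2 - α) / 2)) * bracket T ^ (-θ) ≤
        ((α - 1) / 2) ^ (-θ) * branchWeight α θ z x := by
    intro z x T h
    have h0 : 0 < (α - 1) / 2 := by linarith
    have h1 : (α - 1) / 2 * (1 + (signedRpow (α / 2) x - z) ^ 2) ≤ bracket T := by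
      rw [bracket]; linarith
    have h2 := Real.rpow_le_rpow_of_nonpos (by positivity) h1 (neg_nonpos.2 hθ)
    rw [Real.mul_rpow h0.le (by positivity)] at h2
    have h3 := mul_le_mul_of_nonneg_left h2
      (Real.rpow_nonneg (bracket_pos x).le (-((2 - α) / 2)))
    rw [branchWeight]
    linarith
  have hc : 0 ≤ ((α - 1) / 2) ^ (-θ) := Real.rpow_nonneg (by linarith) _
  refine ⟨y, -y', fun x => ?_⟩
  rw [mul_add]
  rcases le_total (ξ / 2) x with hx | hx
  · have := key y x _ (hy x hx)
    have := mul_nonneg hc (branchWeight_nonneg α θ (-y') x)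
    linarith
  · have h := hy' (-x) (by linarith)
    rw [signedRpow_neg (by linarith), abs_neg, show -ξ - -x = -(ξ - x) by ring, abs_neg,
      show (-signedRpow (α / 2) x - y') ^ 2 = (signedRpow (α / 2) x - -y') ^ 2 by ring] at h
    have := key (-y') x _ h
    have := mul_nonneg hc (branchWeight_nonneg α θ y x)
    linarith

theorem measurable_bourgainWeight (α s b : ℝ) : Measurable (bourgainWeight α s b) := by
  unfold bourgainWeight
  fun_prop

theorem bourgainWeight_pos (α s b : ℝ) (q : ℝ × ℝ) : 0 < bourgainWeight α s b q :=
  mul_pos (Real.rpow_pos_of_pos (bracket_pos _) _) (Real.rpow_pos_of_pos (bracket_pos _) _)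

/-- The kernel of the bilinear `L²` estimate is bounded. -/
theorem exists_bilinear_kernel_bound (Z : SpaceDomain) (hα₁ : 1 < α) (hα₂ : α < 2) {ε : ℝ}
    (hε : 0 < ε) (hε' : ε < 1 / 4) :
    ∃ K : ℝ≥0, ∀ f : ℝ × ℝ,
      ∫⁻ a, ENNReal.ofReal (bourgainWeight α (-((2 - α) / 4)) (-(1 / 2 + ε)) a) ^ 2 *
        ENNReal.ofReal (bourgainWeight α 0 (-1 / 2 + ε) (f - a)) ^ 2
        ∂Z.spaceTimeFreqMeasure ≤ K := by
  -- The exponents θ and p are twice the modulation exponents 1/2 - ε and 1/2 + ε. The bound ε < 1/4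
  -- serves to make θ > 1/2.
  set θ := 1 - 2 * ε with hθ
  set p := 1 + 2 * ε with hp
  set I₁ := ∫⁻ t, ENNReal.ofReal (bracket t ^ (-p)) with hI₁
  set I₂ := ∫⁻ t : ℝ, ENNReal.ofReal ((1 + t ^ 2) ^ (-θ)) with hI₂
  have hI₁f : I₁ < ∞ := lintegral_bracket_lt_top (by linarith)
  have hI₂f : I₂ < ∞ := lintegral_one_add_sq_lt_top (by linarith)
  set c : ℝ≥0∞ := ENNReal.ofReal (((α - 1) / 2) ^ (-θ)) with hc
  -- The factor 3 I₁ comes from the τ-integral, c from the convexity constant, 2 from the two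
  -- branches, 18 from passing to the frequency measure, and 4 I₂ from the substitution.
  set K : ℝ≥0∞ := 3 * I₁ * (c * (2 * (18 * (4 * I₂)))) with hK
  have hKf : K ≠ ∞ := by finiteness
  refine ⟨K.toNNReal, fun f => ?_⟩
  rw [ENNReal.coe_toNNReal hKf]
  have hpt : ∀ a : ℝ × ℝ, ENNReal.ofReal (bourgainWeight α (-((2 - α) / 4)) (-(1 / 2 + ε)) a) ^ 2 *
        ENNReal.ofReal (bourgainWeight α 0 (-1 / 2 + ε) (f - a)) ^ 2 =
      ENNReal.ofReal (bracket a.2 ^ (-((2 - α) / 2))) *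
        ENNReal.ofReal (bracket (a.1 - |a.2| ^ α) ^ (-p) *
          bracket (f.1 - |f.2 - a.2| ^ α - a.1) ^ (-θ)) := by
    intro a
    have e : ∀ x r : ℝ, (bracket x ^ r) ^ 2 = bracket x ^ (2 * r) := fun x r => by
      rw [← Real.rpow_natCast, ← Real.rpow_mul (bracket_pos x).le]; congr 1; push_cast; ring
    rw [← ENNReal.ofReal_pow (bourgainWeight_pos _ _ _ _).le,
      ← ENNReal.ofReal_pow (bourgainWeight_pos _ _ _ _).le,
      ← ENNReal.ofReal_mul (by positivity),
      ← ENNReal.ofReal_mul (Real.rpow_nonneg (bracket_pos _).le _)]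
    congr 1
    simp only [bourgainWeight, mul_pow, e, Prod.fst_sub, Prod.snd_sub]
    rw [mul_zero, Real.rpow_zero, one_mul, mul_assoc]
    congr 2
    · ring
    · congr 1; rw [hp]; ring
    · congr 1
      · congr 1; ring
      · rw [hθ]; ring
  obtain ⟨y, y', hy⟩ := phase_weight_le hα₁ hα₂ (θ := θ) (by linarith) f.2 f.1
  have hbr : ∀ z, ∫⁻ x, ENNReal.ofReal (branchWeight α θ z x) ∂Z.freqMeasure ≤ 18 * (4 * I₂) := by
    intro z
    refine (Z.lintegral_freqMeasure_le (C := 18) (measurable_branchWeight α θ z).ennreal_ofReal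
      (by norm_num) fun x x' h => ?_).trans ?_
    · rw [show (18 : ℝ≥0∞) = ENNReal.ofReal 18 by simp, ← ENNReal.ofReal_mul (by norm_num)]
      exact ENNReal.ofReal_le_ofReal (branchWeight_le hα₁ hα₂ (by linarith) (by linarith) z h)
    · gcongr
      exact lintegral_branchWeight_le hα₁ hα₂ θ z
  have hmb := measurable_branchWeight α θ
  simp_rw [hpt]
  rw [SpaceDomain.spaceTimeFreqMeasure, lintegral_prod_symm' _ (by fun_prop)]
  calc _ = ∫⁻ x, ENNReal.ofReal (bracket x ^ (-((2 - α) / 2))) *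
        (∫⁻ t, ENNReal.ofReal (bracket (t - |x| ^ α) ^ (-p) *
          bracket (f.1 - |f.2 - x| ^ α - t) ^ (-θ))) ∂Z.freqMeasure :=
        lintegral_congr fun x => lintegral_const_mul _ (by fun_prop)
    _ ≤ ∫⁻ x, 3 * I₁ * (c * (ENNReal.ofReal (branchWeight α θ y x) +
          ENNReal.ofReal (branchWeight α θ y' x))) ∂Z.freqMeasure := by
        refine lintegral_mono fun x => ?_
        refine (mul_le_mul' le_rfl (lintegral_bracket_mul_bracket_le (p := p) (θ := θ)
          (by linarith) (by linarith) (by linarith) (|x| ^ α) (f.1 - |f.2 - x| ^ α))).trans ?_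
        rw [mul_left_comm]
        refine mul_le_mul' le_rfl ?_
        rw [← ENNReal.ofReal_mul (Real.rpow_nonneg (bracket_pos _).le _),
          ← ENNReal.ofReal_add (branchWeight_nonneg _ _ _ _) (branchWeight_nonneg _ _ _ _), hc,
          ← ENNReal.ofReal_mul (Real.rpow_nonneg (by linarith) _)]
        refine ENNReal.ofReal_le_ofReal ?_
        have := hy x
        rwa [show f.1 - |f.2 - x| ^ α - |x| ^ α = f.1 - (|x| ^ α + |f.2 - x| ^ α) by ring]
    _ ≤ K := by
        rw [lintegral_const_mul _ (by fun_prop), lintegral_const_mul _ (by fun_prop),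
          lintegral_add_left (by fun_prop), hK]
        gcongr
        rw [two_mul]
        exact add_le_add (hbr y) (hbr y')

end Kernel

/-! ### The Fourier transform of (1 + x²)⁻¹ -/

section Cauchy

open Complex in
-- In this direction the integral splits at 0 into two elementary exponential integrals. The
-- transform of (1+x²)⁻¹ itself then follows by Fourier inversion.
theorem fourier_exp_neg_abs (x : ℝ) :
    𝓕 (fun y : ℝ => ((Real.exp (-(2 * Real.pi * |y|)) : ℝ) : ℂ)) x =
      (((Real.pi * (1 + x ^ 2))⁻¹ : ℝ) : ℂ) := by
  have hpi := Real.pi_pos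
  rw [Real.fourier_eq']
  set a : ℂ := 2 * Real.pi * (-1 - x * I) with ha
  set b : ℂ := 2 * Real.pi * (1 - x * I) with hb
  have hare : a.re < 0 := by simp [ha, hpi]
  have hbre : 0 < b.re := by simp [hb, hpi]
  have h1 : ∀ y ∈ Set.Ioi (0 : ℝ),
      cexp (↑(-2 * Real.pi * inner ℝ y x) * I) • ((Real.exp (-(2 * Real.pi * |y|)) : ℝ) : ℂ) =
        cexp (a * y) := by
    intro y hy
    rw [abs_of_pos hy, smul_eq_mul, ofReal_exp, ← Complex.exp_add]
    congr 1
    simp [ha]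
    ring
  have h2 : ∀ y ∈ Set.Iic (0 : ℝ),
      cexp (↑(-2 * Real.pi * inner ℝ y x) * I) • ((Real.exp (-(2 * Real.pi * |y|)) : ℝ) : ℂ) =
        cexp (b * y) := by
    intro y hy
    rw [abs_of_nonpos hy, smul_eq_mul, ofReal_exp, ← Complex.exp_add]
    congr 1
    simp [hb]
    ring
  have i1 := (integrableOn_exp_mul_complex_Ioi hare 0).congr_fun (fun y hy => (h1 y hy).symm)
    measurableSet_Ioi
  have i2 := (integrableOn_exp_mul_complex_Iic hbre 0).congr_fun (fun y hy => (h2 y hy).symm)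
    measurableSet_Iic
  rw [← intervalIntegral.integral_Iic_add_Ioi i2 i1, setIntegral_congr_fun measurableSet_Iic h2,
    setIntegral_congr_fun measurableSet_Ioi h1, integral_exp_mul_complex_Ioi hare,
    integral_exp_mul_complex_Iic hbre]
  have hpi0 : (Real.pi : ℂ) ≠ 0 := by exact_mod_cast hpi.ne'
  have n1 : (-1 - x * I : ℂ) ≠ 0 := by
    intro h; simpa using congrArg Complex.re h
  have n2 : (1 - x * I : ℂ) ≠ 0 := by
    intro h; simpa using congrArg Complex.re h
  have n3 : (1 + (x : ℂ) ^ 2) ≠ 0 := by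
    have : (0 : ℝ) < 1 + x ^ 2 := by positivity
    exact_mod_cast this.ne'
  have e : (-1 - x * I : ℂ) * (1 - x * I) = -(1 + x ^ 2) := by
    linear_combination (x : ℂ) ^ 2 * I_sq
  have : b⁻¹ - a⁻¹ = ((Real.pi : ℂ) * (1 + (x : ℂ) ^ 2))⁻¹ := by
    rw [ha, hb]
    field_simp
    linear_combination -2 * e
  simp only [ofReal_zero, mul_zero, Complex.exp_zero]
  push_cast
  rw [← this]
  simp [div_eq_mul_inv]
  ring

theorem integrable_one_add_sq_inv : Integrable fun x : ℝ => (1 + x ^ 2)⁻¹ :=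
  integrable_inv_one_add_sq

theorem integrable_exp_neg_abs : Integrable fun x : ℝ => Real.exp (-|x|) := by
  refine (integrable_one_add_sq_inv.const_mul 2).mono' (by fun_prop) (.of_forall fun x => ?_)
  have h := Real.quadratic_le_exp_of_nonneg (abs_nonneg x)
  rw [sq_abs] at h
  have hx := abs_nonneg x
  rw [Real.norm_of_nonneg (Real.exp_pos _).le, Real.exp_neg, ← div_eq_mul_inv,
    le_div_iff₀ (by positivity), inv_mul_le_iff₀ (Real.exp_pos _)]
  linarith

open Complex in
/-- The Fourier transform of `(1 + x ^ 2)⁻¹`. -/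
theorem integral_exp_mul_one_add_sq_inv (η : ℝ) :
    ∫ x : ℝ, cexp ((x * η : ℝ) * I) * (((1 + x ^ 2)⁻¹ : ℝ) : ℂ) =
      ((Real.pi * Real.exp (-|η|) : ℝ) : ℂ) := by
  have hpi := Real.pi_pos
  set F : ℝ → ℂ := fun y => ((Real.exp (-(2 * Real.pi * |y|)) : ℝ) : ℂ) with hF
  have hFc : Continuous F := by fun_prop
  have hFi : Integrable F := by
    have := (integrable_exp_neg_abs.comp_mul_left' (R := 2 * Real.pi) (by positivity)).ofReal (𝕜 := ℂ)
    refine this.congr (.of_forall fun y => ?_)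
    simp only [hF, abs_mul, abs_of_pos hpi, abs_two]
    rfl
  have hF' : 𝓕 F = fun x => (((Real.pi * (1 + x ^ 2))⁻¹ : ℝ) : ℂ) := funext fourier_exp_neg_abs
  have hF'i : Integrable (𝓕 F) := by
    rw [hF']
    refine ((integrable_one_add_sq_inv.const_mul Real.pi⁻¹).ofReal (𝕜 := ℂ)).congr
      (.of_forall fun y => ?_)
    simp
    ring
  have h := congrFun (hFc.fourierInv_fourier_eq hFi hF'i) (η / (2 * Real.pi))
  rw [hF', Real.fourierInv_eq'] at h
  have e1 : F (η / (2 * Real.pi)) = ((Real.exp (-|η|) : ℝ) : ℂ) := by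
    simp only [hF, abs_div, abs_mul, abs_of_pos hpi, abs_two]
    congr 3
    field_simp
  rw [e1] at h
  rw [ofReal_mul, ← h, ← integral_const_mul]
  refine integral_congr_ae (.of_forall fun x => ?_)
  have hpi0 : (Real.pi : ℂ) ≠ 0 := by exact_mod_cast hpi.ne'
  have e2 : 2 * Real.pi * inner ℝ x (η / (2 * Real.pi)) = x * η := by
    simp; field_simp
  simp only [e2, smul_eq_mul, mul_inv]
  push_cast
  field_simp

end Cauchy

/-! ### A finite measure on the plane with polynomially decaying density -/

section Weight

/-- The integral over the plane is an iterated integral. -/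
theorem measurePreserving_plane :
    MeasurePreserving (fun p : Plane => (p 0, p 1)) volume (volume : Measure (ℝ × ℝ)) :=
  (volume_preserving_finTwoArrow ℝ).comp (PiLp.volume_preserving_ofLp (Fin 2))

theorem measurableEmbedding_plane : MeasurableEmbedding (fun p : Plane => (p 0, p 1)) :=
  (MeasurableEquiv.finTwoArrow.measurableEmbedding).comp
    (MeasurableEquiv.toLp 2 (Fin 2 → ℝ)).symm.measurableEmbedding

/-- An integrable weight on the plane with polynomial decay. -/
noncomputable def planeWeight (p : Plane) : ℝ := (1 + p 0 ^ 2)⁻¹ * (1 + p 1 ^ 2)⁻¹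

theorem planeWeight_pos (p : Plane) : 0 < planeWeight p := by
  unfold planeWeight; positivity

theorem continuous_planeWeight : Continuous planeWeight := by
  unfold planeWeight
  refine Continuous.mul (Continuous.inv₀ (by fun_prop) fun p => ?_)
    (Continuous.inv₀ (by fun_prop) fun p => ?_) <;> positivity

theorem integrable_planeWeight : Integrable planeWeight := by
  have h := Integrable.mul_prod integrable_one_add_sq_inv integrable_one_add_sq_inv
  exact measurePreserving_plane.integrable_comp_of_integrable h

/-- The finite measure on the plane with density `planeWeight`. -/
noncomputable def planeMeasure : Measure Plane :=
  volume.withDensity fun p => ENNReal.ofReal (planeWeight p)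

instance : IsFiniteMeasure planeMeasure :=
  isFiniteMeasure_withDensity_ofReal integrable_planeWeight.2

theorem inv_planeWeight_le (p : Plane) : (planeWeight p)⁻¹ ≤ (1 + ‖p‖) ^ 4 := by
  have h0 : |p 0| ≤ ‖p‖ := PiLp.norm_apply_le p 0
  have h1 : |p 1| ≤ ‖p‖ := PiLp.norm_apply_le p 1
  have k : ∀ a : ℝ, |a| ≤ ‖p‖ → 1 + a ^ 2 ≤ (1 + ‖p‖) ^ 2 := fun a ha => by
    rw [← sq_abs]; nlinarith [abs_nonneg a]
  rw [planeWeight, mul_inv, inv_inv, inv_inv]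
  calc _ ≤ (1 + ‖p‖) ^ 2 * (1 + ‖p‖) ^ 2 := by
        gcongr
        exacts [k _ h0, k _ h1]
    _ = _ := by ring

/-- The Schwartz seminorms that control division by `planeWeight`. -/
theorem norm_le_seminorm_mul_planeWeight (φ : 𝓢(Plane, ℂ)) (p : Plane) :
    ‖φ p‖ ≤ 2 ^ 4 * (Finset.Iic ((4, 0) : ℕ × ℕ)).sup (schwartzSeminormFamily ℂ Plane ℂ) φ *
      planeWeight p := by
  have h := SchwartzMap.one_add_le_sup_seminorm_apply (𝕜 := ℂ) (m := (4, 0)) (k := 4) (n := 0)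
    le_rfl le_rfl φ p
  rw [norm_iteratedFDeriv_zero] at h
  have hw := planeWeight_pos p
  rw [← div_le_iff₀ hw, div_eq_inv_mul]
  refine le_trans ?_ h
  gcongr
  exact inv_planeWeight_le p

end Weight

/-! ### Inverse Fourier transforms and a local Plancherel bound -/

section Extension

/-- The character `e^{i (t τ + x ξ)}`. -/
noncomputable def planeWave (p : Plane) (q : ℝ × ℝ) : ℂ :=
  Complex.exp (((p 0 * q.1 + p 1 * q.2 : ℝ) : ℂ) * Complex.I)

theorem continuous_planeWave : Continuous fun z : Plane × (ℝ × ℝ) => planeWave z.1 z.2 := by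
  unfold planeWave
  fun_prop

@[fun_prop]
theorem continuous_planeWave_left (q : ℝ × ℝ) : Continuous fun p => planeWave p q := by
  unfold planeWave
  fun_prop

@[fun_prop]
theorem continuous_planeWave_right (p : Plane) : Continuous fun q => planeWave p q := by
  unfold planeWave
  fun_prop

@[simp]
theorem norm_planeWave (p : Plane) (q : ℝ × ℝ) : ‖planeWave p q‖ = 1 :=
  Complex.norm_exp_ofReal_mul_I _

theorem planeWave_add (p : Plane) (q r : ℝ × ℝ) :
    planeWave p (q + r) = planeWave p q * planeWave p r := by
  rw [planeWave, planeWave, planeWave, ← Complex.exp_add]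
  congr 1
  simp
  ring

theorem conj_planeWave (p : Plane) (q : ℝ × ℝ) :
    starRingEnd ℂ (planeWave p q) = planeWave p (-q) := by
  rw [planeWave, planeWave, ← Complex.exp_conj]
  congr 1
  simp
  ring

theorem fourierInv_apply_div (φ : 𝓢(Plane, ℂ)) (q : ℝ × ℝ) :
    (𝓕⁻ φ) !₂[q.1 / (2 * Real.pi), q.2 / (2 * Real.pi)] = ∫ p, planeWave p q * φ p := by
  rw [SchwartzMap.fourierInv_coe, Real.fourierInv_eq']
  refine integral_congr_ae (.of_forall fun p => ?_)
  have hpi := Real.pi_ne_zero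
  have : 2 * Real.pi * inner ℝ p !₂[q.1 / (2 * Real.pi), q.2 / (2 * Real.pi)] =
      p 0 * q.1 + p 1 * q.2 := by
    simp [PiLp.inner_apply]
    field_simp
  simp only [planeWave, smul_eq_mul]
  rw [this]

theorem integral_planeWave_mul_planeWeight (q : ℝ × ℝ) :
    ∫ p, planeWave p q * (planeWeight p : ℂ) =
      ((Real.pi * Real.exp (-|q.1|) * (Real.pi * Real.exp (-|q.2|)) : ℝ) : ℂ) := by
  rw [Complex.ofReal_mul, ← integral_exp_mul_one_add_sq_inv, ← integral_exp_mul_one_add_sq_inv,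
    ← integral_prod_mul, ← Measure.volume_eq_prod,
    ← measurePreserving_plane.integral_comp measurableEmbedding_plane]
  refine integral_congr_ae (.of_forall fun p => ?_)
  simp only [planeWave, planeWeight]
  push_cast
  rw [add_mul, Complex.exp_add]
  ring

/-- The function `(2π)⁻² ∫ g(q) e^{i p·q} dq` on the plane whose Fourier transform is `g`. -/
noncomputable def extension (Z : SpaceDomain) (g : ℝ × ℝ → ℂ) (p : Plane) : ℂ :=
  ((2 * Real.pi : ℂ) ^ 2)⁻¹ * ∫ q, g q * planeWave p q ∂Z.spaceTimeFreqMeasure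

variable {Z : SpaceDomain} {g : ℝ × ℝ → ℂ}

theorem integrable_mul_planeWave (hg : Integrable g Z.spaceTimeFreqMeasure) (p : Plane) :
    Integrable (fun q => g q * planeWave p q) Z.spaceTimeFreqMeasure :=
  hg.mul_bdd (c := 1) (by fun_prop) (.of_forall fun q => (norm_planeWave p q).le)

theorem continuous_extension (hg : Integrable g Z.spaceTimeFreqMeasure) :
    Continuous (extension Z g) := by
  refine continuous_const.mul (continuous_of_dominated (bound := fun q => ‖g q‖)
    (fun p => (integrable_mul_planeWave hg p).aestronglyMeasurable)
    (fun p => .of_forall fun q => by simp) hg.norm (.of_forall fun q => by fun_prop))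

theorem norm_extension_le (g : ℝ × ℝ → ℂ) (p : Plane) :
    ‖extension Z g p‖ ≤ ‖((2 * Real.pi : ℂ) ^ 2)⁻¹‖ * ∫ q, ‖g q‖ ∂Z.spaceTimeFreqMeasure := by
  rw [extension, norm_mul]
  gcongr
  refine (norm_integral_le_integral_norm _).trans (le_of_eq ?_)
  simp

theorem extension_sub {h : ℝ × ℝ → ℂ} (hg : Integrable g Z.spaceTimeFreqMeasure)
    (hh : Integrable h Z.spaceTimeFreqMeasure) (p : Plane) :
    extension Z (g - h) p = extension Z g p - extension Z h p := by
  rw [extension, extension, extension, ← mul_sub,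
    ← integral_sub (integrable_mul_planeWave hg p) (integrable_mul_planeWave hh p)]
  simp [sub_mul]

/-- The adjoint of `extension` is the Fourier transform. -/
theorem integral_extension_mul (hg : Integrable g Z.spaceTimeFreqMeasure) (φ : 𝓢(Plane, ℂ)) :
    ∫ p, extension Z g p * φ p = ((2 * Real.pi : ℂ) ^ 2)⁻¹ *
      ∫ q, g q * (𝓕⁻ φ) !₂[q.1 / (2 * Real.pi), q.2 / (2 * Real.pi)]
        ∂Z.spaceTimeFreqMeasure := by
  simp_rw [extension, mul_assoc]
  rw [integral_const_mul]
  congr 1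
  simp_rw [fourierInv_apply_div, ← integral_mul_const, ← integral_const_mul]
  rw [integral_integral_swap]
  · simp_rw [mul_assoc]
  · have h := ((φ.integrable (μ := volume)).mul_prod hg).mul_bdd (c := 1)
      (continuous_planeWave.aestronglyMeasurable) (.of_forall fun z => (norm_planeWave _ _).le)
    refine h.congr (.of_forall fun z => ?_)
    simp only [Function.uncurry]
    ring

/-- The constant in the Schur test for the kernel `π² e^{-|τ|-|ξ|}`. -/
theorem exists_exp_kernel_bound (Z : SpaceDomain) :
    ∃ D : ℝ≥0, ∀ f : ℝ × ℝ, ∫⁻ q, ENNReal.ofReal (Real.pi * Real.exp (-|(f - q).1|) *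
      (Real.pi * Real.exp (-|(f - q).2|))) ∂Z.spaceTimeFreqMeasure ≤ D := by
  set J := ∫⁻ x : ℝ, ENNReal.ofReal (Real.pi * Real.exp (-|x|)) with hJ
  have hJf : J < ∞ := (integrable_exp_neg_abs.const_mul Real.pi).lintegral_lt_top
  set D : ℝ≥0∞ := J * (ENNReal.ofReal (Real.exp 1) * J) with hD
  have hDf : D ≠ ∞ := by finiteness
  refine ⟨D.toNNReal, fun f => ?_⟩
  rw [ENNReal.coe_toNNReal hDf]
  have e : ∀ q : ℝ × ℝ, ENNReal.ofReal (Real.pi * Real.exp (-|(f - q).1|) *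
      (Real.pi * Real.exp (-|(f - q).2|))) = ENNReal.ofReal (Real.pi * Real.exp (-|f.1 - q.1|)) *
      ENNReal.ofReal (Real.pi * Real.exp (-|f.2 - q.2|)) := fun q => by
    rw [← ENNReal.ofReal_mul (by positivity)]; rfl
  simp_rw [e]
  have hsub : ∀ u : ℝ, ∫⁻ x : ℝ, ENNReal.ofReal (Real.pi * Real.exp (-|u - x|)) = J := fun u =>
    lintegral_sub_left_eq_self (fun x : ℝ => ENNReal.ofReal (Real.pi * Real.exp (-|x|))) u
  rw [SpaceDomain.spaceTimeFreqMeasure,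
    lintegral_prod_mul (f := fun x => ENNReal.ofReal (Real.pi * Real.exp (-|f.1 - x|)))
      (g := fun x => ENNReal.ofReal (Real.pi * Real.exp (-|f.2 - x|)))
      (by fun_prop) (by fun_prop), hsub, hD]
  gcongr
  refine (Z.lintegral_freqMeasure_le (C := ENNReal.ofReal (Real.exp 1)) (by fun_prop)
    (by simp) fun x y hxy => ?_).trans (by rw [hsub])
  rw [← ENNReal.ofReal_mul (Real.exp_pos 1).le]
  refine ENNReal.ofReal_le_ofReal ?_
  rw [mul_left_comm, ← Real.exp_add]
  gcongr
  have := abs_sub_abs_le_abs_sub (f.2 - y) (f.2 - x)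
  rw [show f.2 - y - (f.2 - x) = x - y by ring] at this
  linarith

/-- Schur's test: u(x) u(y) ≤ u(x)² + u(y)², and the symmetric kernel is integrated in the free
variable. -/
theorem lintegral_prod_mul_mul_kernel_le {X : Type*} [MeasurableSpace X] {ν : Measure X}
    [SFinite ν] {u : X → ℝ≥0∞} (hu : AEMeasurable u ν) {k : X → X → ℝ≥0∞}
    (hk : Measurable (Function.uncurry k)) (hsymm : ∀ x y, k x y = k y x) {D : ℝ≥0∞}
    (hD : ∀ x, ∫⁻ y, k x y ∂ν ≤ D) :
    ∫⁻ z, u z.1 * u z.2 * k z.1 z.2 ∂(ν.prod ν) ≤ 2 * D * ∫⁻ x, u x ^ 2 ∂ν := by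
  have hu1 : AEMeasurable (fun z : X × X => u z.1) (ν.prod ν) := hu.comp_fst
  have hu2 : AEMeasurable (fun z : X × X => u z.2) (ν.prod ν) := hu.comp_snd
  have hk' : Measurable fun z : X × X => k z.1 z.2 := hk
  have hkx : ∀ x, Measurable (k x) := fun x => hk.comp measurable_prodMk_left
  have hm : AEMeasurable (fun z : X × X => u z.1 ^ 2 * k z.1 z.2) (ν.prod ν) :=
    (hu1.pow_const 2).mul hk'.aemeasurable
  have half : ∫⁻ z, u z.1 ^ 2 * k z.1 z.2 ∂(ν.prod ν) ≤ D * ∫⁻ x, u x ^ 2 ∂ν := by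
    rw [lintegral_prod _ hm,
      ← lintegral_const_mul'' _ (hu.pow_const 2)]
    refine lintegral_mono fun x => ?_
    dsimp only
    rw [lintegral_const_mul _ (hkx x), mul_comm]
    gcongr
    exact hD x
  have half' : ∫⁻ z, u z.2 ^ 2 * k z.1 z.2 ∂(ν.prod ν) ≤ D * ∫⁻ x, u x ^ 2 ∂ν := by
    rw [← lintegral_prod_swap]
    refine le_of_eq_of_le (lintegral_congr fun z => ?_) half
    simp [hsymm z.1 z.2]
  calc _ ≤ ∫⁻ z, u z.1 ^ 2 * k z.1 z.2 + u z.2 ^ 2 * k z.1 z.2 ∂(ν.prod ν) := by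
        refine lintegral_mono fun z => ?_
        rw [← add_mul]
        gcongr
        rcases le_total (u z.1) (u z.2) with h | h
        · refine le_add_left ?_
          rw [sq]; gcongr
        · refine le_add_right ?_
          rw [sq]; gcongr
    _ ≤ _ := by
        rw [lintegral_add_left' hm]
        refine (add_le_add half half').trans (le_of_eq (by ring))

/-- Functions with square integrable Fourier transform are square integrable for `planeMeasure`. -/
theorem exists_local_plancherel (Z : SpaceDomain) :
    ∃ D : ℝ≥0, ∀ g : ℝ × ℝ → ℂ, Integrable g Z.spaceTimeFreqMeasure →
      ∫⁻ p, ‖extension Z g p‖ₑ ^ 2 ∂planeMeasure ≤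
        D * ∫⁻ q, ‖g q‖ₑ ^ 2 ∂Z.spaceTimeFreqMeasure := by
  obtain ⟨D, hD⟩ := exists_exp_kernel_bound Z
  set c : ℂ := ((2 * Real.pi : ℂ) ^ 2)⁻¹ with hc
  refine ⟨‖c‖₊ ^ 2 * (2 * D), fun g hg => ?_⟩
  set ν := Z.spaceTimeFreqMeasure
  set k : ℝ × ℝ → ℝ := fun q => Real.pi * Real.exp (-|q.1|) * (Real.pi * Real.exp (-|q.2|)) with hk
  have hk0 : ∀ q, 0 ≤ k q := fun q => by simp only [hk]; positivity
  have hkm : Measurable k := by fun_prop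
  have hcont := continuous_extension hg
  have hint : Integrable (fun p => planeWeight p * ‖extension Z g p‖ ^ 2) :=
    integrable_planeWeight.mul_bdd (hcont.norm.pow 2).aestronglyMeasurable
      (c := (‖c‖ * ∫ q, ‖g q‖ ∂ν) ^ 2) (.of_forall fun p => by
        rw [norm_pow, norm_norm]
        gcongr
        exact norm_extension_le g p)
  have hH : Integrable (fun z : Plane × ((ℝ × ℝ) × (ℝ × ℝ)) =>
      (planeWeight z.1 : ℂ) * (g z.2.1 * starRingEnd ℂ (g z.2.2)) *
        planeWave z.1 (z.2.1 - z.2.2)) (volume.prod (ν.prod ν)) := by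
    have hgc : Integrable (fun q => starRingEnd ℂ (g q)) ν :=
      (integrable_norm_iff (Complex.continuous_conj.comp_aestronglyMeasurable
        hg.aestronglyMeasurable)).1 (by simpa using hg.norm)
    refine (integrable_planeWeight.ofReal.mul_prod (hg.mul_prod hgc)).mul_bdd (c := 1)
      (Continuous.aestronglyMeasurable ?_) (.of_forall fun z => (norm_planeWave _ _).le)
    exact continuous_planeWave.comp (by fun_prop : Continuous fun
      z : Plane × ((ℝ × ℝ) × (ℝ × ℝ)) => (z.1, z.2.1 - z.2.2))
  -- Expand the square as a double integral over frequencies and integrate in p first. This produces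
  -- the Fourier transform k of the weight at the frequency difference. The weight is essential on
  -- the circle, where the function is periodic in x.
  have key : ((∫ p, planeWeight p * ‖extension Z g p‖ ^ 2 : ℝ) : ℂ) =
      c * starRingEnd ℂ c * ∫ z, g z.1 * starRingEnd ℂ (g z.2) * (k (z.1 - z.2) : ℂ) ∂(ν.prod ν) := by
    rw [← integral_complex_ofReal]
    calc _ = ∫ p, c * starRingEnd ℂ c * ∫ z : (ℝ × ℝ) × (ℝ × ℝ),
          (planeWeight p : ℂ) * (g z.1 * starRingEnd ℂ (g z.2)) * planeWave p (z.1 - z.2)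
            ∂(ν.prod ν) := by
          refine integral_congr_ae (.of_forall fun p => ?_)
          dsimp only
          have e1 : ∀ z : (ℝ × ℝ) × (ℝ × ℝ),
              (planeWeight p : ℂ) * (g z.1 * starRingEnd ℂ (g z.2)) * planeWave p (z.1 - z.2) =
              (planeWeight p : ℂ) * ((g z.1 * planeWave p z.1) *
                starRingEnd ℂ (g z.2 * planeWave p z.2)) := fun z => by
            rw [sub_eq_add_neg, planeWave_add, map_mul, conj_planeWave]; ring
          simp_rw [e1]
          rw [integral_const_mul, integral_prod_mul (fun q => g q * planeWave p q)
            (fun q => starRingEnd ℂ (g q * planeWave p q)), integral_conj]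
          push_cast
          rw [← Complex.mul_conj', extension, map_mul]
          ring
      _ = _ := by
          rw [integral_const_mul, integral_integral_swap hH]
          congr 1
          refine integral_congr_ae (.of_forall fun z => ?_)
          dsimp only
          rw [← integral_planeWave_mul_planeWeight, ← integral_const_mul]
          exact integral_congr_ae (.of_forall fun p => by dsimp only; ring)
  calc ∫⁻ p, ‖extension Z g p‖ₑ ^ 2 ∂planeMeasure
      = ∫⁻ p, ENNReal.ofReal (planeWeight p * ‖extension Z g p‖ ^ 2) := by
        rw [planeMeasure, lintegral_withDensity_eq_lintegral_mul _
          continuous_planeWeight.measurable.ennreal_ofReal (by fun_prop)]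
        refine lintegral_congr fun p => ?_
        rw [Pi.mul_apply, ENNReal.ofReal_mul (planeWeight_pos p).le,
          ENNReal.ofReal_pow (norm_nonneg _), ofReal_norm]
    _ = ‖((∫ p, planeWeight p * ‖extension Z g p‖ ^ 2 : ℝ) : ℂ)‖ₑ := by
        have h0 : ∀ p, 0 ≤ planeWeight p * ‖extension Z g p‖ ^ 2 := fun p =>
          mul_nonneg (planeWeight_pos p).le (by positivity)
        rw [← ofReal_integral_eq_lintegral_ofReal hint (.of_forall h0), ← ofReal_norm,
          Complex.norm_real, Real.norm_of_nonneg (integral_nonneg h0)]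
    _ ≤ ‖c‖ₑ ^ 2 * ∫⁻ z, ‖g z.1‖ₑ * ‖g z.2‖ₑ * ENNReal.ofReal (k (z.1 - z.2)) ∂(ν.prod ν) := by
        rw [key, enorm_mul, enorm_mul, sq]
        refine mul_le_mul' (le_of_eq (by simp)) ((enorm_integral_le_lintegral_enorm _).trans_eq ?_)
        refine lintegral_congr fun z => ?_
        rw [enorm_mul, enorm_mul, ← ofReal_norm ((k (z.1 - z.2) : ℂ)), Complex.norm_real,
          Real.norm_of_nonneg (hk0 _)]
        simp
    _ ≤ ‖c‖ₑ ^ 2 * (2 * D * ∫⁻ q, ‖g q‖ₑ ^ 2 ∂ν) := by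
        gcongr
        refine lintegral_prod_mul_mul_kernel_le hg.aestronglyMeasurable.enorm
          (k := fun x y => ENNReal.ofReal (k (x - y))) ?_ (fun x y => ?_) hD
        · simp only [Function.uncurry_def]
          fun_prop
        · simp only [hk, Prod.fst_sub, Prod.snd_sub]
          rw [abs_sub_comm x.1, abs_sub_comm x.2]
    _ = _ := by
        push_cast
        rw [← mul_assoc]
        rfl

end Extension

/-! ### Products in physical space as convolutions in frequency -/

section Products

theorem IsAETranslationInvariant.integral_add {G : Type*} [MeasurableSpace G] [AddCommGroup G]
    [MeasurableAdd₂ G] {ν : Measure G} (h : IsAETranslationInvariant ν) :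
    ∀ᵐ a ∂ν, ∀ F : G → ℂ, StronglyMeasurable F → ∫ x, F (x + a) ∂ν = ∫ x, F x ∂ν := by
  filter_upwards [h.map_add] with a ha F hF
  conv_rhs => rw [← ha]
  rw [integral_map (by fun_prop) hF.aestronglyMeasurable]

variable {Z : SpaceDomain} {g g₁ g₂ g₃ h : ℝ × ℝ → ℂ}

/-- The Fourier transform of the product of two functions. -/
noncomputable def convolution₂ (Z : SpaceDomain) (g h : ℝ × ℝ → ℂ) (f : ℝ × ℝ) : ℂ :=
  ((2 * Real.pi : ℂ) ^ 2)⁻¹ * ∫ a, g a * h (f - a) ∂Z.spaceTimeFreqMeasure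

/-- The Fourier transform of the product `u₁ ū₂ u₃`. -/
noncomputable def convolution₃ (Z : SpaceDomain) (g₁ g₂ g₃ : ℝ × ℝ → ℂ) (q : ℝ × ℝ) : ℂ :=
  (((2 * Real.pi : ℂ) ^ 2)⁻¹) ^ 2 * ∫ z, g₁ z.1 * starRingEnd ℂ (g₂ z.2) * g₃ (q - z.1 + z.2)
    ∂(Z.spaceTimeFreqMeasure.prod Z.spaceTimeFreqMeasure)

theorem enorm_convolution₂_le (f : ℝ × ℝ) :
    ‖convolution₂ Z g h f‖ₑ ≤ ‖((2 * Real.pi : ℂ) ^ 2)⁻¹‖ₑ *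
      lconv Z.spaceTimeFreqMeasure (fun q => ‖g q‖ₑ) (fun q => ‖h q‖ₑ) f := by
  rw [convolution₂, enorm_mul]
  gcongr
  refine (enorm_integral_le_lintegral_enorm _).trans_eq ?_
  simp [lconv]

theorem enorm_convolution₃_le (h₁ : Measurable g₁) (h₂ : Measurable g₂) (h₃ : Measurable g₃)
    (q : ℝ × ℝ) :
    ‖convolution₃ Z g₁ g₂ g₃ q‖ₑ ≤ ‖((2 * Real.pi : ℂ) ^ 2)⁻¹‖ₑ ^ 2 *
      ltriple Z.spaceTimeFreqMeasure (fun q => ‖g₁ q‖ₑ) (fun q => ‖g₂ q‖ₑ) (fun q => ‖g₃ q‖ₑ) q := by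
  have mc : Measurable (starRingEnd ℂ) := Complex.continuous_conj.measurable
  rw [convolution₃, enorm_mul, enorm_pow]
  gcongr
  refine (enorm_integral_le_lintegral_enorm _).trans_eq ?_
  rw [lintegral_prod _ (by fun_prop)]
  simp [ltriple]

theorem stronglyMeasurable_convolution₃ (h₁ : Measurable g₁) (h₂ : Measurable g₂)
    (h₃ : Measurable g₃) : StronglyMeasurable (convolution₃ Z g₁ g₂ g₃) := by
  unfold convolution₃
  refine StronglyMeasurable.const_mul (StronglyMeasurable.integral_prod_right ?_) _
  refine Measurable.stronglyMeasurable ?_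
  simp only [Function.uncurry_def]
  fun_prop

theorem integrable_convolution₂_kernel (mg : Measurable g) (mh : Measurable h)
    (hg : Integrable g Z.spaceTimeFreqMeasure) (hh : Integrable h Z.spaceTimeFreqMeasure) :
    Integrable (fun z : (ℝ × ℝ) × (ℝ × ℝ) => g z.1 * h (z.2 - z.1))
      (Z.spaceTimeFreqMeasure.prod Z.spaceTimeFreqMeasure) := by
  refine ⟨Measurable.aestronglyMeasurable (by fun_prop), ?_⟩
  rw [HasFiniteIntegral, lintegral_prod _ (by fun_prop)]
  have e : ∀ᵐ a ∂Z.spaceTimeFreqMeasure, ∫⁻ q, ‖g a * h (q - a)‖ₑ ∂Z.spaceTimeFreqMeasure =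
      ‖g a‖ₑ * ∫⁻ q, ‖h q‖ₑ ∂Z.spaceTimeFreqMeasure := by
    filter_upwards [Z.isAETranslationInvariant.lintegral_sub] with a ha
    rw [← ha (fun q => ‖h q‖ₑ) (by fun_prop), ← lintegral_const_mul _ (by fun_prop)]
    simp
  dsimp only
  rw [lintegral_congr_ae e, lintegral_mul_const _ (by fun_prop)]
  exact ENNReal.mul_lt_top hg.2 hh.2

theorem integrable_convolution₃_kernel (h₁ : Measurable g₁) (h₂ : Measurable g₂)
    (h₃ : Measurable g₃) (i₁ : Integrable g₁ Z.spaceTimeFreqMeasure)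
    (i₂ : Integrable g₂ Z.spaceTimeFreqMeasure) (i₃ : Integrable g₃ Z.spaceTimeFreqMeasure) :
    Integrable (fun z : ((ℝ × ℝ) × (ℝ × ℝ)) × (ℝ × ℝ) =>
        g₁ z.1.1 * starRingEnd ℂ (g₂ z.1.2) * g₃ (z.2 - z.1.1 + z.1.2))
      ((Z.spaceTimeFreqMeasure.prod Z.spaceTimeFreqMeasure).prod Z.spaceTimeFreqMeasure) := by
  have hc : Measurable (starRingEnd ℂ) := Complex.continuous_conj.measurable
  refine ⟨Measurable.aestronglyMeasurable (by fun_prop), ?_⟩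
  rw [HasFiniteIntegral, lintegral_prod _ (by fun_prop), lintegral_prod _ (by fun_prop)]
  have e : ∀ᵐ a ∂Z.spaceTimeFreqMeasure, ∀ᵐ b ∂Z.spaceTimeFreqMeasure,
      ∫⁻ q, ‖g₁ a * starRingEnd ℂ (g₂ b) * g₃ (q - a + b)‖ₑ ∂Z.spaceTimeFreqMeasure =
      ‖g₁ a‖ₑ * ‖g₂ b‖ₑ * ∫⁻ q, ‖g₃ q‖ₑ ∂Z.spaceTimeFreqMeasure := by
    filter_upwards [Z.isAETranslationInvariant.lintegral_sub] with a ha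
    filter_upwards [Z.isAETranslationInvariant.lintegral_add] with b hb
    rw [← hb (fun q => ‖g₃ q‖ₑ) (by fun_prop), ← ha (fun q => ‖g₃ (q + b)‖ₑ) (by fun_prop),
      ← lintegral_const_mul _ (by fun_prop)]
    simp
  have e' : ∀ᵐ a ∂Z.spaceTimeFreqMeasure, ∫⁻ b, ∫⁻ q, ‖g₁ a * starRingEnd ℂ (g₂ b) *
      g₃ (q - a + b)‖ₑ ∂Z.spaceTimeFreqMeasure ∂Z.spaceTimeFreqMeasure =
      ‖g₁ a‖ₑ * ((∫⁻ b, ‖g₂ b‖ₑ ∂Z.spaceTimeFreqMeasure) *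
        ∫⁻ q, ‖g₃ q‖ₑ ∂Z.spaceTimeFreqMeasure) := by
    filter_upwards [e] with a ha
    rw [lintegral_congr_ae ha, lintegral_mul_const _ (by fun_prop),
      lintegral_const_mul _ (by fun_prop), mul_assoc]
  dsimp only
  rw [lintegral_congr_ae e', lintegral_mul_const _ (by fun_prop)]
  exact ENNReal.mul_lt_top i₁.2 (ENNReal.mul_lt_top i₂.2 i₃.2)

theorem integrable_convolution₂ (mg : Measurable g) (mh : Measurable h)
    (hg : Integrable g Z.spaceTimeFreqMeasure) (hh : Integrable h Z.spaceTimeFreqMeasure) :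
    Integrable (convolution₂ Z g h) Z.spaceTimeFreqMeasure :=
  (integrable_convolution₂_kernel mg mh hg hh).integral_prod_right.const_mul _

theorem integrable_convolution₃ (h₁ : Measurable g₁) (h₂ : Measurable g₂)
    (h₃ : Measurable g₃) (i₁ : Integrable g₁ Z.spaceTimeFreqMeasure)
    (i₂ : Integrable g₂ Z.spaceTimeFreqMeasure) (i₃ : Integrable g₃ Z.spaceTimeFreqMeasure) :
    Integrable (convolution₃ Z g₁ g₂ g₃) Z.spaceTimeFreqMeasure :=
  (integrable_convolution₃_kernel h₁ h₂ h₃ i₁ i₂ i₃).integral_prod_right.const_mul _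

theorem extension_convolution₂ (mg : Measurable g) (mh : Measurable h)
    (hg : Integrable g Z.spaceTimeFreqMeasure) (hh : Integrable h Z.spaceTimeFreqMeasure)
    (p : Plane) : extension Z (convolution₂ Z g h) p = extension Z g p * extension Z h p := by
  set c : ℂ := ((2 * Real.pi : ℂ) ^ 2)⁻¹ with hc
  have hint := (integrable_convolution₂_kernel mg mh hg hh).mul_bdd (c := 1)
    (g := fun z => planeWave p z.2) (Continuous.aestronglyMeasurable (by fun_prop))
    (.of_forall fun z => (norm_planeWave _ _).le)
  calc extension Z (convolution₂ Z g h) p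
      = c * (c * ∫ q, ∫ a, g a * h (q - a) * planeWave p q
          ∂Z.spaceTimeFreqMeasure ∂Z.spaceTimeFreqMeasure) := by
        rw [extension]
        refine congrArg (c * ·) ?_
        rw [← integral_const_mul]
        refine integral_congr_ae (.of_forall fun q => ?_)
        dsimp only
        rw [convolution₂, integral_mul_const, mul_assoc]
    _ = c * (c * ∫ a, ∫ q, g a * h (q - a) * planeWave p q
          ∂Z.spaceTimeFreqMeasure ∂Z.spaceTimeFreqMeasure) := by
        rw [integral_integral_swap]
        exact hint.swap
    _ = c * (c * ∫ a, (g a * planeWave p a) * (∫ q, h q * planeWave p q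
          ∂Z.spaceTimeFreqMeasure) ∂Z.spaceTimeFreqMeasure) := by
        refine congrArg (fun x => c * (_ * x)) (integral_congr_ae ?_)
        filter_upwards [Z.isAETranslationInvariant.integral_add] with a ha
        rw [← ha (fun q => g a * h (q - a) * planeWave p q)
          (Measurable.stronglyMeasurable (by fun_prop)), ← integral_const_mul]
        refine integral_congr_ae (.of_forall fun q => ?_)
        dsimp only
        rw [planeWave_add, add_sub_cancel_right]
        ring
    _ = _ := by
        rw [integral_mul_const, extension, extension]
        ring

theorem extension_convolution₃ (h₁ : Measurable g₁) (h₂ : Measurable g₂)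
    (h₃ : Measurable g₃) (i₁ : Integrable g₁ Z.spaceTimeFreqMeasure)
    (i₂ : Integrable g₂ Z.spaceTimeFreqMeasure) (i₃ : Integrable g₃ Z.spaceTimeFreqMeasure)
    (p : Plane) : extension Z (convolution₃ Z g₁ g₂ g₃) p =
      extension Z g₁ p * starRingEnd ℂ (extension Z g₂ p) * extension Z g₃ p := by
  set c : ℂ := ((2 * Real.pi : ℂ) ^ 2)⁻¹ with hc
  have hcc : starRingEnd ℂ c = c := by
    rw [hc, show (2 * Real.pi : ℂ) = ((2 * Real.pi : ℝ) : ℂ) by push_cast; rfl, ← Complex.ofReal_pow,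
      ← Complex.ofReal_inv, Complex.conj_ofReal]
  have mc : Measurable (starRingEnd ℂ) := Complex.continuous_conj.measurable
  set ν := Z.spaceTimeFreqMeasure with hν
  have hint := (integrable_convolution₃_kernel h₁ h₂ h₃ i₁ i₂ i₃).mul_bdd (c := 1)
    (g := fun z => planeWave p z.2) (Continuous.aestronglyMeasurable (by fun_prop))
    (.of_forall fun z => (norm_planeWave _ _).le)
  calc extension Z (convolution₃ Z g₁ g₂ g₃) p
      = c * (c ^ 2 * ∫ q, ∫ z, g₁ z.1 * starRingEnd ℂ (g₂ z.2) * g₃ (q - z.1 + z.2) *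
          planeWave p q ∂(ν.prod ν) ∂ν) := by
        rw [extension, ← integral_const_mul (r := c ^ 2)]
        congr 1
        refine integral_congr_ae (.of_forall fun q => ?_)
        dsimp only
        rw [convolution₃, integral_mul_const, mul_assoc]
    _ = c * (c ^ 2 * ∫ z, ∫ q, g₁ z.1 * starRingEnd ℂ (g₂ z.2) * g₃ (q - z.1 + z.2) *
          planeWave p q ∂ν ∂(ν.prod ν)) := by
        rw [integral_integral_swap]
        exact hint.swap
    _ = c * (c ^ 2 * ∫ z, ((g₁ z.1 * planeWave p z.1) *
          starRingEnd ℂ (g₂ z.2 * planeWave p z.2)) * (∫ q, g₃ q * planeWave p q ∂ν)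
            ∂(ν.prod ν)) := by
        refine congrArg (fun x => c * (_ * x)) (integral_congr_ae ?_)
        have a₁ : ∀ᵐ z ∂(ν.prod ν), ∀ F : ℝ × ℝ → ℂ, StronglyMeasurable F →
            ∫ x, F (x + z.1) ∂ν = ∫ x, F x ∂ν :=
          Measure.quasiMeasurePreserving_fst.ae Z.isAETranslationInvariant.integral_add
        have a₂ : ∀ᵐ z ∂(ν.prod ν), ∀ F : ℝ × ℝ → ℂ, StronglyMeasurable F →
            ∫ x, F (x + z.2) ∂ν = ∫ x, F x ∂ν :=
          Measure.quasiMeasurePreserving_snd.ae Z.isAETranslationInvariant.integral_add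
        filter_upwards [a₁, a₂] with z hz₁ hz₂
        rw [← hz₁ (fun q => g₁ z.1 * starRingEnd ℂ (g₂ z.2) * g₃ (q - z.1 + z.2) * planeWave p q)
          (Measurable.stronglyMeasurable (by fun_prop)), ← hz₂ (fun q => g₃ q * planeWave p q)
          (Measurable.stronglyMeasurable (by fun_prop)), ← integral_const_mul]
        refine integral_congr_ae (.of_forall fun q => ?_)
        dsimp only
        -- Shifting the output frequency to q + z.1 - z.2 produces the conjugate wave at z.2; this
        -- identity cancels it against the wave from the shift by z.2 in the integral of g₃.
        have e : planeWave p z.2 * starRingEnd ℂ (planeWave p z.2) = 1 := by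
          rw [conj_planeWave, ← planeWave_add]
          simp [planeWave]
        rw [planeWave_add, planeWave_add, add_sub_cancel_right, map_mul]
        linear_combination (-(g₁ z.1 * starRingEnd ℂ (g₂ z.2) * g₃ (q + z.2) * planeWave p q *
          planeWave p z.1)) * e
    _ = _ := by
        rw [integral_mul_const, integral_prod_mul (fun q => g₁ q * planeWave p q)
            (fun q => starRingEnd ℂ (g₂ q * planeWave p q)), integral_conj, extension, extension,
            extension, map_mul, hcc]
        ring

end Products

/-! ### Tempered distributions and their Fourier transforms -/

section Distributions

/-- Every smooth compactly supported function of `(τ, ξ)` is a rescaled Schwartz function. -/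
theorem exists_schwartzMap_eq {ψ : ℝ × ℝ → ℝ} (hψ : ContDiff ℝ (⊤ : ℕ∞) ψ)
    (hs : HasCompactSupport ψ) :
    ∃ χ : 𝓢(Plane, ℂ), ∀ q : ℝ × ℝ,
      χ !₂[q.1 / (2 * Real.pi), q.2 / (2 * Real.pi)] = (ψ q : ℂ) := by
  have hpi := Real.pi_ne_zero
  let e : Plane ≃ₜ ℝ × ℝ :=
    { toFun := fun y => (2 * Real.pi * y 0, 2 * Real.pi * y 1)
      invFun := fun q => !₂[q.1 / (2 * Real.pi), q.2 / (2 * Real.pi)]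
      left_inv := fun y => by
        ext i
        fin_cases i <;> simp
      right_inv := fun q => by
        ext <;> simp <;> field_simp
      continuous_toFun := by fun_prop
      continuous_invFun := by fun_prop }
  have h1 : HasCompactSupport (fun y : Plane => ((ψ (e y) : ℝ) : ℂ)) :=
    (hs.comp_homeomorph e).comp_left (g := fun x : ℝ => (x : ℂ)) Complex.ofReal_zero
  have h2 : ContDiff ℝ (⊤ : ℕ∞) (fun y : Plane => ((ψ (e y) : ℝ) : ℂ)) := by
    refine Complex.ofRealCLM.contDiff.comp (hψ.comp ?_)
    change ContDiff ℝ _ fun y : Plane => (2 * Real.pi * y 0, 2 * Real.pi * y 1)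
    fun_prop
  refine ⟨h1.toSchwartzMap h2, fun q => ?_⟩
  have : e (!₂[q.1 / (2 * Real.pi), q.2 / (2 * Real.pi)]) = q := e.right_inv q
  change ((ψ (e _) : ℝ) : ℂ) = _
  rw [this]

variable {Z : SpaceDomain} {u : 𝓢'(Plane, ℂ)} {g g' : ℝ × ℝ → ℂ}

/-- Test with a smooth bump that equals 1 on a ball containing the given compact set. -/
theorem HasFourier.locallyIntegrable (h : HasFourier Z u g) :
    LocallyIntegrable g Z.spaceTimeFreqMeasure := by
  rw [locallyIntegrable_iff]
  intro K hK
  obtain ⟨R, hR, hKR⟩ := hK.isBounded.subset_closedBall_lt 0 (0 : ℝ × ℝ)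
  let ψ : ContDiffBump (0 : ℝ × ℝ) := ⟨R, R + 1, hR, by linarith⟩
  obtain ⟨χ, hχ⟩ := exists_schwartzMap_eq (ψ := ψ) ψ.contDiff ψ.hasCompactSupport
  refine (h χ).1.integrableOn.congr_fun (fun q hq => ?_) hK.measurableSet
  dsimp only
  rw [hχ, ψ.one_of_mem_closedBall (hKR hq)]
  simp

/-- Smooth compactly supported functions are admissible tests and determine a locally integrable
function almost everywhere. Hence the infimum in `bourgainNorm` is over a single value. -/
theorem HasFourier.ae_eq (h : HasFourier Z u g) (h' : HasFourier Z u g') :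
    g =ᵐ[Z.spaceTimeFreqMeasure] g' := by
  refine ae_eq_of_integral_contDiff_smul_eq h.locallyIntegrable h'.locallyIntegrable
    fun ψ hψ hs => ?_
  obtain ⟨χ, hχ⟩ := exists_schwartzMap_eq hψ hs
  have e := (h χ).2.symm.trans (h' χ).2
  simp only [hχ] at e
  simpa [mul_comm] using e

theorem HasFourier.congr (h : HasFourier Z u g) (hg : g =ᵐ[Z.spaceTimeFreqMeasure] g') :
    HasFourier Z u g' := by
  intro χ
  have e : (fun q : ℝ × ℝ => g q * χ !₂[q.1 / (2 * Real.pi), q.2 / (2 * Real.pi)])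
      =ᵐ[Z.spaceTimeFreqMeasure]
      fun q : ℝ × ℝ => g' q * χ !₂[q.1 / (2 * Real.pi), q.2 / (2 * Real.pi)] := by
    filter_upwards [hg] with q hq
    rw [hq]
  exact ⟨(h χ).1.congr e, (h χ).2.trans (integral_congr_ae e)⟩

theorem HasFourier.bourgainNorm_eq (h : HasFourier Z u g) (α s b : ℝ) :
    bourgainNorm Z α s b u =
      eLpNorm (fun q => (bourgainWeight α s b q : ℂ) * g q) 2 Z.spaceTimeFreqMeasure := by
  refine le_antisymm (iInf₂_le g h) (le_iInf₂ fun g' h' => le_of_eq (eLpNorm_congr_ae ?_))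
  filter_upwards [h.ae_eq h'] with q hq
  rw [hq]

theorem eLpNorm_bourgainWeight_mul (α s b : ℝ) (g : ℝ × ℝ → ℂ) (ν : Measure (ℝ × ℝ)) :
    eLpNorm (fun q => (bourgainWeight α s b q : ℂ) * g q) 2 ν =
      (∫⁻ q, (ENNReal.ofReal (bourgainWeight α s b q) * ‖g q‖ₑ) ^ 2 ∂ν) ^ (1 / 2 : ℝ) := by
  rw [eLpNorm_eq_lintegral_rpow_enorm_toReal (by norm_num) (by norm_num)]
  simp only [ENNReal.toReal_ofNat, ENNReal.rpow_ofNat]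
  congr 1
  refine lintegral_congr fun q => ?_
  rw [enorm_mul, ← ofReal_norm (bourgainWeight α s b q : ℂ), Complex.norm_real,
    Real.norm_of_nonneg (bourgainWeight_pos α s b q).le]

/-- Substituting χ = 𝓕⁻ φ moves the transform from the distribution to the test function. -/
theorem hasFourier_iff : HasFourier Z u g ↔ ∀ φ : 𝓢(Plane, ℂ),
    Integrable (fun q : ℝ × ℝ => g q * (𝓕⁻ φ) !₂[q.1 / (2 * Real.pi), q.2 / (2 * Real.pi)])
      Z.spaceTimeFreqMeasure ∧
    (2 * Real.pi : ℂ) ^ 2 * u φ =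
      ∫ q, g q * (𝓕⁻ φ) !₂[q.1 / (2 * Real.pi), q.2 / (2 * Real.pi)]
        ∂Z.spaceTimeFreqMeasure := by
  constructor
  · intro h φ
    have := h (𝓕⁻ φ)
    rwa [TemperedDistribution.fourier_apply, FourierTransform.fourier_fourierInv_eq] at this
  · intro h χ
    have := h (𝓕 χ)
    rwa [FourierTransform.fourierInv_fourier_eq, ← TemperedDistribution.fourier_apply] at this

/-- On the circle the frequency measure sits on the integers, and e^(ikx) is 2π-periodic in x.
Periodicity of a constructed distribution therefore comes for free. -/
theorem HasFourier.isDistribution (h : HasFourier Z u g) : Z.IsDistribution u := by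
  cases Z with
  | line => trivial
  | circle =>
    intro φ ψ hψ
    have hpi : (2 * Real.pi : ℂ) ^ 2 ≠ 0 := by
      simp [Real.pi_ne_zero]
    rw [hasFourier_iff] at h
    refine mul_left_cancel₀ hpi ?_
    rw [(h φ).2, (h ψ).2]
    have hz : ∀ᵐ q ∂SpaceDomain.circle.spaceTimeFreqMeasure, q.2 ∈ Set.range (fun k : ℤ => (k : ℝ)) :=
      Measure.quasiMeasurePreserving_snd.ae
        (ae_map_mem_range _ (Set.countable_range _).measurableSet _)
    refine integral_congr_ae ?_
    filter_upwards [hz] with q hq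
    obtain ⟨k, hk⟩ := hq
    congr 1
    rw [fourierInv_apply_div, fourierInv_apply_div,
      ← integral_add_right_eq_self (fun p => planeWave p q * φ p) (!₂[0, 2 * Real.pi] : Plane)]
    refine integral_congr_ae (.of_forall fun p => ?_)
    dsimp only
    rw [hψ p]
    congr 1
    rw [planeWave, planeWave, Complex.exp_eq_exp_iff_exists_int]
    refine ⟨-k, ?_⟩
    simp [← hk]
    ring

/-- A Schwartz function is bounded by `planeWeight` times a Schwartz seminorm. Functions integrable
for `planeMeasure` therefore define tempered distributions, continuously in `L¹`. -/
theorem integrable_mul_schwartzMap {F : Plane → ℂ} (hF : Integrable F planeMeasure)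
    (φ : 𝓢(Plane, ℂ)) : Integrable (fun p => F p * φ p) ∧
      ‖∫ p, F p * φ p‖ ≤ (2 ^ 4 * ∫ p, ‖F p‖ ∂planeMeasure) *
        (Finset.Iic ((4, 0) : ℕ × ℕ)).sup (schwartzSeminormFamily ℂ Plane ℂ) φ := by
  have hm := continuous_planeWeight.measurable
  have h1 : Integrable fun p => planeWeight p * ‖F p‖ := by
    have := (integrable_withDensity_iff_integrable_smul₀' hm.ennreal_ofReal.aemeasurable
      (.of_forall fun _ => ENNReal.ofReal_lt_top)).1 hF.norm
    refine this.congr (.of_forall fun p => ?_)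
    simp [ENNReal.toReal_ofReal (planeWeight_pos p).le]
  have h2 : ∫ p, ‖F p‖ ∂planeMeasure = ∫ p, planeWeight p * ‖F p‖ := by
    rw [planeMeasure, integral_withDensity_eq_integral_toReal_smul hm.ennreal_ofReal
      (.of_forall fun _ => ENNReal.ofReal_lt_top)]
    refine integral_congr_ae (.of_forall fun p => ?_)
    simp [ENNReal.toReal_ofReal (planeWeight_pos p).le]
  have hFm : AEStronglyMeasurable F volume := by
    refine hF.aestronglyMeasurable.mono_ac ?_
    refine withDensity_absolutelyContinuous' hm.ennreal_ofReal.aemeasurable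
      (.of_forall fun p => ?_)
    simpa using planeWeight_pos p
  set S := (Finset.Iic ((4, 0) : ℕ × ℕ)).sup (schwartzSeminormFamily ℂ Plane ℂ) φ
  have hle : ∀ p, ‖F p * φ p‖ ≤ 2 ^ 4 * S * (planeWeight p * ‖F p‖) := fun p => by
    have := norm_le_seminorm_mul_planeWeight φ p
    rw [norm_mul]
    calc _ ≤ ‖F p‖ * (2 ^ 4 * S * planeWeight p) := by gcongr
      _ = _ := by ring
  refine ⟨(h1.const_mul (2 ^ 4 * S)).mono' (hFm.mul φ.continuous.aestronglyMeasurable)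
    (.of_forall hle), ?_⟩
  refine (norm_integral_le_of_norm_le (h1.const_mul (2 ^ 4 * S)) (.of_forall hle)).trans
    (le_of_eq ?_)
  rw [integral_const_mul, h2]
  ring

theorem exists_isGivenBy {F : Plane → ℂ} (hF : Integrable F planeMeasure) :
    ∃ u : 𝓢'(Plane, ℂ), IsGivenBy u F := by
  let A : 𝓢(Plane, ℂ) →L[ℂ] ℂ := SchwartzMap.mkCLMtoNormedSpace (fun φ => ∫ p, F p * φ p)
    (fun φ ψ => by
      rw [← integral_add (integrable_mul_schwartzMap hF φ).1 (integrable_mul_schwartzMap hF ψ).1]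
      simp [mul_add])
    (fun a φ => by
      rw [smul_eq_mul, ← integral_const_mul]
      refine integral_congr_ae (.of_forall fun p => ?_)
      simp [mul_left_comm])
    ⟨Finset.Iic (4, 0), 2 ^ 4 * ∫ p, ‖F p‖ ∂planeMeasure, by positivity, fun φ =>
      (integrable_mul_schwartzMap hF φ).2⟩
  refine ⟨A, fun φ => ⟨(integrable_mul_schwartzMap hF φ).1, ?_⟩⟩
  rfl

/-- A function on the plane with a Fourier transform defines a distribution. -/
theorem exists_isGivenBy_hasFourier {F : Plane → ℂ} (hF : Integrable F planeMeasure)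
    (h : ∀ φ : 𝓢(Plane, ℂ),
      Integrable (fun q : ℝ × ℝ => g q * (𝓕⁻ φ) !₂[q.1 / (2 * Real.pi), q.2 / (2 * Real.pi)])
        Z.spaceTimeFreqMeasure ∧
      ∫ p, F p * φ p = ((2 * Real.pi : ℂ) ^ 2)⁻¹ *
        ∫ q, g q * (𝓕⁻ φ) !₂[q.1 / (2 * Real.pi), q.2 / (2 * Real.pi)]
          ∂Z.spaceTimeFreqMeasure) :
    ∃ u : 𝓢'(Plane, ℂ), IsGivenBy u F ∧ HasFourier Z u g ∧ Z.IsDistribution u := by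
  obtain ⟨u, hu⟩ := exists_isGivenBy hF
  have hpi : (2 * Real.pi : ℂ) ^ 2 ≠ 0 := by
    simp [Real.pi_ne_zero]
  have hf : HasFourier Z u g := hasFourier_iff.2 fun φ => ⟨(h φ).1, by
    rw [(hu φ).2, (h φ).2, mul_inv_cancel_left₀ hpi]⟩
  exact ⟨u, hu, hf, hf.isDistribution⟩

theorem norm_fourierInv_apply_le (φ : 𝓢(Plane, ℂ)) (y : Plane) : ‖(𝓕⁻ φ) y‖ ≤ ∫ p, ‖φ p‖ := by
  rw [SchwartzMap.fourierInv_coe, Real.fourierInv_eq']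
  refine (norm_integral_le_integral_norm _).trans (le_of_eq ?_)
  refine integral_congr_ae (.of_forall fun p => ?_)
  dsimp only
  rw [norm_smul, Complex.norm_exp_ofReal_mul_I, one_mul]

@[fun_prop]
theorem continuous_schwartzMap_div (χ : 𝓢(Plane, ℂ)) :
    Continuous fun q : ℝ × ℝ => χ !₂[q.1 / (2 * Real.pi), q.2 / (2 * Real.pi)] :=
  χ.continuous.comp (by fun_prop)

theorem integrable_mul_fourierInv (hg : Integrable g Z.spaceTimeFreqMeasure) (φ : 𝓢(Plane, ℂ)) :
    Integrable (fun q : ℝ × ℝ => g q * (𝓕⁻ φ) !₂[q.1 / (2 * Real.pi), q.2 / (2 * Real.pi)])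
      Z.spaceTimeFreqMeasure :=
  hg.mul_bdd (continuous_schwartzMap_div _).aestronglyMeasurable
    (.of_forall fun _ => norm_fourierInv_apply_le φ _)

theorem integrable_extension (hg : Integrable g Z.spaceTimeFreqMeasure) :
    Integrable (extension Z g) planeMeasure :=
  Integrable.of_bound (continuous_extension hg).aestronglyMeasurable _
    (.of_forall (norm_extension_le g))

theorem exists_isGivenBy_extension (hg : Integrable g Z.spaceTimeFreqMeasure) :
    ∃ u : 𝓢'(Plane, ℂ), IsGivenBy u (extension Z g) ∧ HasFourier Z u g ∧ Z.IsDistribution u :=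
  exists_isGivenBy_hasFourier (integrable_extension hg) fun φ =>
    ⟨integrable_mul_fourierInv hg φ, integral_extension_mul hg φ⟩

end Distributions

/-! ### The `L⁴` bound and the trilinear bound in frequency space -/

section Estimates

/-- The square of the norm `‖⟨ξ⟩^s ⟨τ - |ξ|^α⟩^b g‖`. -/
noncomputable def normSq (Z : SpaceDomain) (α s b : ℝ) (g : ℝ × ℝ → ℂ) : ℝ≥0∞ :=
  ∫⁻ q, (ENNReal.ofReal (bourgainWeight α s b q) * ‖g q‖ₑ) ^ 2 ∂Z.spaceTimeFreqMeasure

variable {Z : SpaceDomain} {α s ε : ℝ}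

theorem bourgainWeight_mul (α s s' b b' : ℝ) (q : ℝ × ℝ) :
    bourgainWeight α s b q * bourgainWeight α s' b' q = bourgainWeight α (s + s') (b + b') q := by
  rw [bourgainWeight, bourgainWeight, bourgainWeight, Real.rpow_add (bracket_pos _),
    Real.rpow_add (bracket_pos _)]
  ring

theorem bourgainWeight_mono {α s s' b b' : ℝ} (hs : s ≤ s') (hb : b ≤ b') (q : ℝ × ℝ) :
    bourgainWeight α s b q ≤ bourgainWeight α s' b' q := by
  unfold bourgainWeight
  have h1 := one_le_bracket q.2
  have h2 := one_le_bracket (q.1 - |q.2| ^ α)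
  gcongr

theorem bourgainWeight_zero (α : ℝ) (q : ℝ × ℝ) : bourgainWeight α 0 0 q = 1 := by
  simp [bourgainWeight]

theorem ofReal_bourgainWeight_mul_le {α s₁ s₂ s₃ b₁ b₂ b₃ : ℝ} (hs : s₁ ≤ s₂ + s₃)
    (hb : b₁ ≤ b₂ + b₃) (q : ℝ × ℝ) (x : ℝ≥0∞) :
    ENNReal.ofReal (bourgainWeight α s₁ b₁ q) * x ≤
      ENNReal.ofReal (bourgainWeight α s₂ b₂ q) *
        (ENNReal.ofReal (bourgainWeight α s₃ b₃ q) * x) := by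
  rw [← mul_assoc, ← ENNReal.ofReal_mul (bourgainWeight_pos _ _ _ _).le, bourgainWeight_mul]
  gcongr
  exact bourgainWeight_mono hs hb q

/-- The bracket of x - y + z is at most three times the largest of the three brackets. The case
split only selects the largest. -/
theorem bracket_rpow_triple_le (hs : 0 ≤ s) (x y z : ℝ) :
    bracket (x - y + z) ^ s ≤ 3 ^ s * (bracket x ^ s + bracket y ^ s + bracket z ^ s) := by
  have hx := Real.rpow_nonneg (bracket_pos x).le s
  have hy := Real.rpow_nonneg (bracket_pos y).le s
  have hz := Real.rpow_nonneg (bracket_pos z).le s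
  have key : ∀ t, 0 < t → bracket x ≤ t → bracket y ≤ t → bracket z ≤ t →
      bracket (x - y + z) ^ s ≤ 3 ^ s * t ^ s := by
    intro t ht h1 h2 h3
    rw [← Real.mul_rpow (by norm_num) ht.le]
    refine Real.rpow_le_rpow (bracket_pos _).le ?_ hs
    have k1 := bracket_add_le (x - y) z
    have k2 := bracket_add_le x (-y)
    rw [← sub_eq_add_neg, show bracket (-y) = bracket y by simp [bracket]] at k2
    linarith
  have h3 : (0 : ℝ) < 3 ^ s := by positivity
  rcases le_total (bracket x) (bracket y) with h | h <;>
  rcases le_total (bracket y) (bracket z) with h' | h' <;>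
  rcases le_total (bracket x) (bracket z) with h'' | h''
  all_goals first
    | exact (key (bracket z) (bracket_pos z) (by linarith) (by linarith) (by linarith)).trans
        (by gcongr; linarith)
    | exact (key (bracket y) (bracket_pos y) (by linarith) (by linarith) (by linarith)).trans
        (by gcongr; linarith)
    | exact (key (bracket x) (bracket_pos x) (by linarith) (by linarith) (by linarith)).trans
        (by gcongr; linarith)

/-- The bilinear estimate, as a bound for the fourth power of the `L⁴` norm. -/
theorem exists_L4_bound (Z : SpaceDomain) (hα₁ : 1 < α) (hα₂ : α < 2) (hs : (2 - α) / 4 ≤ s)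
    (hε : 0 < ε) (hε' : ε < 1 / 4) :
    ∃ C : ℝ≥0, ∀ g : ℝ × ℝ → ℂ, Measurable g → Integrable g Z.spaceTimeFreqMeasure →
      ∫⁻ p, ‖extension Z g p‖ₑ ^ 4 ∂planeMeasure ≤ C * normSq Z α s (1 / 2 + ε) g ^ 2 := by
  obtain ⟨K, hK⟩ := exists_bilinear_kernel_bound Z hα₁ hα₂ hε hε'
  obtain ⟨D, hD⟩ := exists_local_plancherel Z
  set c : ℂ := ((2 * Real.pi : ℂ) ^ 2)⁻¹ with hc
  refine ⟨D * (‖c‖₊ ^ 2 * K), fun g mg ig => ?_⟩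
  have mW := fun s b => measurable_bourgainWeight α s b
  calc ∫⁻ p, ‖extension Z g p‖ₑ ^ 4 ∂planeMeasure
      -- The fourth power of a function is the square of its square, whose Fourier transform is a
      -- convolution to which the bilinear estimate applies.
      = ∫⁻ p, ‖extension Z (convolution₂ Z g g) p‖ₑ ^ 2 ∂planeMeasure := by
        refine lintegral_congr fun p => ?_
        rw [extension_convolution₂ mg mg ig ig, enorm_mul]
        ring
    _ ≤ D * ∫⁻ q, ‖convolution₂ Z g g q‖ₑ ^ 2 ∂Z.spaceTimeFreqMeasure :=
        hD _ (integrable_convolution₂ mg mg ig ig)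
    -- One copy of g is given the weight A and the other the weight B. Each times the full weight of
    -- the norm is at least 1.
    _ ≤ D * ∫⁻ f, ‖c‖ₑ ^ 2 * lconv Z.spaceTimeFreqMeasure
          (fun a => ENNReal.ofReal (bourgainWeight α (-((2 - α) / 4)) (-(1 / 2 + ε)) a) *
            (ENNReal.ofReal (bourgainWeight α s (1 / 2 + ε) a) * ‖g a‖ₑ))
          (fun a => ENNReal.ofReal (bourgainWeight α 0 (-1 / 2 + ε) a) *
            (ENNReal.ofReal (bourgainWeight α s (1 / 2 + ε) a) * ‖g a‖ₑ)) f ^ 2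
          ∂Z.spaceTimeFreqMeasure := by
        gcongr with f
        rw [← mul_pow]
        gcongr
        refine (enorm_convolution₂_le f).trans ?_
        unfold lconv
        have e : ∀ {s₂ b₂ : ℝ}, 0 ≤ s₂ + s → 0 ≤ b₂ + (1 / 2 + ε) → ∀ q, ‖g q‖ₑ ≤
            ENNReal.ofReal (bourgainWeight α s₂ b₂ q) *
              (ENNReal.ofReal (bourgainWeight α s (1 / 2 + ε) q) * ‖g q‖ₑ) := fun h1 h2 q => by
          simpa [bourgainWeight_zero] using
            ofReal_bourgainWeight_mul_le (s₁ := 0) (b₁ := 0) (α := α) h1 h2 q ‖g q‖ₑ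
        gcongr with a
        · exact e (by linarith) (by linarith) a
        · exact e (by linarith) (by linarith) (f - a)
    _ ≤ D * (‖c‖ₑ ^ 2 * (K * (normSq Z α s (1 / 2 + ε) g * normSq Z α s (1 / 2 + ε) g))) := by
        rw [lintegral_const_mul' _ _ (by finiteness)]
        gcongr
        exact Z.isAETranslationInvariant.lintegral_lconv_sq_le (by fun_prop) (by fun_prop)
          (by fun_prop) (by fun_prop) hK
    _ = _ := by
        push_cast
        rw [← enorm_eq_nnnorm]
        ring

/-- The trilinear estimate for convolutions. -/
theorem exists_trilinear_bound (Z : SpaceDomain) (hα₁ : 1 < α) (hα₂ : α < 2)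
    (hs : (2 - α) / 4 ≤ s) (hε : 0 < ε) (hε' : ε < 1 / 4) :
    ∃ C : ℝ≥0, ∀ g₁ g₂ g₃ : ℝ × ℝ → ℂ, Measurable g₁ → Measurable g₂ → Measurable g₃ →
      ∫⁻ q, (ENNReal.ofReal (bourgainWeight α s (-1 / 2 + ε) q) *
        ltriple Z.spaceTimeFreqMeasure (fun q => ‖g₁ q‖ₑ) (fun q => ‖g₂ q‖ₑ) (fun q => ‖g₃ q‖ₑ) q) ^ 2
          ∂Z.spaceTimeFreqMeasure ≤
        C * (normSq Z α s (1 / 2 + ε) g₁ * normSq Z α s (1 / 2 + ε) g₂ *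
          normSq Z α s (1 / 2 + ε) g₃) := by
  obtain ⟨K, hK⟩ := exists_bilinear_kernel_bound Z hα₁ hα₂ hε hε'
  have hs0 : 0 ≤ s := by linarith
  refine ⟨9 * Real.toNNReal (3 ^ s) ^ 2 * K ^ 2, fun g₁ g₂ g₃ m₁ m₂ m₃ => ?_⟩
  have mW := fun s b => measurable_bourgainWeight α s b
  -- This is where s ≥ (2-α)/4 enters.
  have eA : ∀ g : ℝ × ℝ → ℂ, ∀ q, ‖g q‖ₑ ≤
      ENNReal.ofReal (bourgainWeight α (-((2 - α) / 4)) (-(1 / 2 + ε)) q) *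
        (ENNReal.ofReal (bourgainWeight α s (1 / 2 + ε) q) * ‖g q‖ₑ) := fun g q => by
    simpa [bourgainWeight_zero] using
      ofReal_bourgainWeight_mul_le (s₁ := 0) (b₁ := 0) (α := α) (s₂ := -((2 - α) / 4))
        (b₂ := -(1 / 2 + ε)) (s₃ := s) (b₃ := 1 / 2 + ε) (by linarith) (by linarith) q ‖g q‖ₑ
  -- The modulation exponents leave a surplus of 2ε ≥ 0, while ⟨ξ⟩^s is used up exactly.
  have eB : ∀ g : ℝ × ℝ → ℂ, ∀ q, ENNReal.ofReal (bourgainWeight α s 0 q) * ‖g q‖ₑ ≤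
      ENNReal.ofReal (bourgainWeight α 0 (-1 / 2 + ε) q) *
        (ENNReal.ofReal (bourgainWeight α s (1 / 2 + ε) q) * ‖g q‖ₑ) := fun g q =>
    ofReal_bourgainWeight_mul_le (by linarith) (by linarith) q ‖g q‖ₑ
  have hM : ∀ a b c : ℝ × ℝ, ENNReal.ofReal (bourgainWeight α s 0 (a - b + c)) ≤
      ENNReal.ofReal (3 ^ s) * (ENNReal.ofReal (bourgainWeight α s 0 a) +
        ENNReal.ofReal (bourgainWeight α s 0 b) + ENNReal.ofReal (bourgainWeight α s 0 c)) := by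
    intro a b c
    have hp := fun q => (bourgainWeight_pos α s 0 q).le
    rw [← ENNReal.ofReal_add (hp a) (hp b), ← ENNReal.ofReal_add (add_nonneg (hp a) (hp b)) (hp c),
      ← ENNReal.ofReal_mul (by positivity)]
    refine ENNReal.ofReal_le_ofReal ?_
    simpa [bourgainWeight] using bracket_rpow_triple_le hs0 a.2 b.2 c.2
  have main := Z.isAETranslationInvariant.lintegral_ltriple_sq_le
    (A := fun q => ENNReal.ofReal (bourgainWeight α (-((2 - α) / 4)) (-(1 / 2 + ε)) q))
    (B := fun q => ENNReal.ofReal (bourgainWeight α 0 (-1 / 2 + ε) q))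
    (S := fun q => ENNReal.ofReal (bourgainWeight α s 0 q))
    (by fun_prop) (by fun_prop) (by fun_prop) hK hM
    (F₁ := fun q => ‖g₁ q‖ₑ) (F₂ := fun q => ‖g₂ q‖ₑ) (F₃ := fun q => ‖g₃ q‖ₑ)
    (h₁ := fun q => ENNReal.ofReal (bourgainWeight α s (1 / 2 + ε) q) * ‖g₁ q‖ₑ)
    (h₂ := fun q => ENNReal.ofReal (bourgainWeight α s (1 / 2 + ε) q) * ‖g₂ q‖ₑ)
    (h₃ := fun q => ENNReal.ofReal (bourgainWeight α s (1 / 2 + ε) q) * ‖g₃ q‖ₑ)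
    (by fun_prop) (by fun_prop) (by fun_prop) (by fun_prop) (by fun_prop) (by fun_prop)
    (eA g₁) (eA g₂) (eA g₃) (eB g₁) (eB g₂) (eB g₃)
  refine le_of_eq_of_le (lintegral_congr fun q => ?_) (main.trans (le_of_eq ?_))
  · rw [← ENNReal.ofReal_mul (bourgainWeight_pos _ _ _ _).le, bourgainWeight_mul, add_zero, zero_add]
  · push_cast
    rfl

/-- Schwartz functions decay faster than the weights grow. -/
theorem lintegral_weight_mul_schwartzMap_lt_top (Z : SpaceDomain) (hα₁ : 1 < α) (hα₂ : α < 2)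
    (hs : 0 ≤ s) (hε : 0 < ε) (χ : 𝓢(Plane, ℂ)) :
    ∫⁻ q, (ENNReal.ofReal (bourgainWeight α (-s) (1 / 2 - ε) q) *
      ‖χ !₂[q.1 / (2 * Real.pi), q.2 / (2 * Real.pi)]‖ₑ) ^ 2 ∂Z.spaceTimeFreqMeasure < ∞ := by
  have hpi := Real.pi_pos
  obtain ⟨C, hC0, hC⟩ : ∃ C, 0 ≤ C ∧ ∀ q : ℝ × ℝ, bourgainWeight α (-s) (1 / 2 - ε) q *
      ‖χ !₂[q.1 / (2 * Real.pi), q.2 / (2 * Real.pi)]‖ ≤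
        C * (bracket q.1 ^ (-1 : ℝ) * bracket q.2 ^ (-1 : ℝ)) := by
    -- Five powers of decay are used: three for the weight, which is at most ⟨τ⟩⟨ξ⟩², and one more
    -- in each variable for square integrability.
    set S := 2 ^ 5 * (Finset.Iic ((5, 0) : ℕ × ℕ)).sup (fun m => SchwartzMap.seminorm ℂ m.1 m.2) χ
      with hS
    refine ⟨(2 * Real.pi) ^ 5 * S, by positivity, fun q => ?_⟩
    set y : Plane := !₂[q.1 / (2 * Real.pi), q.2 / (2 * Real.pi)] with hy
    have h := SchwartzMap.one_add_le_sup_seminorm_apply (𝕜 := ℂ) (m := (5, 0)) (k := 5) (n := 0)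
      le_rfl le_rfl χ y
    rw [norm_iteratedFDeriv_zero] at h
    have hpi2 : 1 ≤ 2 * Real.pi := by linarith [Real.pi_gt_three]
    have k : ∀ x : ℝ, |x / (2 * Real.pi)| ≤ ‖y‖ → bracket x ≤ 2 * Real.pi * (1 + ‖y‖) := by
      intro x hx
      rw [abs_div, abs_of_pos (by positivity : 0 < 2 * Real.pi), div_le_iff₀ (by positivity)] at hx
      rw [bracket]
      linarith
    have k1 : bracket q.1 ≤ 2 * Real.pi * (1 + ‖y‖) := k _ (PiLp.norm_apply_le y 0)
    have k2 : bracket q.2 ≤ 2 * Real.pi * (1 + ‖y‖) := k _ (PiLp.norm_apply_le y 1)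
    have b1 := bracket_pos q.1
    have b2 := bracket_pos q.2
    have w : bourgainWeight α (-s) (1 / 2 - ε) q ≤ bracket q.1 * bracket q.2 ^ 2 := by
      refine (bourgainWeight_mono (s' := 0) (b' := 1) (by linarith) (by linarith) q).trans ?_
      rw [bourgainWeight, Real.rpow_zero, Real.rpow_one, one_mul]
      have hx := abs_nonneg q.2
      have e1 : |q.2| ^ α ≤ bracket q.2 ^ 2 - 1 := by
        rw [bracket]
        rcases le_total |q.2| 1 with h | h
        · have := Real.rpow_le_rpow_of_exponent_ge' hx h zero_le_one hα₁.le
          rw [Real.rpow_one] at this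
          nlinarith
        · have := Real.rpow_le_rpow_of_exponent_le h hα₂.le
          rw [Real.rpow_two] at this
          nlinarith
      have e2 : |q.1 - |q.2| ^ α| ≤ |q.1| + |q.2| ^ α := by
        refine (abs_sub _ _).trans_eq ?_
        rw [abs_of_nonneg (by positivity : 0 ≤ |q.2| ^ α)]
      have e4 : 1 ≤ bracket q.2 ^ 2 := one_le_pow₀ (one_le_bracket q.2)
      calc bracket (q.1 - |q.2| ^ α) ≤ |q.1| + bracket q.2 ^ 2 := by
            rw [show bracket (q.1 - |q.2| ^ α) = 1 + |q.1 - |q.2| ^ α| from rfl]; linarith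
        _ ≤ _ := by
          rw [show bracket q.1 = 1 + |q.1| from rfl]; nlinarith [abs_nonneg q.1]
    rw [Real.rpow_neg_one, Real.rpow_neg_one, ← mul_inv, ← div_eq_mul_inv, le_div_iff₀ (by positivity)]
    calc _ ≤ bracket q.1 * bracket q.2 ^ 2 * ‖χ y‖ * (bracket q.1 * bracket q.2) := by gcongr
      _ = bracket q.1 ^ 2 * bracket q.2 ^ 3 * ‖χ y‖ := by ring
      _ ≤ (2 * Real.pi * (1 + ‖y‖)) ^ 2 * (2 * Real.pi * (1 + ‖y‖)) ^ 3 * ‖χ y‖ := by gcongr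
      _ = (2 * Real.pi) ^ 5 * ((1 + ‖y‖) ^ 5 * ‖χ y‖) := by ring
      _ ≤ _ := by gcongr
  have hI := lintegral_bracket_lt_top (p := 2) one_lt_two
  have hIZ : ∫⁻ x, ENNReal.ofReal (bracket x ^ (-2 : ℝ)) ∂Z.freqMeasure < ∞ := by
    refine (Z.lintegral_freqMeasure_le (C := 4) (by fun_prop) (by norm_num)
      fun x y hxy => ?_).trans_lt (ENNReal.mul_lt_top (by norm_num) hI)
    rw [show (4 : ℝ≥0∞) = ENNReal.ofReal 4 by simp, ← ENNReal.ofReal_mul (by norm_num)]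
    refine ENNReal.ofReal_le_ofReal ?_
    have hb := bracket_le_two_mul (x := y) (y := x) (by rwa [abs_sub_comm])
    have h1 := bracket_pos x
    have h2 := bracket_pos y
    rw [Real.rpow_neg h1.le, Real.rpow_neg h2.le, ← div_eq_mul_inv, le_div_iff₀ (by positivity),
      inv_mul_le_iff₀ (by positivity)]
    norm_num
    nlinarith
  calc _ ≤ ∫⁻ q, ENNReal.ofReal (C ^ 2) * (ENNReal.ofReal (bracket q.1 ^ (-2 : ℝ)) *
        ENNReal.ofReal (bracket q.2 ^ (-2 : ℝ))) ∂Z.spaceTimeFreqMeasure := by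
        refine lintegral_mono fun q => ?_
        have hw := (bourgainWeight_pos α (-s) (1 / 2 - ε) q).le
        have e : ∀ x : ℝ, bracket x ^ (-2 : ℝ) = (bracket x ^ (-1 : ℝ)) ^ 2 := fun x => by
          rw [← Real.rpow_natCast, ← Real.rpow_mul (bracket_pos x).le]; norm_num
        have hb := fun x => Real.rpow_nonneg (bracket_pos x).le (-1)
        rw [← ofReal_norm, ← ENNReal.ofReal_mul hw, ← ENNReal.ofReal_pow (by positivity), e, e,
          ← ENNReal.ofReal_mul (by positivity), ← ENNReal.ofReal_mul (by positivity), ← mul_pow,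
          ← mul_pow]
        refine ENNReal.ofReal_le_ofReal ?_
        exact pow_le_pow_left₀ (by positivity) (hC q) 2
    _ < ∞ := by
        rw [lintegral_const_mul _ (by fun_prop), SpaceDomain.spaceTimeFreqMeasure,
          lintegral_prod_mul (f := fun x => ENNReal.ofReal (bracket x ^ (-2 : ℝ)))
          (g := fun x => ENNReal.ofReal (bracket x ^ (-2 : ℝ))) (by fun_prop) (by fun_prop)]
        exact ENNReal.mul_lt_top ENNReal.ofReal_lt_top (ENNReal.mul_lt_top hI hIZ)

end Estimates

open Filter Topology

/-! ### Truncation in frequency and passage to the limit -/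

section Limits

variable {X : Type*} [MeasurableSpace X] {μ : Measure X}

/-- Hölder's inequality applied to u v - a b = (u-a)(v-b) + (u-a) b + a (v-b). -/
theorem tendsto_eLpNorm_mul_sub {p q r : ℝ≥0∞} [p.HolderTriple q r] (hr : 1 ≤ r)
    {a b : X → ℂ} {u v : ℕ → X → ℂ} (ha : MemLp a p μ) (hb : MemLp b q μ)
    (hu : ∀ n, MemLp (u n) p μ) (hv : ∀ n, MemLp (v n) q μ)
    (hua : Tendsto (fun n => eLpNorm (u n - a) p μ) atTop (𝓝 0))
    (hvb : Tendsto (fun n => eLpNorm (v n - b) q μ) atTop (𝓝 0)) :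
    Tendsto (fun n => eLpNorm (u n * v n - a * b) r μ) atTop (𝓝 0) := by
  have hle : ∀ n, eLpNorm (u n * v n - a * b) r μ ≤
      eLpNorm (u n - a) p μ * eLpNorm (v n - b) q μ + eLpNorm (u n - a) p μ * eLpNorm b q μ +
        eLpNorm a p μ * eLpNorm (v n - b) q μ := by
    intro n
    have m1 := ((hu n).sub ha).aestronglyMeasurable
    have m2 := ((hv n).sub hb).aestronglyMeasurable
    have m3 := ha.aestronglyMeasurable
    have m4 := hb.aestronglyMeasurable
    have hmul : ∀ x y : X → ℂ, AEStronglyMeasurable x μ → AEStronglyMeasurable y μ →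
        eLpNorm (x * y) r μ ≤ eLpNorm x p μ * eLpNorm y q μ := fun x y hx hy => by
      rw [← smul_eq_mul]
      exact eLpNorm_smul_le_mul_eLpNorm hy hx
    have e : u n * v n - a * b = (u n - a) * (v n - b) + (u n - a) * b + a * (v n - b) := by
      ext x
      simp only [Pi.add_apply, Pi.sub_apply, Pi.mul_apply]
      ring
    rw [e]
    refine (eLpNorm_add_le ((m1.mul m2).add (m1.mul m4)) (m3.mul m2) hr).trans ?_
    exact add_le_add ((eLpNorm_add_le (m1.mul m2) (m1.mul m4) hr).trans
      (add_le_add (hmul _ _ m1 m2) (hmul _ _ m1 m4))) (hmul _ _ m3 m2)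
  refine tendsto_of_tendsto_of_tendsto_of_le_of_le tendsto_const_nhds ?_ (fun n => zero_le) hle
  have h1 := ENNReal.Tendsto.mul hua (Or.inr ENNReal.zero_ne_top) hvb (Or.inr ENNReal.zero_ne_top)
  have h2 := ENNReal.Tendsto.mul_const hua (Or.inr hb.eLpNorm_lt_top.ne)
  have h3 := ENNReal.Tendsto.const_mul hvb (Or.inr ha.eLpNorm_lt_top.ne)
  simpa using (h1.add h2).add h3

theorem tendsto_integral_mul_schwartzMap {F : Plane → ℂ} {G : ℕ → Plane → ℂ}
    (hF : Integrable F planeMeasure) (hG : ∀ n, Integrable (G n) planeMeasure)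
    (h : Tendsto (fun n => eLpNorm (G n - F) 1 planeMeasure) atTop (𝓝 0)) (φ : 𝓢(Plane, ℂ)) :
    Tendsto (fun n => ∫ p, G n p * φ p) atTop (𝓝 (∫ p, F p * φ p)) := by
  rw [tendsto_iff_norm_sub_tendsto_zero]
  set S := (Finset.Iic ((4, 0) : ℕ × ℕ)).sup (schwartzSeminormFamily ℂ Plane ℂ) φ with hS
  have h' : Tendsto (fun n => (2 ^ 4 * (eLpNorm (G n - F) 1 planeMeasure).toReal) * S)
      atTop (𝓝 0) := by
    have := (ENNReal.tendsto_toReal ENNReal.zero_ne_top).comp h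
    simpa using (this.const_mul (2 ^ 4)).mul_const S
  refine squeeze_zero (fun n => norm_nonneg _) (fun n => ?_) h'
  rw [← integral_sub (integrable_mul_schwartzMap (hG n) φ).1 (integrable_mul_schwartzMap hF φ).1]
  have := (integrable_mul_schwartzMap ((hG n).sub hF) φ).2
  simp only [Pi.sub_apply, sub_mul] at this
  refine this.trans (le_of_eq ?_)
  rw [eLpNorm_one_eq_lintegral_enorm, ← integral_norm_eq_lintegral_enorm
    ((hG n).sub hF).aestronglyMeasurable]
  rfl

/-- Truncation of a function to the ball of radius `n`. -/
noncomputable def truncation (g : ℝ × ℝ → ℂ) (n : ℕ) : ℝ × ℝ → ℂ :=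
  (Metric.closedBall 0 n).indicator g

variable {g g₁ g₂ g₃ : ℝ × ℝ → ℂ} {Z : SpaceDomain} {α s ε : ℝ}

theorem measurable_truncation (hg : Measurable g) (n : ℕ) : Measurable (truncation g n) :=
  hg.indicator Metric.isClosed_closedBall.measurableSet

theorem norm_truncation_le (g : ℝ × ℝ → ℂ) (n : ℕ) (q : ℝ × ℝ) : ‖truncation g n q‖ ≤ ‖g q‖ :=
  norm_indicator_le_norm_self _ _

theorem truncation_eventuallyEq (g : ℝ × ℝ → ℂ) (q : ℝ × ℝ) :
    ∀ᶠ n in atTop, truncation g n q = g q := by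
  filter_upwards [eventually_ge_atTop ⌈‖q‖⌉₊] with n hn
  refine Set.indicator_of_mem ?_ g
  rw [mem_closedBall_zero_iff]
  exact Nat.ceil_le.1 hn

theorem tendsto_truncation (g : ℝ × ℝ → ℂ) (q : ℝ × ℝ) :
    Tendsto (fun n => truncation g n q) atTop (𝓝 (g q)) :=
  tendsto_const_nhds.congr' ((truncation_eventuallyEq g q).mono fun _ h => h.symm)

theorem normSq_mono {α s b : ℝ} {g h : ℝ × ℝ → ℂ} (H : ∀ q, ‖g q‖ ≤ ‖h q‖) :
    normSq Z α s b g ≤ normSq Z α s b h := by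
  unfold normSq
  gcongr with q
  exact enorm_le_iff_norm_le.2 (H q)

theorem integrable_truncation (hs : 0 ≤ s) {b : ℝ} (hb : 0 ≤ b) (mg : Measurable g)
    (hg : normSq Z α s b g < ∞) (n : ℕ) :
    Integrable (truncation g n) Z.spaceTimeFreqMeasure := by
  have h2 : MemLp g 2 Z.spaceTimeFreqMeasure := by
    refine ⟨mg.aestronglyMeasurable, ?_⟩
    rw [eLpNorm_lt_top_iff_lintegral_rpow_enorm_lt_top (by norm_num) (by norm_num)]
    refine lt_of_le_of_lt (lintegral_mono fun q => ?_) hg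
    simp only [ENNReal.toReal_ofNat, ENNReal.rpow_ofNat]
    gcongr
    refine le_mul_of_one_le_left zero_le ?_
    rw [← ENNReal.ofReal_one]
    refine ENNReal.ofReal_le_ofReal ?_
    rw [← bourgainWeight_zero α q]
    exact bourgainWeight_mono hs hb q
  have hfin : IsFiniteMeasure (Z.spaceTimeFreqMeasure.restrict (Metric.closedBall 0 n)) :=
    ⟨by
      rw [Measure.restrict_apply_univ]
      exact (isCompact_closedBall _ _).measure_lt_top⟩
  refine (integrable_indicator_iff Metric.isClosed_closedBall.measurableSet).2 ?_
  exact (h2.restrict _).integrable (by norm_num)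

theorem tendsto_normSq_tail (mg : Measurable g) {b : ℝ} (hg : normSq Z α s b g < ∞) :
    Tendsto (fun n => normSq Z α s b (g - truncation g n)) atTop (𝓝 0) := by
  have mW := fun s b => measurable_bourgainWeight α s b
  have mt := fun n => measurable_truncation mg n
  have h := tendsto_lintegral_of_dominated_convergence
    (μ := Z.spaceTimeFreqMeasure)
    (F := fun n q => (ENNReal.ofReal (bourgainWeight α s b q) * ‖(g - truncation g n) q‖ₑ) ^ 2)
    (f := fun _ => 0)
    (fun q => (ENNReal.ofReal (bourgainWeight α s b q) * ‖g q‖ₑ) ^ 2)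
    (fun n => by have := mt n; simp only [Pi.sub_apply]; fun_prop) (fun n => .of_forall fun q => ?_)
    hg.ne (.of_forall fun q => ?_)
  · unfold normSq
    simpa using h
  · dsimp only
    gcongr
    refine enorm_le_iff_norm_le.2 ?_
    by_cases hq : q ∈ Metric.closedBall (0 : ℝ × ℝ) n
    · simp [truncation, Set.indicator_of_mem hq]
    · simp [truncation, Set.indicator_of_notMem hq]
  · refine tendsto_const_nhds.congr' ((truncation_eventuallyEq g q).mono fun n hn => ?_)
    simp [hn]

theorem norm_truncation_sub_le (g : ℝ × ℝ → ℂ) {m n N : ℕ} (hm : N ≤ m) (hn : N ≤ n)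
    (q : ℝ × ℝ) : ‖(truncation g m - truncation g n) q‖ ≤ ‖(g - truncation g N) q‖ := by
  by_cases hq : q ∈ Metric.closedBall (0 : ℝ × ℝ) N
  · have h1 := Metric.closedBall_subset_closedBall (Nat.cast_le.2 hm) hq
    have h2 := Metric.closedBall_subset_closedBall (Nat.cast_le.2 hn) hq
    simp [truncation, Set.indicator_of_mem h1, Set.indicator_of_mem h2]
  · simp only [Pi.sub_apply, truncation, Set.indicator_of_notMem hq, sub_zero]
    by_cases h1 : q ∈ Metric.closedBall (0 : ℝ × ℝ) m <;>
    by_cases h2 : q ∈ Metric.closedBall (0 : ℝ × ℝ) n <;>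
    simp [Set.indicator, h1, h2]

theorem memLp_extension {p : ℝ≥0∞} (hg : Integrable g Z.spaceTimeFreqMeasure) :
    MemLp (extension Z g) p planeMeasure :=
  MemLp.of_bound (continuous_extension hg).aestronglyMeasurable _
    (.of_forall (norm_extension_le g))

/-- Functions of finite norm have an inverse Fourier transform in `L⁴(planeMeasure)`. -/
theorem exists_tendsto_extension_truncation (hα₁ : 1 < α) (hα₂ : α < 2) (hs : (2 - α) / 4 ≤ s)
    (hε : 0 < ε) (hε' : ε < 1 / 4) (mg : Measurable g) (hg : normSq Z α s (1 / 2 + ε) g < ∞) :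
    ∃ f : Plane → ℂ, MemLp f 4 planeMeasure ∧
      Tendsto (fun n => eLpNorm (extension Z (truncation g n) - f) 4 planeMeasure) atTop (𝓝 0) := by
  obtain ⟨C, hC⟩ := exists_L4_bound Z hα₁ hα₂ hs hε hε'
  have hi := integrable_truncation (by linarith) (by linarith) mg hg
  have hm : ∀ n, MemLp (extension Z (truncation g n)) 4 planeMeasure := fun n =>
    memLp_extension (hi n)
  have : Fact ((1 : ℝ≥0∞) ≤ 4) := ⟨by norm_num⟩
  -- Two truncations at radii at least N differ by at most the tail of g beyond radius N. The `L⁴`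
  -- bound applied to the difference makes r a Cauchy modulus.
  set r : ℕ → ℝ≥0∞ := fun N =>
    (C * normSq Z α s (1 / 2 + ε) (g - truncation g N) ^ 2) ^ (1 / 4 : ℝ) with hr
  have hr0 : Tendsto r atTop (𝓝 0) := by
    have h1 := ENNReal.Tendsto.const_mul (a := (C : ℝ≥0∞))
      (ENNReal.Tendsto.pow (n := 2) (tendsto_normSq_tail mg hg)) (Or.inr ENNReal.coe_ne_top)
    have h2 := (ENNReal.continuous_rpow_const (y := 1 / 4)).tendsto _ |>.comp h1
    simpa [hr, Function.comp_def] using h2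
  have hrf : ∀ N, r N ≠ ∞ := fun N => by
    have : normSq Z α s (1 / 2 + ε) (g - truncation g N) < ∞ := by
      refine (normSq_mono fun q => ?_).trans_lt hg
      by_cases hq : q ∈ Metric.closedBall (0 : ℝ × ℝ) N
      · simp [truncation, Set.indicator_of_mem hq]
      · simp [truncation, Set.indicator_of_notMem hq]
    simp only [hr]
    finiteness
  have hdist : ∀ n m N : ℕ, N ≤ n → N ≤ m →
      dist ((hm n).toLp _) ((hm m).toLp _) ≤ (r N).toReal := by
    intro n m N hn hmN
    rw [dist_eq_norm, ← MemLp.toLp_sub, Lp.norm_toLp]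
    refine ENNReal.toReal_mono (hrf N) ?_
    have e : extension Z (truncation g n) - extension Z (truncation g m) =
        extension Z (truncation g n - truncation g m) := by
      ext p
      rw [Pi.sub_apply, extension_sub (hi n) (hi m)]
    rw [e, eLpNorm_eq_lintegral_rpow_enorm_toReal (by norm_num) (by norm_num)]
    simp only [ENNReal.toReal_ofNat, ENNReal.rpow_ofNat, hr]
    gcongr
    refine (hC _ ((measurable_truncation mg n).sub (measurable_truncation mg m))
      ((hi n).sub (hi m))).trans ?_
    gcongr
    exact normSq_mono fun q => norm_truncation_sub_le g hn hmN q
  have hcauchy := cauchySeq_of_le_tendsto_0 _ hdist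
    (by simpa [Function.comp_def] using (ENNReal.tendsto_toReal ENNReal.zero_ne_top).comp hr0)
  obtain ⟨f, hf⟩ := cauchySeq_tendsto_of_complete hcauchy
  refine ⟨f, Lp.memLp f, ?_⟩
  exact (Lp.tendsto_Lp_iff_tendsto_eLpNorm'' _ hm f (Lp.memLp f)).1 (by simpa using hf)

theorem tendsto_eLpNorm_of_le {p q : ℝ≥0∞} (hpq : p ≤ q) [IsFiniteMeasure μ] {a : X → ℂ}
    {u : ℕ → X → ℂ} (ha : MemLp a q μ) (hu : ∀ n, MemLp (u n) q μ)
    (h : Tendsto (fun n => eLpNorm (u n - a) q μ) atTop (𝓝 0)) :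
    Tendsto (fun n => eLpNorm (u n - a) p μ) atTop (𝓝 0) := by
  by_cases hμ : μ Set.univ = 0
  · simp [Measure.measure_univ_eq_zero.1 hμ]
  refine tendsto_of_tendsto_of_tendsto_of_le_of_le tendsto_const_nhds ?_ (fun n => zero_le)
    (fun n => eLpNorm_le_eLpNorm_mul_rpow_measure_univ hpq
      ((hu n).sub ha).aestronglyMeasurable)
  have := ENNReal.Tendsto.mul_const (b := μ Set.univ ^ (1 / p.toReal - 1 / q.toReal)) h
    (Or.inr ?_)
  · simpa using this
  · exact ENNReal.rpow_ne_top_of_nonneg' (pos_iff_ne_zero.2 hμ) (measure_ne_top _ _)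

/-- The limit of the truncated inverse Fourier transforms is the distribution. -/
theorem isGivenBy_of_tendsto {u : 𝓢'(Plane, ℂ)} (hu : HasFourier Z u g) {f : Plane → ℂ}
    (hi : ∀ n, Integrable (truncation g n) Z.spaceTimeFreqMeasure) (hf : Integrable f planeMeasure)
    (h : Tendsto (fun n => eLpNorm (extension Z (truncation g n) - f) 1 planeMeasure)
      atTop (𝓝 0)) : IsGivenBy u f := by
  intro φ
  refine ⟨(integrable_mul_schwartzMap hf φ).1, ?_⟩
  have h1 := tendsto_integral_mul_schwartzMap hf (fun n => integrable_extension (hi n)) h φ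
  obtain ⟨h2, h3⟩ := hasFourier_iff.1 hu φ
  have h4 : Tendsto (fun n => ∫ q, truncation g n q *
      (𝓕⁻ φ) !₂[q.1 / (2 * Real.pi), q.2 / (2 * Real.pi)] ∂Z.spaceTimeFreqMeasure) atTop
      (𝓝 (∫ q, g q * (𝓕⁻ φ) !₂[q.1 / (2 * Real.pi), q.2 / (2 * Real.pi)]
        ∂Z.spaceTimeFreqMeasure)) := by
    refine tendsto_integral_of_dominated_convergence _
      (fun n => (integrable_mul_fourierInv (hi n) φ).aestronglyMeasurable) h2.norm
      (fun n => .of_forall fun q => ?_) (.of_forall fun q => (tendsto_truncation g q).mul_const _)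
    rw [norm_mul, norm_mul]
    gcongr
    exact norm_truncation_le g n q
  -- For the truncations the frequency integral and the integral over the plane agree. One limit
  -- gives u φ and the other ∫ f φ.
  have h5 := h4.const_mul (((2 * Real.pi : ℂ) ^ 2)⁻¹)
  simp_rw [← integral_extension_mul (hi _) φ, ← h3] at h5
  have hpi : (2 * Real.pi : ℂ) ^ 2 ≠ 0 := by
    simp [Real.pi_ne_zero]
  rw [inv_mul_cancel_left₀ hpi] at h5
  exact tendsto_nhds_unique h5 h1

end Limits

/-! ### The trilinear estimate for distributions -/

section Trilinear

variable {g₁ g₂ g₃ : ℝ × ℝ → ℂ} {Z : SpaceDomain} {α s ε : ℝ}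

theorem tendsto_convolution₃_truncation (m₁ : Measurable g₁) (m₂ : Measurable g₂)
    (m₃ : Measurable g₃) {q : ℝ × ℝ}
    (hq : ltriple Z.spaceTimeFreqMeasure (fun q => ‖g₁ q‖ₑ) (fun q => ‖g₂ q‖ₑ)
      (fun q => ‖g₃ q‖ₑ) q < ∞) :
    Tendsto (fun n => convolution₃ Z (truncation g₁ n) (truncation g₂ n) (truncation g₃ n) q) atTop
      (𝓝 (convolution₃ Z g₁ g₂ g₃ q)) := by
  have mc : Measurable (starRingEnd ℂ) := Complex.continuous_conj.measurable
  have t₁ := fun n => measurable_truncation m₁ n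
  have t₂ := fun n => measurable_truncation m₂ n
  have t₃ := fun n => measurable_truncation m₃ n
  unfold convolution₃
  refine Tendsto.const_mul _ (tendsto_integral_of_dominated_convergence
    (fun z => ‖g₁ z.1‖ * ‖g₂ z.2‖ * ‖g₃ (q - z.1 + z.2)‖) (fun n => ?_) ⟨?_, ?_⟩
    (fun n => .of_forall fun z => ?_) (.of_forall fun z => ?_))
  · have := t₁ n
    have := t₂ n
    have := t₃ n
    exact Measurable.aestronglyMeasurable (by fun_prop)
  · exact Measurable.aestronglyMeasurable (by fun_prop)
  · rw [HasFiniteIntegral, lintegral_prod _ (by fun_prop)]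
    simpa [ltriple] using hq
  · rw [norm_mul, norm_mul, RCLike.norm_conj]
    gcongr <;> exact norm_truncation_le _ n _
  · exact ((tendsto_truncation g₁ z.1).mul
      ((Complex.continuous_conj.tendsto _).comp (tendsto_truncation g₂ z.2))).mul
      (tendsto_truncation g₃ _)

/-- The trilinear estimate for functions on the frequency side with finite norm. -/
theorem exists_tripleProduct (hα₁ : 1 < α) (hα₂ : α < 2) (hs : (2 - α) / 4 ≤ s)
    (hε : 0 < ε) (hε' : ε < 1 / 4) (m₁ : Measurable g₁) (m₂ : Measurable g₂) (m₃ : Measurable g₃)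
    (h₁ : normSq Z α s (1 / 2 + ε) g₁ < ∞) (h₂ : normSq Z α s (1 / 2 + ε) g₂ < ∞)
    (h₃ : normSq Z α s (1 / 2 + ε) g₃ < ∞) {u₁ u₂ u₃ : 𝓢'(Plane, ℂ)} (F₁ : HasFourier Z u₁ g₁)
    (F₂ : HasFourier Z u₂ g₂) (F₃ : HasFourier Z u₃ g₃) :
    ∃ w : 𝓢'(Plane, ℂ), IsTripleProduct u₁ u₂ u₃ w ∧ HasFourier Z w (convolution₃ Z g₁ g₂ g₃) ∧
      Z.IsDistribution w := by
  obtain ⟨f₁, M₁, T₁⟩ := exists_tendsto_extension_truncation hα₁ hα₂ hs hε hε' m₁ h₁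
  obtain ⟨f₂, M₂, T₂⟩ := exists_tendsto_extension_truncation hα₁ hα₂ hs hε hε' m₂ h₂
  obtain ⟨f₃, M₃, T₃⟩ := exists_tendsto_extension_truncation hα₁ hα₂ hs hε hε' m₃ h₃
  have i₁ := integrable_truncation (by linarith) (by linarith) m₁ h₁
  have i₂ := integrable_truncation (by linarith) (by linarith) m₂ h₂
  have i₃ := integrable_truncation (by linarith) (by linarith) m₃ h₃
  have t₁ := fun n => measurable_truncation m₁ n
  have t₂ := fun n => measurable_truncation m₂ n
  have t₃ := fun n => measurable_truncation m₃ n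
  have given : ∀ {u : 𝓢'(Plane, ℂ)} {g : ℝ × ℝ → ℂ} {f : Plane → ℂ}, HasFourier Z u g →
      (∀ n, Integrable (truncation g n) Z.spaceTimeFreqMeasure) → MemLp f 4 planeMeasure →
      Tendsto (fun n => eLpNorm (extension Z (truncation g n) - f) 4 planeMeasure)
        atTop (𝓝 0) → IsGivenBy u f := fun hu hi hf h =>
    isGivenBy_of_tendsto hu hi (hf.integrable (by norm_num))
      (tendsto_eLpNorm_of_le (by norm_num) hf (fun n => memLp_extension (hi n)) h)
  set c₂ : Plane → ℂ := fun p => starRingEnd ℂ (f₂ p) with hc₂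
  have M₂' : MemLp c₂ 4 planeMeasure := M₂.star
  have T₂' : Tendsto (fun n => eLpNorm ((fun p => starRingEnd ℂ (extension Z (truncation g₂ n) p)) -
      c₂) 4 planeMeasure) atTop (𝓝 0) := by
    refine T₂.congr fun n => eLpNorm_congr_norm_ae (.of_forall fun p => ?_)
    simp only [Pi.sub_apply, hc₂, ← map_sub, RCLike.norm_conj]
  have : ENNReal.HolderTriple 4 4 2 := ⟨by
    rw [show (4 : ℝ≥0∞)⁻¹ = 2⁻¹ / 2 by
      rw [div_eq_mul_inv, ← ENNReal.mul_inv (by simp) (by simp)]; norm_num, ENNReal.add_halves]⟩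
  -- `L⁴` times `L⁴` gives `L²`. The third factor is then used only in `L²`, which contains `L⁴`
  -- because the measure is finite, so the triple products converge in `L¹`.
  have P := tendsto_eLpNorm_mul_sub (r := 2) (by norm_num) M₁ M₂' (fun n => memLp_extension (i₁ n))
    (fun n => (memLp_extension (i₂ n)).star) T₁ T₂'
  have N₁₂ : MemLp (f₁ * c₂) 2 planeMeasure := M₂'.mul M₁
  have N₃ : MemLp f₃ 2 planeMeasure := M₃.mono_exponent (by norm_num)
  have Q := tendsto_eLpNorm_mul_sub (r := 1) le_rfl N₁₂ N₃
    (fun n => MemLp.mul (p := 4) (q := 4) (memLp_extension (i₂ n)).star (memLp_extension (i₁ n)))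
    (fun n => memLp_extension (i₃ n)) P
    (tendsto_eLpNorm_of_le (by norm_num) M₃ (fun n => memLp_extension (i₃ n)) T₃)
  have IF : Integrable (f₁ * c₂ * f₃) planeMeasure := memLp_one_iff_integrable.1 (N₃.mul N₁₂)
  set E : ℕ → ℝ × ℝ → ℂ := fun n =>
    convolution₃ Z (truncation g₁ n) (truncation g₂ n) (truncation g₃ n) with hE
  have iE : ∀ n, Integrable (E n) Z.spaceTimeFreqMeasure := fun n =>
    integrable_convolution₃ (t₁ n) (t₂ n) (t₃ n) (i₁ n) (i₂ n) (i₃ n)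
  have eE : ∀ n, extension Z (truncation g₁ n) *
      star (extension Z (truncation g₂ n)) * extension Z (truncation g₃ n) =
      extension Z (E n) := fun n => by
    ext p
    rw [hE, extension_convolution₃ (t₁ n) (t₂ n) (t₃ n) (i₁ n) (i₂ n) (i₃ n)]
    rfl
  obtain ⟨C, hC⟩ := exists_trilinear_bound Z hα₁ hα₂ hs hε hε'
  set L : ℝ × ℝ → ℝ≥0∞ := ltriple Z.spaceTimeFreqMeasure (fun q => ‖g₁ q‖ₑ) (fun q => ‖g₂ q‖ₑ)
    (fun q => ‖g₃ q‖ₑ) with hL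
  have mL : Measurable L := measurable_ltriple (by fun_prop) (by fun_prop) (by fun_prop)
  have mW := fun s b => measurable_bourgainWeight α s b
  have hL2 : ∫⁻ q, (ENNReal.ofReal (bourgainWeight α s (-1 / 2 + ε) q) * L q) ^ 2
      ∂Z.spaceTimeFreqMeasure < ∞ :=
    (hC g₁ g₂ g₃ m₁ m₂ m₃).trans_lt (by finiteness)
  -- The trilinear bound makes the triple convolution integral absolutely convergent almost
  -- everywhere. Thus `convolution₃` of the untruncated functions is meaningful and is the limit of
  -- the truncated ones.
  have hLf : ∀ᵐ q ∂Z.spaceTimeFreqMeasure, L q < ∞ := by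
    filter_upwards [ae_lt_top (by fun_prop) hL2.ne] with q hq
    by_contra hcon
    rw [not_lt_top_iff] at hcon
    rw [hcon, ENNReal.mul_top (by simpa using bourgainWeight_pos α s (-1 / 2 + ε) q)] at hq
    simp at hq
  set c : ℂ := ((2 * Real.pi : ℂ) ^ 2)⁻¹ with hc
  have mG := stronglyMeasurable_convolution₃ (Z := Z) m₁ m₂ m₃
  have hbound : ∀ n q, ‖E n q‖ₑ ≤ ‖c‖ₑ ^ 2 * L q := fun n q => by
    refine (enorm_convolution₃_le (t₁ n) (t₂ n) (t₃ n) q).trans ?_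
    simp only [hL, ltriple]
    gcongr <;> exact enorm_le_iff_norm_le.2 (norm_truncation_le _ n _)
  have key : ∀ φ : 𝓢(Plane, ℂ),
      Integrable (fun q : ℝ × ℝ => convolution₃ Z g₁ g₂ g₃ q *
        (𝓕⁻ φ) !₂[q.1 / (2 * Real.pi), q.2 / (2 * Real.pi)]) Z.spaceTimeFreqMeasure ∧
      ∫ p, (f₁ * c₂ * f₃) p * φ p = c *
        ∫ q, convolution₃ Z g₁ g₂ g₃ q * (𝓕⁻ φ) !₂[q.1 / (2 * Real.pi), q.2 / (2 * Real.pi)]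
          ∂Z.spaceTimeFreqMeasure := by
    intro φ
    set χ : ℝ × ℝ → ℂ := fun q => (𝓕⁻ φ) !₂[q.1 / (2 * Real.pi), q.2 / (2 * Real.pi)] with hχ
    have mχ : Measurable χ := (continuous_schwartzMap_div (𝓕⁻ φ)).measurable
    have hχ2 := lintegral_weight_mul_schwartzMap_lt_top Z hα₁ hα₂ (by linarith : 0 ≤ s) hε (𝓕⁻ φ)
    have hLχ : ∫⁻ q, L q * ‖χ q‖ₑ ∂Z.spaceTimeFreqMeasure < ∞ := by
      -- The two weights are inverse to each other, so Cauchy–Schwarz pairs the weighted `L²` bound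
      -- for L with the decay of χ.
      have h := lintegral_mul_sq_le Z.spaceTimeFreqMeasure
        (u := fun q => ENNReal.ofReal (bourgainWeight α s (-1 / 2 + ε) q) * L q)
        (v := fun q => ENNReal.ofReal (bourgainWeight α (-s) (1 / 2 - ε) q) * ‖χ q‖ₑ)
        (by fun_prop) (by fun_prop)
      have h' := h.trans_lt (ENNReal.mul_lt_top hL2 hχ2)
      rw [ENNReal.pow_lt_top_iff] at h'
      refine lt_of_eq_of_lt (lintegral_congr fun q => ?_) (h'.resolve_right (by norm_num))
      have e : ENNReal.ofReal (bourgainWeight α s (-1 / 2 + ε) q) *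
          ENNReal.ofReal (bourgainWeight α (-s) (1 / 2 - ε) q) = 1 := by
        rw [← ENNReal.ofReal_mul (bourgainWeight_pos _ _ _ _).le, bourgainWeight_mul,
          ← ENNReal.ofReal_one, ← bourgainWeight_zero α q]
        congr 2 <;> ring
      rw [mul_mul_mul_comm, e, one_mul]
    have ib : Integrable (fun q => (‖c‖ₑ ^ 2 * L q * ‖χ q‖ₑ).toReal) Z.spaceTimeFreqMeasure := by
      refine integrable_toReal_of_lintegral_ne_top (by fun_prop) ?_
      simp_rw [mul_assoc]
      rw [lintegral_const_mul _ (by fun_prop)]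
      exact ENNReal.mul_ne_top (by finiteness) hLχ.ne
    have hle : ∀ᵐ q ∂Z.spaceTimeFreqMeasure, ∀ x : ℂ, ‖x‖ₑ ≤ ‖c‖ₑ ^ 2 * L q →
        ‖x * χ q‖ ≤ (‖c‖ₑ ^ 2 * L q * ‖χ q‖ₑ).toReal := by
      filter_upwards [hLf] with q hq x hx
      rw [← toReal_enorm, enorm_mul]
      refine ENNReal.toReal_mono (by finiteness) ?_
      gcongr
    refine ⟨ib.mono' (mG.aestronglyMeasurable.mul mχ.aestronglyMeasurable) ?_, ?_⟩
    · filter_upwards [hle] with q hq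
      exact hq _ (enorm_convolution₃_le m₁ m₂ m₃ q)
    -- The truncated products are tested against φ in the plane and against χ in frequency. The two
    -- expressions agree for each n, hence so do their limits.
    · have l1 := tendsto_integral_mul_schwartzMap IF
        (fun n => by rw [eE]; exact integrable_extension (iE n)) Q φ
      have l2 : Tendsto (fun n => ∫ q, E n q * χ q ∂Z.spaceTimeFreqMeasure) atTop
          (𝓝 (∫ q, convolution₃ Z g₁ g₂ g₃ q * χ q ∂Z.spaceTimeFreqMeasure)) := by
        refine tendsto_integral_of_dominated_convergence _
          (fun n => (iE n).aestronglyMeasurable.mul mχ.aestronglyMeasurable) ib (fun n => ?_) ?_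
        · filter_upwards [hle] with q hq
          exact hq _ (hbound n q)
        · filter_upwards [hLf] with q hq
          exact (tendsto_convolution₃_truncation m₁ m₂ m₃ hq).mul_const _
      have l3 := l2.const_mul c
      simp only [eE] at l1
      simp only [hχ, hc, ← integral_extension_mul (iE _) φ] at l3
      exact tendsto_nhds_unique l1 l3
  obtain ⟨w, w₁, w₂, w₃⟩ := exists_isGivenBy_hasFourier IF key
  exact ⟨w, ⟨f₁, f₂, f₃, given F₁ i₁ M₁ T₁, given F₂ i₂ M₂ T₂, given F₃ i₃ M₃ T₃, w₁⟩, w₂, w₃⟩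

/-- The convolution lemmas need genuinely measurable functions, so the Fourier transform is replaced
by a measurable representative. -/
theorem exists_measurable_hasFourier {b : ℝ} {u : 𝓢'(Plane, ℂ)} (hu : u ∈ bourgainSpace Z α s b) :
    ∃ g : ℝ × ℝ → ℂ, Measurable g ∧ HasFourier Z u g ∧ normSq Z α s b g < ∞ ∧
      bourgainNorm Z α s b u = normSq Z α s b g ^ (1 / 2 : ℝ) := by
  obtain ⟨-, hu⟩ := hu
  have h := hu
  simp only [bourgainNorm, iInf_lt_iff] at h
  obtain ⟨g, hg, -⟩ := h
  have hm := hg.locallyIntegrable.aestronglyMeasurable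
  have hg' := hg.congr hm.ae_eq_mk
  have e : bourgainNorm Z α s b u = normSq Z α s b (hm.mk g) ^ (1 / 2 : ℝ) := by
    rw [hg'.bourgainNorm_eq, eLpNorm_bourgainWeight_mul]
    rfl
  refine ⟨_, hm.stronglyMeasurable_mk.measurable, hg', ?_, e⟩
  rw [e] at hu
  exact (ENNReal.rpow_lt_top_iff_of_pos (by norm_num)).1 hu

theorem trilinear_estimate (Z : SpaceDomain) (hα₁ : 1 < α) (hα₂ : α < 2) (hs : (2 - α) / 4 ≤ s)
    (hε : 0 < ε) (hε' : ε < 1 / 4) :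
    ∃ C : ℝ≥0, ∀ u₁ u₂ u₃ : 𝓢'(Plane, ℂ), u₁ ∈ bourgainSpace Z α s (1 / 2 + ε) →
      u₂ ∈ bourgainSpace Z α s (1 / 2 + ε) → u₃ ∈ bourgainSpace Z α s (1 / 2 + ε) →
      ∃ w : 𝓢'(Plane, ℂ), IsTripleProduct u₁ u₂ u₃ w ∧ w ∈ bourgainSpace Z α s (-1 / 2 + ε) ∧
        bourgainNorm Z α s (-1 / 2 + ε) w ≤ C * (bourgainNorm Z α s (1 / 2 + ε) u₁ *
          bourgainNorm Z α s (1 / 2 + ε) u₂ * bourgainNorm Z α s (1 / 2 + ε) u₃) := by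
  obtain ⟨C, hC⟩ := exists_trilinear_bound Z hα₁ hα₂ hs hε hε'
  set c : ℂ := ((2 * Real.pi : ℂ) ^ 2)⁻¹ with hc
  -- `convolution₃` carries the factor c² and C bounds squared norms, whence ‖c‖⁴ and the square
  -- root.
  refine ⟨(‖c‖₊ ^ 4 * C) ^ (1 / 2 : ℝ), fun u₁ u₂ u₃ hu₁ hu₂ hu₃ => ?_⟩
  obtain ⟨g₁, m₁, F₁, n₁, e₁⟩ := exists_measurable_hasFourier hu₁
  obtain ⟨g₂, m₂, F₂, n₂, e₂⟩ := exists_measurable_hasFourier hu₂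
  obtain ⟨g₃, m₃, F₃, n₃, e₃⟩ := exists_measurable_hasFourier hu₃
  obtain ⟨w, hw, Fw, Dw⟩ := exists_tripleProduct hα₁ hα₂ hs hε hε' m₁ m₂ m₃ n₁ n₂ n₃ F₁ F₂ F₃
  have mW := fun s b => measurable_bourgainWeight α s b
  have mL : Measurable (ltriple Z.spaceTimeFreqMeasure (fun q => ‖g₁ q‖ₑ) (fun q => ‖g₂ q‖ₑ)
    (fun q => ‖g₃ q‖ₑ)) := measurable_ltriple (by fun_prop) (by fun_prop) (by fun_prop)
  have hle : bourgainNorm Z α s (-1 / 2 + ε) w ≤ ((‖c‖₊ ^ 4 * C) ^ (1 / 2 : ℝ) : ℝ≥0) *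
      (bourgainNorm Z α s (1 / 2 + ε) u₁ *
        bourgainNorm Z α s (1 / 2 + ε) u₂ * bourgainNorm Z α s (1 / 2 + ε) u₃) := by
    rw [Fw.bourgainNorm_eq, eLpNorm_bourgainWeight_mul, e₁, e₂, e₃,
      ENNReal.coe_rpow_of_nonneg _ (by norm_num), ← ENNReal.mul_rpow_of_nonneg _ _ (by norm_num),
      ← ENNReal.mul_rpow_of_nonneg _ _ (by norm_num),
      ← ENNReal.mul_rpow_of_nonneg _ _ (by norm_num)]
    gcongr
    calc _ ≤ ∫⁻ q, ‖c‖ₑ ^ 4 * (ENNReal.ofReal (bourgainWeight α s (-1 / 2 + ε) q) *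
          ltriple Z.spaceTimeFreqMeasure (fun q => ‖g₁ q‖ₑ) (fun q => ‖g₂ q‖ₑ)
            (fun q => ‖g₃ q‖ₑ) q) ^ 2 ∂Z.spaceTimeFreqMeasure := by
          refine lintegral_mono fun q => ?_
          refine (pow_le_pow_left' (mul_le_mul' le_rfl (enorm_convolution₃_le m₁ m₂ m₃ q)) 2).trans
            (le_of_eq ?_)
          ring
      _ ≤ _ := by
          rw [lintegral_const_mul _ (by fun_prop)]
          push_cast
          rw [mul_assoc]
          refine mul_le_mul' le_rfl (hC g₁ g₂ g₃ m₁ m₂ m₃)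
  refine ⟨w, hw, ⟨Dw, hle.trans_lt ?_⟩, hle⟩
  exact ENNReal.mul_lt_top ENNReal.coe_lt_top
    (ENNReal.mul_lt_top (ENNReal.mul_lt_top hu₁.2 hu₂.2) hu₃.2)

end Trilinear

/-! ### The counterexample below the critical exponent -/

section Sharpness

theorem rpow_mem_Icc_of_mem_Icc {N k x : ℝ} (hN : 0 < N) (hk : 1 ≤ k) (h₁ : N / k ≤ x)
    (h₂ : x ≤ k * N) (s : ℝ) : x ^ s ∈ Set.Icc (k ^ (-|s|) * N ^ s) (k ^ |s| * N ^ s) := by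
  have hk0 : 0 < k := by linarith
  have hx : 0 < x := lt_of_lt_of_le (by positivity) h₁
  rcases le_total 0 s with hs | hs
  · rw [abs_of_nonneg hs]
    constructor
    · rw [Real.rpow_neg hk0.le, inv_mul_eq_div, ← Real.div_rpow hN.le hk0.le]
      exact Real.rpow_le_rpow (by positivity) h₁ hs
    · rw [← Real.mul_rpow hk0.le hN.le]
      exact Real.rpow_le_rpow hx.le h₂ hs
  · rw [abs_of_nonpos hs, neg_neg]
    constructor
    · rw [← Real.mul_rpow hk0.le hN.le]
      exact Real.rpow_le_rpow_of_nonpos hx h₂ hs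
    · rw [Real.rpow_neg hk0.le, inv_mul_eq_div, ← Real.div_rpow hN.le hk0.le]
      exact Real.rpow_le_rpow_of_nonpos (by positivity) h₁ hs

variable {Z : SpaceDomain} {α : ℝ}

/-- The remainder in the first order Taylor expansion of `x ^ α` at `N`. -/
theorem rpow_taylor_mem_Icc (hα₁ : 1 < α) (hα₂ : α < 2) {N x : ℝ} (hN : 0 < N) (hx : 0 < x) :
    |x| ^ α - N ^ α - α * N ^ (α - 1) * (x - N) ∈ Set.Icc 0 (2 * (N ^ (α - 2) * (x - N) ^ 2)) := by
  have h0 : 0 < α - 1 := by linarith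
  have b1 := rpow_bregman_of_nonneg hα₁ hα₂ hN.le hx.le
  have b2 := rpow_bregman_of_nonneg hα₁ hα₂ hx.le hN.le
  rw [abs_of_pos hx]
  have p1 : 0 ≤ (α - 1) * (x ^ (α / 2) - N ^ (α / 2)) ^ 2 := by positivity
  have p2 : 0 ≤ (α - 1) * (N ^ (α / 2) - x ^ (α / 2)) ^ 2 := by positivity
  refine ⟨by linarith, ?_⟩
  have hpow : ∀ y : ℝ, 0 < y → y ^ (α - 1) = y * y ^ (α - 2) := fun y hy => by
    nth_rewrite 2 [← Real.rpow_one y]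
    rw [← Real.rpow_add hy]
    congr 1; ring
  -- The remainders of the expansions at N and at x are both nonnegative and sum to α times this
  -- left side, which therefore bounds each. The inequality holds because x^(α-1) = x · x^(α-2) and
  -- x^(α-2) is decreasing.
  have hq : (x ^ (α - 1) - N ^ (α - 1)) * (x - N) ≤ N ^ (α - 2) * (x - N) ^ 2 := by
    rw [hpow x hx, hpow N hN]
    rcases le_total N x with h | h
    · have := Real.rpow_le_rpow_of_nonpos hN h (by linarith : α - 2 ≤ 0)
      nlinarith [mul_le_mul_of_nonneg_left this (mul_nonneg hx.le (sub_nonneg.2 h))]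
    · have := Real.rpow_le_rpow_of_nonpos hx h (by linarith : α - 2 ≤ 0)
      nlinarith [mul_le_mul_of_nonneg_left this (mul_nonneg hx.le (sub_nonneg.2 h))]
  have hr : 0 ≤ N ^ (α - 2) * (x - N) ^ 2 := by positivity
  nlinarith

/-- The set of frequencies with `a ≤ ξ ≤ b` at distance at most `R` from the curve `τ = |ξ|^α`. -/
def curveBox (α a b R : ℝ) : Set (ℝ × ℝ) := {q | q.2 ∈ Set.Icc a b ∧ |q.1 - |q.2| ^ α| ≤ R}

theorem measurableSet_curveBox (α a b R : ℝ) : MeasurableSet (curveBox α a b R) := by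
  have h1 : Measurable fun q : ℝ × ℝ => q.1 - |q.2| ^ α := by fun_prop
  exact (measurableSet_Icc.preimage measurable_snd).inter
    (measurableSet_le (continuous_abs.measurable.comp h1) measurable_const)

theorem norm_le_of_mem_curveBox (hα : 0 ≤ α) {a b R : ℝ} {q : ℝ × ℝ} (h : q ∈ curveBox α a b R) :
    ‖q‖ ≤ R + (|a| + |b|) ^ α + (|a| + |b|) := by
  have h2 : |q.2| ≤ |a| + |b| := by
    rw [abs_le]
    constructor
    · linarith [h.1.1, neg_abs_le a, abs_nonneg b]
    · linarith [h.1.2, le_abs_self b, abs_nonneg a]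
  have h3 : |q.2| ^ α ≤ (|a| + |b|) ^ α := Real.rpow_le_rpow (abs_nonneg _) h2 hα
  have h4 : |q.1| ≤ R + |q.2| ^ α := by
    have e := abs_add_le (q.1 - |q.2| ^ α) (|q.2| ^ α)
    rw [sub_add_cancel, abs_of_nonneg (by positivity : 0 ≤ |q.2| ^ α)] at e
    linarith [h.2]
  have h5 : 0 ≤ R := (abs_nonneg _).trans h.2
  rw [Prod.norm_def, Real.norm_eq_abs, Real.norm_eq_abs]
  have h6 : 0 ≤ (|a| + |b|) ^ α := by positivity
  exact max_le (by linarith [abs_nonneg a, abs_nonneg b]) (by linarith)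

theorem measure_curveBox (Z : SpaceDomain) (α a b R : ℝ) :
    Z.spaceTimeFreqMeasure (curveBox α a b R) =
      ENNReal.ofReal (2 * R) * Z.freqMeasure (Set.Icc a b) := by
  rw [SpaceDomain.spaceTimeFreqMeasure, Measure.prod_apply_symm (measurableSet_curveBox α a b R),
    ← setLIntegral_const, ← lintegral_indicator measurableSet_Icc]
  refine lintegral_congr fun x => ?_
  by_cases hx : x ∈ Set.Icc a b
  · rw [Set.indicator_of_mem hx, ← Real.volume_closedBall (|x| ^ α) R]
    congr 1
    ext t
    simp only [curveBox, Set.mem_preimage, Set.mem_ofPred_eq, hx, true_and, Metric.mem_closedBall,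
      Real.dist_eq]
  · rw [Set.indicator_of_notMem hx]
    convert measure_empty (μ := (volume : Measure ℝ))
    ext t
    simp only [curveBox, Set.mem_preimage, Set.mem_ofPred_eq, hx, false_and,
      Set.mem_empty_iff_false]

theorem freqMeasure_Icc_mem_Icc (Z : SpaceDomain) {a b : ℝ} (hab : a ≤ b) :
    Z.freqMeasure (Set.Icc a b) ∈
      Set.Icc (ENNReal.ofReal (b - a - 1)) (ENNReal.ofReal (b - a + 1)) := by
  cases Z with
  | line =>
    rw [SpaceDomain.freqMeasure, Real.volume_Icc]
    exact ⟨ENNReal.ofReal_le_ofReal (by linarith), ENNReal.ofReal_le_ofReal (by linarith)⟩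
  | circle =>
    have e : SpaceDomain.circle.freqMeasure (Set.Icc a b) =
        ENNReal.ofReal (((⌊b⌋ + 1 - ⌈a⌉).toNat : ℕ) : ℝ) := by
      rw [SpaceDomain.freqMeasure, Measure.map_apply (measurable_of_countable _) measurableSet_Icc,
        Int.preimage_Icc, ← Finset.coe_Icc, Measure.count_apply_finset, Int.card_Icc,
        ENNReal.ofReal_natCast]
    have h1 := Int.floor_le b
    have h2 := Int.lt_floor_add_one b
    have h3 := Int.le_ceil a
    have h4 := Int.ceil_lt_add_one a
    have h5 : ((⌊b⌋ + 1 - ⌈a⌉ : ℤ) : ℝ) = ⌊b⌋ + 1 - ⌈a⌉ := by push_cast; ring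
    have h6 : (((⌊b⌋ + 1 - ⌈a⌉).toNat : ℕ) : ℝ) = max ((⌊b⌋ + 1 - ⌈a⌉ : ℤ) : ℝ) 0 := by
      have : (((⌊b⌋ + 1 - ⌈a⌉).toNat : ℤ) : ℝ) = ((max (⌊b⌋ + 1 - ⌈a⌉) 0 : ℤ) : ℝ) := by
        rw [Int.toNat_eq_max]
      exact_mod_cast this
    rw [e, h6, h5]
    refine ⟨ENNReal.ofReal_le_ofReal (le_max_of_le_left (by linarith)),
      ENNReal.ofReal_le_ofReal (max_le (by linarith) (by linarith))⟩

theorem continuous_bourgainWeight (hα : 0 ≤ α) (s b : ℝ) : Continuous (bourgainWeight α s b) := by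
  have hb : Continuous bracket := by unfold bracket; fun_prop
  have h1 : Continuous fun q : ℝ × ℝ => |q.2| ^ α :=
    (continuous_snd.abs).rpow_const fun _ => Or.inr hα
  exact ((hb.comp continuous_snd).rpow_const fun q => Or.inl (bracket_pos _).ne').mul
    ((hb.comp (continuous_fst.sub h1)).rpow_const fun q => Or.inl (bracket_pos _).ne')

theorem normSq_lt_top_of_bounded (hα : 0 ≤ α) (s b : ℝ) {g : ℝ × ℝ → ℂ} {M R : ℝ}
    (hM : ∀ q, ‖g q‖ ≤ M) (hR : ∀ q, g q ≠ 0 → ‖q‖ ≤ R) : normSq Z α s b g < ∞ := by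
  obtain ⟨D, hD⟩ := (isCompact_closedBall (0 : ℝ × ℝ) R).exists_bound_of_continuousOn
    (continuous_bourgainWeight hα s b).continuousOn
  calc normSq Z α s b g ≤ ∫⁻ q, (Metric.closedBall (0 : ℝ × ℝ) R).indicator
        (fun _ => (ENNReal.ofReal D * ENNReal.ofReal M) ^ 2) q ∂Z.spaceTimeFreqMeasure := by
        refine lintegral_mono fun q => ?_
        by_cases hq : q ∈ Metric.closedBall (0 : ℝ × ℝ) R
        · rw [Set.indicator_of_mem hq, ← ofReal_norm]
          have := hM q
          have := (le_abs_self _).trans (hD q hq)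
          gcongr
        · have : g q = 0 := by
            by_contra h
            exact hq (mem_closedBall_zero_iff.2 (hR q h))
          simp [this]
    _ < ∞ := by
        rw [lintegral_indicator Metric.isClosed_closedBall.measurableSet, setLIntegral_const]
        exact ENNReal.mul_lt_top (by finiteness) (isCompact_closedBall _ _).measure_lt_top

/-- On such a box ⟨ξ⟩ lies in [N/4, 4N] and the modulation bracket in [1, 14]. The weight is thus
comparable to N^s for every modulation exponent, and the value of ε plays no role in the
counterexample. -/
theorem bourgainWeight_mem_Icc {N a b : ℝ} (hN : 1 ≤ N) (ha : N / 4 ≤ a) (hb : b ≤ 3 * N)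
    {R : ℝ} (hR : R ≤ 13) {q : ℝ × ℝ} (hq : q ∈ curveBox α a b R) (s t : ℝ) :
    bourgainWeight α s t q ∈
      Set.Icc (4 ^ (-|s|) * 14 ^ (-|t|) * N ^ s) (4 ^ |s| * 14 ^ |t| * N ^ s) := by
  have hN0 : 0 < N := by linarith
  have h2 : 0 ≤ q.2 := by linarith [hq.1.1]
  have k1 := rpow_mem_Icc_of_mem_Icc (x := bracket q.2) hN0 (by norm_num : (1 : ℝ) ≤ 4)
    (by rw [bracket, abs_of_nonneg h2]; linarith [hq.1.1])
    (by rw [bracket, abs_of_nonneg h2]; linarith [hq.1.2]) s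
  have k2 := rpow_mem_Icc_of_mem_Icc (x := bracket (q.1 - |q.2| ^ α)) one_pos
    (by norm_num : (1 : ℝ) ≤ 14) (by linarith [one_le_bracket (q.1 - |q.2| ^ α)])
    (by rw [bracket]; linarith [hq.2]) t
  rw [Real.one_rpow, mul_one, mul_one] at k2
  rw [bourgainWeight]
  have p1 := Real.rpow_pos_of_pos (bracket_pos q.2) s
  have p2 := Real.rpow_pos_of_pos (bracket_pos (q.1 - |q.2| ^ α)) t
  constructor
  · calc _ = 4 ^ (-|s|) * N ^ s * 14 ^ (-|t|) := by ring
      _ ≤ _ := mul_le_mul k1.1 k2.1 (by positivity) p1.le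
  · calc _ ≤ 4 ^ |s| * N ^ s * 14 ^ |t| := mul_le_mul k1.2 k2.2 p2.le (by positivity)
      _ = _ := by ring

/-- Tangent lines are respected by q - z₁ + z₂, so only errors accumulate. The normalisation N^(α-2)
L² = 1 keeps the Taylor remainders in [0, 2] for the three points and in [0, 8] for the combination,
which is at distance at most 2L from N. With three modulations of size 1 the worst case is 3 + 2 + 8
= 13. -/
theorem add_sub_mem_curveBox (hα₁ : 1 < α) (hα₂ : α < 2) {N L : ℝ} (hL : 0 < L) (hLN : L ≤ N / 4)
    (hNL : N ^ (α - 2) * L ^ 2 = 1) {q z₁ z₂ : ℝ × ℝ} (hq : q ∈ curveBox α N (N + L) 1)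
    (h₁ : z₁ ∈ curveBox α N (N + L) 1) (h₂ : z₂ ∈ curveBox α N (N + L) 1) :
    q - z₁ + z₂ ∈ curveBox α (N - L) (N + 2 * L) 13 := by
  have hN : 0 < N := by linarith
  have hNa : 0 < N ^ (α - 2) := by positivity
  obtain ⟨⟨q1, q2⟩, q3⟩ := hq
  obtain ⟨⟨a1, a2⟩, a3⟩ := h₁
  obtain ⟨⟨b1, b2⟩, b3⟩ := h₂
  have hr : ∀ x, N ≤ x → x ≤ N + L →
      |x| ^ α - N ^ α - α * N ^ (α - 1) * (x - N) ∈ Set.Icc 0 2 := by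
    intro x hx hx'
    obtain ⟨r1, r2⟩ := rpow_taylor_mem_Icc hα₁ hα₂ hN (by linarith : 0 < x)
    refine ⟨r1, r2.trans ?_⟩
    have : (x - N) ^ 2 ≤ L ^ 2 := by nlinarith
    nlinarith
  obtain ⟨r1, r2⟩ := hr q.2 q1 q2
  obtain ⟨s1, s2⟩ := hr z₁.2 a1 a2
  obtain ⟨t1, t2⟩ := hr z₂.2 b1 b2
  have hx : N - L ≤ q.2 - z₁.2 + z₂.2 ∧ q.2 - z₁.2 + z₂.2 ≤ N + 2 * L :=
    ⟨by linarith, by linarith⟩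
  obtain ⟨w1, w2⟩ := rpow_taylor_mem_Icc hα₁ hα₂ hN (by linarith : 0 < q.2 - z₁.2 + z₂.2)
  have w3 : N ^ (α - 2) * (q.2 - z₁.2 + z₂.2 - N) ^ 2 ≤ 4 := by
    have : (q.2 - z₁.2 + z₂.2 - N) ^ 2 ≤ 4 * L ^ 2 := by nlinarith
    nlinarith
  refine ⟨hx, ?_⟩
  simp only [Prod.fst_sub, Prod.fst_add, Prod.snd_sub, Prod.snd_add]
  rw [abs_le] at q3 a3 b3 ⊢
  constructor <;> linarith

/-- Take L = N^((2-α)/2). Then L² = N^(2-α) dominates any multiple of N^(4s) for large N, because s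
< (2-α)/4. -/
theorem sharpness_exists_large (hα₁ : 1 < α) (hα₂ : α < 2) {s : ℝ} (hs : s < (2 - α) / 4) (K : ℝ) :
    ∃ N L : ℝ, 1 ≤ N ∧ 2 ≤ L ∧ L ≤ N / 4 ∧ N ^ (α - 2) * L ^ 2 = 1 ∧ K * N ^ (4 * s) < L ^ 2 := by
  have h1 := (tendsto_rpow_atTop (by linarith : 0 < (2 - α) / 2)).eventually_ge_atTop 2
  have h2 := (tendsto_rpow_atTop (by linarith : 0 < α / 2)).eventually_ge_atTop 4
  have h3 := (tendsto_rpow_atTop (by linarith : 0 < 2 - α - 4 * s)).eventually_gt_atTop K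
  obtain ⟨N, hN1, hN2, hN3, hN⟩ := (h1.and (h2.and (h3.and (eventually_ge_atTop 1)))).exists
  have hN0 : 0 < N := by linarith
  have hsq : (N ^ ((2 - α) / 2)) ^ 2 = N ^ (2 - α) := by
    rw [← Real.rpow_natCast, ← Real.rpow_mul hN0.le]; congr 1; push_cast; ring
  refine ⟨N, N ^ ((2 - α) / 2), hN, hN1, ?_, ?_, ?_⟩
  · have : N ^ ((2 - α) / 2) * N ^ (α / 2) = N := by
      rw [← Real.rpow_add hN0, show (2 - α) / 2 + α / 2 = 1 by ring, Real.rpow_one]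
    nlinarith
  · rw [hsq, ← Real.rpow_add hN0]; simp
  · rw [hsq]
    calc K * N ^ (4 * s) < N ^ (2 - α - 4 * s) * N ^ (4 * s) := by gcongr
      _ = N ^ (2 - α) := by rw [← Real.rpow_add hN0]; congr 1; ring

theorem normSq_indicator_le {S : Set (ℝ × ℝ)} (hS : MeasurableSet S) {s b M : ℝ}
    (hM : ∀ q ∈ S, bourgainWeight α s b q ≤ M) :
    normSq Z α s b (S.indicator 1) ≤ ENNReal.ofReal M ^ 2 * Z.spaceTimeFreqMeasure S := by
  rw [← setLIntegral_const, ← lintegral_indicator hS]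
  refine lintegral_mono fun q => ?_
  by_cases hq : q ∈ S
  · rw [Set.indicator_of_mem hq, Set.indicator_of_mem hq]
    simp only [Pi.one_apply, enorm_one, mul_one]
    gcongr
    exact hM q hq
  · simp [Set.indicator_of_notMem hq]

theorem le_normSq {S : Set (ℝ × ℝ)} (hS : MeasurableSet S) {s b m : ℝ} {T : ℝ≥0∞}
    {g : ℝ × ℝ → ℂ} (hm : ∀ q ∈ S, m ≤ bourgainWeight α s b q) (hT : ∀ q ∈ S, T ≤ ‖g q‖ₑ) :
    (ENNReal.ofReal m * T) ^ 2 * Z.spaceTimeFreqMeasure S ≤ normSq Z α s b g := by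
  rw [← setLIntegral_const, ← lintegral_indicator hS]
  refine lintegral_mono fun q => ?_
  by_cases hq : q ∈ S
  · rw [Set.indicator_of_mem hq]
    have := hm q hq
    have := hT q hq
    gcongr
  · simp [Set.indicator_of_notMem hq]

theorem convolution₃_indicator_eq {S S₃ : Set (ℝ × ℝ)} (hS : MeasurableSet S) {q : ℝ × ℝ}
    (h : ∀ z₁ ∈ S, ∀ z₂ ∈ S, q - z₁ + z₂ ∈ S₃) :
    convolution₃ Z (S.indicator 1) (S.indicator 1) (S₃.indicator 1) q =
      (((2 * Real.pi : ℂ) ^ 2)⁻¹) ^ 2 * ((Z.spaceTimeFreqMeasure.real S ^ 2 : ℝ) : ℂ) := by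
  rw [convolution₃]
  congr 1
  have e : (fun z : (ℝ × ℝ) × (ℝ × ℝ) => (S.indicator 1 z.1 : ℂ) *
      starRingEnd ℂ (S.indicator 1 z.2) * S₃.indicator 1 (q - z.1 + z.2)) =
      (S ×ˢ S).indicator 1 := by
    ext z
    by_cases h1 : z.1 ∈ S <;> by_cases h2 : z.2 ∈ S
    · simp [Set.indicator, h1, h2, h _ h1 _ h2]
    · simp [Set.indicator, h1, h2]
    · simp [Set.indicator, h1, h2]
    · simp [Set.indicator, h1, h2]
  rw [e, integral_indicator (hS.prod hS)]
  simp only [Pi.one_apply, setIntegral_const, measureReal_prod_prod, Complex.real_smul, mul_one, sq]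

/-- Two inputs have transform 1_B and the third 1_{B₃}, where B₃ contains B - B + B. On B the output
transform is then constant, of size |B|². With |B| ≥ L and |B₃| ≤ 104 L, the squared inequality
would force L² ≤ K N^(4s). -/
theorem trilinear_estimate_fails (Z : SpaceDomain) (hα₁ : 1 < α) (hα₂ : α < 2) {s : ℝ}
    (hs : s < (2 - α) / 4) (ε : ℝ) (C : ℝ≥0) :
    ∃ u₁ u₂ u₃ w : 𝓢'(Plane, ℂ), u₁ ∈ bourgainSpace Z α s (1 / 2 + ε) ∧
      u₂ ∈ bourgainSpace Z α s (1 / 2 + ε) ∧ u₃ ∈ bourgainSpace Z α s (1 / 2 + ε) ∧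
      IsTripleProduct u₁ u₂ u₃ w ∧ w ∈ bourgainSpace Z α s (-1 / 2 + ε) ∧
      C * (bourgainNorm Z α s (1 / 2 + ε) u₁ * bourgainNorm Z α s (1 / 2 + ε) u₂ *
        bourgainNorm Z α s (1 / 2 + ε) u₃) < bourgainNorm Z α s (-1 / 2 + ε) w := by
  set c : ℂ := ((2 * Real.pi : ℂ) ^ 2)⁻¹ with hc
  have hc0 : 0 < ‖c‖ := by
    rw [norm_pos_iff, hc]
    simp [Real.pi_ne_zero]
  set M : ℝ := 4 ^ |s| * 14 ^ |1 / 2 + ε| with hM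
  set m : ℝ := 4 ^ (-|s|) * 14 ^ (-|-1 / 2 + ε|) with hm
  have hM0 : 0 < M := by positivity
  have hm0 : 0 < m := by positivity
  -- This threshold comes from the squared inequality at the end: M⁶ from three input norms, m² ‖c‖⁴
  -- from the output, and 104 from the measure of B₃.
  obtain ⟨N, L, hN, hL, hLN, hNL, hbig⟩ := sharpness_exists_large hα₁ hα₂ hs
    (104 * C ^ 2 * M ^ 6 / (m ^ 2 * ‖c‖ ^ 4))
  have hN0 : 0 < N := by linarith
  set B := curveBox α N (N + L) 1 with hB
  set B₃ := curveBox α (N - L) (N + 2 * L) 13 with hB₃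
  have mB : MeasurableSet B := measurableSet_curveBox _ _ _ _
  have mB₃ : MeasurableSet B₃ := measurableSet_curveBox _ _ _ _
  set ν := Z.spaceTimeFreqMeasure with hν
  have κ₁ := freqMeasure_Icc_mem_Icc Z (by linarith : N ≤ N + L)
  have κ₃ := freqMeasure_Icc_mem_Icc Z (by linarith : N - L ≤ N + 2 * L)
  -- An interval of length L contains at least L - 1 integers, and 2(L - 1) ≥ L because L ≥ 2.
  have hνB : ENNReal.ofReal L ≤ ν B := by
    rw [hB, measure_curveBox]
    calc ENNReal.ofReal L ≤ ENNReal.ofReal (2 * 1 * (N + L - N - 1)) :=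
          ENNReal.ofReal_le_ofReal (by linarith)
      _ = ENNReal.ofReal (2 * 1) * ENNReal.ofReal (N + L - N - 1) :=
          ENNReal.ofReal_mul (by norm_num)
      _ ≤ _ := by gcongr; exact κ₁.1
  have hνBf : ν B ≠ ∞ := by
    rw [hB, measure_curveBox]
    exact ENNReal.mul_ne_top ENNReal.ofReal_ne_top (ne_top_of_le_ne_top ENNReal.ofReal_ne_top κ₁.2)
  have hνB₃ : ν B₃ ≤ ENNReal.ofReal (104 * L) := by
    rw [hB₃, measure_curveBox]
    calc _ ≤ ENNReal.ofReal (2 * 13) * ENNReal.ofReal (N + 2 * L - (N - L) + 1) := by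
          gcongr; exact κ₃.2
      _ = ENNReal.ofReal (2 * 13 * (N + 2 * L - (N - L) + 1)) :=
          (ENNReal.ofReal_mul (by norm_num)).symm
      _ ≤ _ := ENNReal.ofReal_le_ofReal (by linarith)
  set V : ℝ := ν.real B with hV
  have hνV : ν B = ENNReal.ofReal V := (ENNReal.ofReal_toReal hνBf).symm
  have hVL : L ≤ V := by
    rw [hνV, ENNReal.ofReal_le_ofReal_iff measureReal_nonneg] at hνB
    exact hνB
  have hV0 : 0 < V := by linarith
  set g : ℝ × ℝ → ℂ := B.indicator 1 with hg
  set g₃ : ℝ × ℝ → ℂ := B₃.indicator 1 with hg₃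
  have mg : Measurable g := measurable_one.indicator mB
  have mg₃ : Measurable g₃ := measurable_one.indicator mB₃
  have ig : Integrable g ν := (integrable_indicator_iff mB).2 (integrableOn_const hνBf)
  have ig₃ : Integrable g₃ ν := (integrable_indicator_iff mB₃).2
    (integrableOn_const (ne_top_of_le_ne_top ENNReal.ofReal_ne_top hνB₃))
  obtain ⟨u, U₁, U₂, U₃⟩ := exists_isGivenBy_extension ig
  obtain ⟨u₃, W₁, W₂, W₃⟩ := exists_isGivenBy_extension ig₃
  obtain ⟨w, Y₁, Y₂, Y₃⟩ := exists_isGivenBy_extension (integrable_convolution₃ mg mg mg₃ ig ig ig₃)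
  have norm_eq : ∀ {v : 𝓢'(Plane, ℂ)} {h : ℝ × ℝ → ℂ} {b : ℝ}, HasFourier Z v h →
      bourgainNorm Z α s b v = normSq Z α s b h ^ (1 / 2 : ℝ) := fun hv => by
    rw [hv.bourgainNorm_eq, eLpNorm_bourgainWeight_mul]; rfl
  have mem : ∀ {v : 𝓢'(Plane, ℂ)} {h : ℝ × ℝ → ℂ} {b : ℝ}, HasFourier Z v h →
      normSq Z α s b h < ∞ → v ∈ bourgainSpace Z α s b := fun hv hf => by
    refine ⟨hv.isDistribution, ?_⟩
    rw [norm_eq hv]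
    exact ENNReal.rpow_lt_top_of_nonneg (by norm_num) hf.ne
  have n₁ : normSq Z α s (1 / 2 + ε) g ≤ ENNReal.ofReal ((M * N ^ s) ^ 2 * V) := by
    rw [ENNReal.ofReal_mul (by positivity), ENNReal.ofReal_pow (by positivity), ← hνV]
    exact normSq_indicator_le mB fun q hq => (bourgainWeight_mem_Icc hN (by linarith)
      (by linarith) (by norm_num) hq s (1 / 2 + ε)).2
  have n₃ : normSq Z α s (1 / 2 + ε) g₃ ≤ ENNReal.ofReal ((M * N ^ s) ^ 2 * (104 * L)) := by
    rw [ENNReal.ofReal_mul (by positivity), ENNReal.ofReal_pow (by positivity)]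
    refine (normSq_indicator_le mB₃ fun q hq => (bourgainWeight_mem_Icc hN (by linarith)
      (by linarith) le_rfl hq s (1 / 2 + ε)).2).trans ?_
    gcongr
  have hT : ∀ q ∈ B, ENNReal.ofReal (‖c‖ ^ 2 * V ^ 2) ≤ ‖convolution₃ Z g g g₃ q‖ₑ := fun q hq => by
    rw [hg, hg₃, convolution₃_indicator_eq mB fun z₁ h₁ z₂ h₂ =>
      add_sub_mem_curveBox hα₁ hα₂ (by linarith) hLN hNL hq h₁ h₂, ← ofReal_norm, norm_mul,
      Complex.norm_real, norm_pow, norm_pow, Real.norm_of_nonneg measureReal_nonneg]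
  have nw : ENNReal.ofReal ((m * N ^ s * (‖c‖ ^ 2 * V ^ 2)) ^ 2 * V) ≤
      normSq Z α s (-1 / 2 + ε) (convolution₃ Z g g g₃) := by
    refine le_of_eq_of_le ?_ (le_normSq mB (fun q hq => (bourgainWeight_mem_Icc hN (by linarith)
      (by linarith) (by norm_num) hq s (-1 / 2 + ε)).1) hT)
    rw [ENNReal.ofReal_mul (by positivity), ENNReal.ofReal_pow (by positivity), ← hνV,
      ENNReal.ofReal_mul (by positivity)]
  have fw : normSq Z α s (-1 / 2 + ε) (convolution₃ Z g g g₃) < ∞ := by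
    set R := 1 + (|N| + |N + L|) ^ α + (|N| + |N + L|)
    set R₃ := 13 + (|N - L| + |N + 2 * L|) ^ α + (|N - L| + |N + 2 * L|)
    refine normSq_lt_top_of_bounded (by linarith) _ _ (M := ‖c ^ 2‖ * V ^ 2)
      (R := R₃ + R + R) (fun q => ?_) fun q hq => ?_
    · rw [convolution₃, norm_mul]
      gcongr
      refine (norm_integral_le_of_norm_le (g := (B ×ˢ B).indicator 1) ?_
        (.of_forall fun z => ?_)).trans (le_of_eq ?_)
      · refine (integrable_indicator_iff (mB.prod mB)).2 (integrableOn_const ?_)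
        rw [Measure.prod_prod]
        finiteness
      · by_cases h1 : z.1 ∈ B <;> by_cases h2 : z.2 ∈ B
        · by_cases h3 : q - z.1 + z.2 ∈ B₃ <;> simp [hg, hg₃, Set.indicator, h1, h2, h3]
        · simp [hg, Set.indicator, h1, h2]
        · simp [hg, Set.indicator, h1]
        · simp [hg, Set.indicator, h1]
      · rw [integral_indicator_one (mB.prod mB), measureReal_prod_prod, sq]
    · by_contra hcon
      refine hq ?_
      rw [convolution₃, integral_eq_zero_of_ae (.of_forall fun z => ?_), mul_zero]
      by_contra hz
      have h1 : z.1 ∈ B := by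
        by_contra h
        exact hz (by simp [hg, Set.indicator_of_notMem h])
      have h2 : z.2 ∈ B := by
        by_contra h
        exact hz (by simp [hg, Set.indicator_of_notMem h])
      have h3 : q - z.1 + z.2 ∈ B₃ := by
        by_contra h
        exact hz (by simp [hg₃, Set.indicator_of_notMem h])
      refine hcon ?_
      have k1 := norm_le_of_mem_curveBox (by linarith) h1
      have k2 := norm_le_of_mem_curveBox (by linarith) h2
      have k3 := norm_le_of_mem_curveBox (by linarith) h3
      calc ‖q‖ = ‖q - z.1 + z.2 + z.1 - z.2‖ := by congr 1; abel
        _ ≤ ‖q - z.1 + z.2‖ + ‖z.1‖ + ‖z.2‖ :=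
          (norm_sub_le _ _).trans (by gcongr; exact norm_add_le _ _)
        _ ≤ _ := by gcongr
  have f₁ := n₁.trans_lt ENNReal.ofReal_lt_top
  refine ⟨u, u, u₃, w, mem U₂ f₁, mem U₂ f₁, mem W₂ (n₃.trans_lt ENNReal.ofReal_lt_top),
    ⟨_, _, _, U₁, U₁, W₁, ?_⟩, mem Y₂ fw, ?_⟩
  · have e : extension Z (convolution₃ Z g g g₃) = fun p =>
        extension Z g p * starRingEnd ℂ (extension Z g p) * extension Z g₃ p :=
      funext (extension_convolution₃ mg mg mg₃ ig ig ig₃)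
    rw [← e]
    exact Y₁
  · rw [norm_eq U₂, norm_eq W₂, norm_eq Y₂]
    have hC : (C : ℝ≥0∞) = ENNReal.ofReal ((C : ℝ) ^ 2) ^ (1 / 2 : ℝ) := by
      rw [ENNReal.ofReal_rpow_of_nonneg (by positivity) (by norm_num), ← Real.sqrt_eq_rpow,
        Real.sqrt_sq C.coe_nonneg, ENNReal.ofReal_coe_nnreal]
    rw [hC, ← ENNReal.mul_rpow_of_nonneg _ _ (by norm_num),
      ← ENNReal.mul_rpow_of_nonneg _ _ (by norm_num),
      ← ENNReal.mul_rpow_of_nonneg _ _ (by norm_num)]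
    refine ENNReal.rpow_lt_rpow ?_ (by norm_num)
    refine lt_of_lt_of_le (lt_of_le_of_lt (mul_le_mul' le_rfl (mul_le_mul' (mul_le_mul' n₁ n₁) n₃))
      ?_) nw
    rw [← ENNReal.ofReal_mul (by positivity), ← ENNReal.ofReal_mul (by positivity),
      ← ENNReal.ofReal_mul (by positivity), ENNReal.ofReal_lt_ofReal_iff (by positivity)]
    rw [div_mul_eq_mul_div, div_lt_iff₀ (by positivity)] at hbig
    have hN4 : N ^ (4 * s) = (N ^ s) ^ 4 := by
      rw [← Real.rpow_natCast, ← Real.rpow_mul hN0.le]; congr 1; push_cast; ring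
    rw [hN4] at hbig
    set x := N ^ s with hx
    have hx0 : 0 < x := by positivity
    calc (C : ℝ) ^ 2 * ((M * x) ^ 2 * V * ((M * x) ^ 2 * V) * ((M * x) ^ 2 * (104 * L)))
        = (104 * C ^ 2 * M ^ 6 * x ^ 4) * (x ^ 2 * V ^ 2 * L) := by ring
      _ < (L ^ 2 * (m ^ 2 * ‖c‖ ^ 4)) * (x ^ 2 * V ^ 2 * L) := by gcongr
      _ = (m * x * ‖c‖ ^ 2) ^ 2 * V ^ 2 * (L * L * L) := by ring
      -- The measure V of B enters squared on the input side and to the fifth power on the output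
      -- side, so the lower bound V ≥ L is enough.
      _ ≤ (m * x * ‖c‖ ^ 2) ^ 2 * V ^ 2 * (V * V * V) := by
        gcongr
      _ = _ := by ring

end Sharpness

end FractionalNLS

theorem proposition4p1 (Z : FractionalNLS.SpaceDomain) (α : ℝ) (hα₁ : 1 < α) (hα₂ : α < 2) :
    (∃ ε₀ : ℝ, 0 < ε₀ ∧ ∀ s : ℝ, (2 - α) / 4 ≤ s → ∀ ε : ℝ, 0 < ε → ε < ε₀ →
      ∃ C : ℝ≥0, ∀ u₁ u₂ u₃ : 𝓢'(FractionalNLS.Plane, ℂ),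
        u₁ ∈ FractionalNLS.bourgainSpace Z α s (1 / 2 + ε) →
        u₂ ∈ FractionalNLS.bourgainSpace Z α s (1 / 2 + ε) →
        u₃ ∈ FractionalNLS.bourgainSpace Z α s (1 / 2 + ε) →
        ∃ w : 𝓢'(FractionalNLS.Plane, ℂ), FractionalNLS.IsTripleProduct u₁ u₂ u₃ w ∧
          w ∈ FractionalNLS.bourgainSpace Z α s (-1 / 2 + ε) ∧
          FractionalNLS.bourgainNorm Z α s (-1 / 2 + ε) w ≤
            C * (FractionalNLS.bourgainNorm Z α s (1 / 2 + ε) u₁ *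
              FractionalNLS.bourgainNorm Z α s (1 / 2 + ε) u₂ *
              FractionalNLS.bourgainNorm Z α s (1 / 2 + ε) u₃)) ∧
    (∀ s : ℝ, s < (2 - α) / 4 → ∀ ε : ℝ, 0 < ε → ∀ C : ℝ≥0,
      ∃ u₁ u₂ u₃ w : 𝓢'(FractionalNLS.Plane, ℂ),
        u₁ ∈ FractionalNLS.bourgainSpace Z α s (1 / 2 + ε) ∧
        u₂ ∈ FractionalNLS.bourgainSpace Z α s (1 / 2 + ε) ∧
        u₃ ∈ FractionalNLS.bourgainSpace Z α s (1 / 2 + ε) ∧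
        FractionalNLS.IsTripleProduct u₁ u₂ u₃ w ∧
        w ∈ FractionalNLS.bourgainSpace Z α s (-1 / 2 + ε) ∧
        C * (FractionalNLS.bourgainNorm Z α s (1 / 2 + ε) u₁ *
          FractionalNLS.bourgainNorm Z α s (1 / 2 + ε) u₂ *
          FractionalNLS.bourgainNorm Z α s (1 / 2 + ε) u₃) <
            FractionalNLS.bourgainNorm Z α s (-1 / 2 + ε) w) :=
  -- The threshold 1/4 is what makes θ = 1 - 2ε exceed 1/2, so that (1+t²)^(-θ) is integrable.
  ⟨⟨1 / 4, by norm_num, fun _ hs _ hε hε' =>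
    FractionalNLS.trilinear_estimate Z hα₁ hα₂ hs hε hε'⟩,
    fun _ hs ε _ C => FractionalNLS.trilinear_estimate_fails Z hα₁ hα₂ hs ε C⟩
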